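/- For a Coxeter system $(W,S)$ with length function $\ell$ and $J\subseteq S$ let $W^J=\{w\in W:\ell(w)<\ell(ws)\ \text{for all } s\in J\}$. Order $W$ by the Bruhat order and its subsets by the induced order; for $u\le v$ write $[u,v]=\{z\in W:u\le z\le v\}$, and, if $u,v\in W^J$, $[u,v]^J=[u,v]\cap W^J$. Let $P_{u,v}\in\mathbb Z[q]$ be the Kazhdan–Lusztig polynomials of $(W,S)$, and, for $u,v\in W^J$ and $x\in\{-1,q\}$, let $P^{J,x}_{u,v}\in\mathbb Z[q]$ be Deodhar's parabolic Kazhdan–Lusztig polynomials of type $x$. Consider the following three assertions about Coxeter systems. (1) (Lusztig, Dyer) For all Coxeter systems $(W,S)$, $(W',S')$ and all $u\le v$ in $W$, $u'\le v'$ in $W'$: if the posets $[u,v]$ and $[u',v']$ are isomorphic, then $P_{u,v}=P_{u',v'}$. (2) (Marietti) For all Coxeter systems $(W,S)$, $(W',S')$, all $J\subseteq S$, $J'\subseteq S'$ and all $u\le v$ in $W^J$, $u'\le v'$ in $W'^{J'}$: if there exists a poset isomorphism $[u,v]^J\to[u',v']^{J'}$ which extends to a poset isomorphism $[u,v]\to[u',v']$,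 then $P^{J,x}_{u,v}=P^{J',x}_{u',v'}$ for all $x\in\{-1,q\}$. (3) Assertion (2) for maximal quotients only, i.e. for $J=S\setminus\{s\}$ and $J'=S'\setminus\{s'\}$ with $s\in S$ and $s'\in S'$. Theorem. The assertions (1), (2) and (3) are equivalent to each other. Moreover, let $\varnothing\ne X\subseteq\{3,4,5,\ldots\}\cup\{\infty\}$, and say that a Coxeter system $(W,S)$ with Coxeter matrix $m$ is of class $X$ if $m(s,t)\in X\cup\{1,2\}$ for all $s,t\in S$. Then the restrictions of (1), (2) and (3) to Coxeter systems $(W,S)$, $(W',S')$ of class $X$ are equivalent to each other. -/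

import Mathlib

open Polynomial

universe u

noncomputable section

namespace CoxeterSystem

/-! ### Bruhat order and minimal coset representatives -/

section Bruhat

variable {B : Type u} {W : Type u} [Group W] {M : CoxeterMatrix B} (cs : CoxeterSystem M W)

/-- The Bruhat order: the reflexive and transitive closure of the relation
`a → a * t`, for `t` a reflection with `ℓ(a) < ℓ(a * t)`. -/
def BruhatLE (a b : W) : Prop :=
  Relation.ReflTransGen
    (fun a b : W => ∃ t : W, cs.IsReflection t ∧ b = a * t ∧ cs.length a < cs.length b) a b

theorem BruhatLE.eq_or_length_lt {a b : W} (h : cs.BruhatLE a b) :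
    a = b ∨ cs.length a < cs.length b := by
  induction h with
  | refl => exact Or.inl rfl
  | tail _ hbc ih =>
    obtain ⟨t, _, _, hlt⟩ := hbc
    rcases ih with rfl | ih
    · exact Or.inr hlt
    · exact Or.inr (ih.trans hlt)

/-- The Bruhat order is a partial order on `W`. -/
theorem isPartialOrder_bruhatLE : IsPartialOrder W cs.BruhatLE where
  refl _ := Relation.ReflTransGen.refl
  trans _ _ _ h₁ h₂ := Relation.ReflTransGen.trans h₁ h₂
  antisymm a b h₁ h₂ := by
    rcases BruhatLE.eq_or_length_lt cs h₁ with h | h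
    · exact h
    · rcases BruhatLE.eq_or_length_lt cs h₂ with h' | h'
      · exact h'.symm
      · exact absurd (h.trans h') (lt_irrefl _)

/-- The Bruhat interval `[a, b]`. -/
def bruhatInterval (a b : W) : Set W := {z | cs.BruhatLE a z ∧ cs.BruhatLE z b}

/-- The quotient `W^J`, i.e. the set of all `w` with `ℓ(w) < ℓ(w s)` for every `s ∈ J`. -/
def minReps (J : Set B) : Set W := {w | ∀ i ∈ J, cs.length w < cs.length (w * cs.simple i)}

/-- The interval `[a, b]^J` of the quotient `W^J`. -/
def quotientInterval (J : Set B) (a b : W) : Set W :=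
  {z | z ∈ cs.minReps J ∧ z ∈ cs.bruhatInterval a b}

/-- The order induced by the Bruhat order on a subset of `W`. -/
def inducedOrder (A : Set W) (a b : A) : Prop := cs.BruhatLE a b

end Bruhat

/-! ### Kazhdan-Lusztig polynomials -/

section KL

variable {B : Type u} {W : Type u} [Group W] {M : CoxeterMatrix B} (cs : CoxeterSystem M W)

/-- The defining properties of the family of `R`-polynomials of a Coxeter system
(the variable `q` is `X`). -/
structure IsRFamily (R : W → W → ℤ[X]) : Prop where
  eq_zero : ∀ a b, ¬ cs.BruhatLE a b → R a b = 0
  diag : ∀ a, R a a = 1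
  descent : ∀ a b, cs.BruhatLE a b → a ≠ b → ∀ i, cs.IsLeftDescent b i →
    cs.IsLeftDescent a i →
      R a b = R (cs.simple i * a) (cs.simple i * b)
  ascent : ∀ a b, cs.BruhatLE a b → a ≠ b → ∀ i, cs.IsLeftDescent b i →
    ¬ cs.IsLeftDescent a i →
      R a b = (X - 1) * R (cs.simple i * a) b + X * R (cs.simple i * a) (cs.simple i * b)

/-- The `R`-polynomials `R_{a,b}`: the unique family with the defining properties. -/
def rPoly : W → W → ℤ[X] := Classical.epsilon cs.IsRFamily

/-- The defining properties of the family of Kazhdan-Lusztig polynomials.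
For a polynomial `p` of degree at most `n`, `p.reflect n` is `q ^ n * p(q⁻¹)`.
Bruhat intervals are finite, so that the sum is a finite sum. -/
structure IsKLFamily (P : W → W → ℤ[X]) : Prop where
  eq_zero : ∀ a b, ¬ cs.BruhatLE a b → P a b = 0
  diag : ∀ a, P a a = 1
  degree : ∀ a b, cs.BruhatLE a b → a ≠ b →
    2 * (P a b).natDegree + 1 ≤ cs.length b - cs.length a
  inversion : ∀ a b, cs.BruhatLE a b →
    (P a b).reflect (cs.length b - cs.length a) =
      ∑ᶠ z ∈ cs.bruhatInterval a b, cs.rPoly a z * P z b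

/-- The Kazhdan-Lusztig polynomials `P_{a,b}`: the unique family with the defining
properties. -/
def klPoly : W → W → ℤ[X] := Classical.epsilon cs.IsKLFamily

/-- The defining properties of the family of parabolic `R`-polynomials `R^{J,x}_{a,b}`,
for `a, b ∈ W^J`; the family is extended by zero to all `a, b ∈ W`. -/
structure IsParabolicRFamily (J : Set B) (x : ℤ[X]) (R : W → W → ℤ[X]) : Prop where
  eq_zero : ∀ a b, ¬ (a ∈ cs.minReps J ∧ b ∈ cs.minReps J ∧ cs.BruhatLE a b) → R a b = 0
  diag : ∀ a ∈ cs.minReps J, R a a = 1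
  descent : ∀ a ∈ cs.minReps J, ∀ b ∈ cs.minReps J, cs.BruhatLE a b → a ≠ b →
    ∀ i, cs.IsLeftDescent b i → cs.IsLeftDescent a i →
      R a b = R (cs.simple i * a) (cs.simple i * b)
  ascent_mem : ∀ a ∈ cs.minReps J, ∀ b ∈ cs.minReps J, cs.BruhatLE a b → a ≠ b →
    ∀ i, cs.IsLeftDescent b i → ¬ cs.IsLeftDescent a i → cs.simple i * a ∈ cs.minReps J →
      R a b = (X - 1) * R (cs.simple i * a) b + X * R (cs.simple i * a) (cs.simple i * b)
  ascent_notMem : ∀ a ∈ cs.minReps J, ∀ b ∈ cs.minReps J, cs.BruhatLE a b → a ≠ b →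
    ∀ i, cs.IsLeftDescent b i → ¬ cs.IsLeftDescent a i → cs.simple i * a ∉ cs.minReps J →
      R a b = (X - 1 - x) * R a (cs.simple i * b)

/-- The parabolic `R`-polynomials of type `x`: the unique family with the defining
properties, for `x = -1` and for `x = q`. -/
def parabolicRPoly (J : Set B) (x : ℤ[X]) : W → W → ℤ[X] :=
  Classical.epsilon (cs.IsParabolicRFamily J x)

/-- The defining properties of the family of parabolic Kazhdan-Lusztig polynomials
`P^{J,x}_{a,b}`, for `a, b ∈ W^J`; the family is extended by zero to all `a, b ∈ W`. -/
structure IsParabolicKLFamily (J : Set B) (x : ℤ[X]) (P : W → W → ℤ[X]) : Prop where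
  eq_zero : ∀ a b, ¬ (a ∈ cs.minReps J ∧ b ∈ cs.minReps J ∧ cs.BruhatLE a b) → P a b = 0
  diag : ∀ a ∈ cs.minReps J, P a a = 1
  degree : ∀ a ∈ cs.minReps J, ∀ b ∈ cs.minReps J, cs.BruhatLE a b → a ≠ b →
    2 * (P a b).natDegree + 1 ≤ cs.length b - cs.length a
  inversion : ∀ a ∈ cs.minReps J, ∀ b ∈ cs.minReps J, cs.BruhatLE a b →
    (P a b).reflect (cs.length b - cs.length a) =
      ∑ᶠ z ∈ cs.quotientInterval J a b, cs.parabolicRPoly J x a z * P z b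

/-- The parabolic Kazhdan-Lusztig polynomials of type `x`: the unique family with the
defining properties, for `x = -1` and for `x = q`. -/
def parabolicKLPoly (J : Set B) (x : ℤ[X]) : W → W → ℤ[X] :=
  Classical.epsilon (cs.IsParabolicKLFamily J x)

/-- There is a poset isomorphism `[a, b]^J ≃ [a', b']^{J'}` which extends to a poset
isomorphism `[a, b] ≃ [a', b']`. -/
def ExtendableIso {B' : Type u} {W' : Type u} [Group W'] {M' : CoxeterMatrix B'}
    (cs' : CoxeterSystem M' W') (J : Set B) (J' : Set B') (a b : W) (a' b' : W') : Prop :=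
  ∃ (φ : cs.inducedOrder (cs.quotientInterval J a b) ≃r
        cs'.inducedOrder (cs'.quotientInterval J' a' b'))
    (Φ : cs.inducedOrder (cs.bruhatInterval a b) ≃r
        cs'.inducedOrder (cs'.bruhatInterval a' b')),
    ∀ z : cs.quotientInterval J a b, (Φ ⟨z.1, z.2.2⟩ : W') = (φ z : W')

end KL

/-! ### The conjectures, restricted to a class of Coxeter systems -/

/-- The Coxeter systems whose Coxeter matrix has all its entries in `E ∪ {1, 2}`.
Mathlib encodes `m(s,t) = ∞` by the entry `0`. -/
def OfClass (E : Set ℕ∞) ⦃B : Type u⦄ (M : CoxeterMatrix B) : Prop :=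
  ∀ s t : B, (if M s t = 0 then (⊤ : ℕ∞) else (M s t : ℕ∞)) ∈ E ∪ {1, 2}

/-- The class of all Coxeter systems. -/
def AllSystems ⦃B : Type u⦄ (_ : CoxeterMatrix B) : Prop := True

/-- Combinatorial invariance of Kazhdan-Lusztig polynomials (Lusztig, Dyer), for the Coxeter
systems of the class `C`. -/
def LusztigDyerConjecture (C : ∀ ⦃B : Type u⦄, CoxeterMatrix B → Prop) : Prop :=
  ∀ (B B' W W' : Type u) [Group W] [Group W'] (M : CoxeterMatrix B) (M' : CoxeterMatrix B')
    (cs : CoxeterSystem M W) (cs' : CoxeterSystem M' W'), C M → C M' →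
    ∀ (a b : W) (a' b' : W'), cs.BruhatLE a b → cs'.BruhatLE a' b' →
      Nonempty (cs.inducedOrder (cs.bruhatInterval a b) ≃r
        cs'.inducedOrder (cs'.bruhatInterval a' b')) →
      cs.klPoly a b = cs'.klPoly a' b'

/-- Combinatorial invariance of parabolic Kazhdan-Lusztig polynomials (Marietti), for the
Coxeter systems of the class `C`. -/
def MariettiConjecture (C : ∀ ⦃B : Type u⦄, CoxeterMatrix B → Prop) : Prop :=
  ∀ (B B' W W' : Type u) [Group W] [Group W'] (M : CoxeterMatrix B) (M' : CoxeterMatrix B')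
    (cs : CoxeterSystem M W) (cs' : CoxeterSystem M' W'), C M → C M' →
    ∀ (J : Set B) (J' : Set B'), ∀ a ∈ cs.minReps J, ∀ b ∈ cs.minReps J,
      ∀ a' ∈ cs'.minReps J', ∀ b' ∈ cs'.minReps J', cs.BruhatLE a b → cs'.BruhatLE a' b' →
      cs.ExtendableIso cs' J J' a b a' b' →
      (cs.parabolicKLPoly J (-1) a b = cs'.parabolicKLPoly J' (-1) a' b' ∧
        cs.parabolicKLPoly J X a b = cs'.parabolicKLPoly J' X a' b')

/-- Marietti's conjecture for maximal quotients, `J = S \ {s}` and `J' = S' \ {s'}`, for the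
Coxeter systems of the class `C`. -/
def MaximalQuotientConjecture (C : ∀ ⦃B : Type u⦄, CoxeterMatrix B → Prop) : Prop :=
  ∀ (B B' W W' : Type u) [Group W] [Group W'] (M : CoxeterMatrix B) (M' : CoxeterMatrix B')
    (cs : CoxeterSystem M W) (cs' : CoxeterSystem M' W'), C M → C M' →
    ∀ (s : B) (s' : B'), ∀ a ∈ cs.minReps {s}ᶜ, ∀ b ∈ cs.minReps {s}ᶜ,
      ∀ a' ∈ cs'.minReps {s'}ᶜ, ∀ b' ∈ cs'.minReps {s'}ᶜ,
      cs.BruhatLE a b → cs'.BruhatLE a' b' →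
      cs.ExtendableIso cs' {s}ᶜ {s'}ᶜ a b a' b' →
      (cs.parabolicKLPoly {s}ᶜ (-1) a b = cs'.parabolicKLPoly {s'}ᶜ (-1) a' b' ∧
        cs.parabolicKLPoly {s}ᶜ X a b = cs'.parabolicKLPoly {s'}ᶜ X a' b')

end CoxeterSystem

end

/-!
All assertions are treated for a class `C` of Coxeter systems which is stable under adding a node
joined to all the others by edges with one fixed label `n ≥ 3`, possibly `∞`
(`CoxeterSystem.extendMatrix`). The class of all systems is stable for `n = 3`, and the class given
by `E` is stable for every label `n ∈ E`. The implication from parabolic quotients to maximal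
quotients is a specialization, and it remains to prove two implications.

*From ordinary to parabolic polynomials.* If Kazhdan–Lusztig polynomials are combinatorial
invariants then so are the `R`-polynomials, which are obtained from the Kazhdan–Lusztig polynomials
of all subintervals by solving the inversion formula (`IsIntervalIso.rPoly_eq`). By Deodhar's
formula, for `a, b ∈ W^J`,
`R^{J,x}_{a,b} = ∑ (-x) ^ (ℓ(z) - ℓ(a)) R_{z,b}`, where `z` runs over `[a, b] ∩ a W_J`
(`parabolicRPoly_eq_finsum`). The point is that this index set can be read off from the pair of
posets `[a, b]^J ⊆ [a, b]`: an element `z` of `[a, b]` is in `a W_J` if and only if `a` is the only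
element of `[a, b]^J` below `z`, because the projection `W → W^J` is order preserving
(`inv_mul_mem_parabolic_iff`). So the parabolic `R`-polynomials are invariant, and the parabolic
Kazhdan–Lusztig polynomials are determined by them recursively
(`IsIntervalIso.parabolicKLPoly_eq`).

*From maximal quotients to ordinary polynomials.* Let `s` be the node added to the diagram of `W`.
The map `w ↦ w s` (`extendMap`) identifies `W` with a set of minimal representatives of the
maximal quotient of the extended group by all simple reflections other than `s`, and `[a, b]` with
`[a s, b s] = [a s, b s]^J`. Under this identification, the recursions for the parabolic `R`- and
Kazhdan–Lusztig polynomials become those for the ordinary ones, so that by uniqueness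
`P_{a,b} = P^{J,x}_{as,bs}` (`parabolicKLPoly_extendMap`), and an isomorphism `[a, b] ≃ [a', b']`
transfers to the extended systems. That `W` embeds into the extended group and that `w s` is a
minimal representative are both read off from the positivity of roots in the geometric
representation (`rootRep_nonneg`).

Since all the polynomials are defined as the unique families with certain properties, existence
and uniqueness have to be proved as well. Existence of the `R`-polynomials comes from operators
on the free module on `W` which satisfy the relations of the Hecke algebra, and existence of the
parabolic ones comes from applying to the columns of the matrix `(R_{a,b})` the functionals of
Deodhar's formula. The Kazhdan–Lusztig polynomials then exist because the bar involution is an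
involution (`sum_parabolicRPoly_mul_reflect`). The tool for the combinatorics of `W` is the strong
exchange property (`strong_exchange`), which is obtained from the action of `W` on signed
reflections.
-/

noncomputable section

namespace CoxeterSystem

/-! ### The strong exchange property -/

section Exchange

variable {B : Type*} {W : Type*} [Group W] {M : CoxeterMatrix B} (cs : CoxeterSystem M W)

open Classical in
/-- The permutation `(t, e) ↦ (s t s, e + [t = s])` of `W × ℤ/2` attached to a simple
reflection `s`. On reflections `t` the second coordinate counts inversions modulo two. -/
def exchangePerm (i : B) : Equiv.Perm (W × ZMod 2) :=
  Function.Involutive.toPerm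
    (fun p => (cs.simple i * p.1 * cs.simple i, p.2 + if p.1 = cs.simple i then 1 else 0)) <| by
  rintro ⟨t, e⟩
  have h2 : (1 : ZMod 2) + 1 = 0 := by decide
  have h1 : cs.simple i * t * cs.simple i = cs.simple i ↔ t = cs.simple i := by
    constructor
    · intro h
      have := congrArg (fun z => cs.simple i * z) h
      simp only [mul_assoc, simple_mul_simple_cancel_left, simple_mul_simple_self] at this
      exact (mul_eq_one_iff_eq_inv.1 this).trans (cs.inv_simple i)
    · rintro rfl; simp
  by_cases h : t = cs.simple i
  · simp [h, add_assoc, h2]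
  · simp only [h1, h, if_false, add_zero]; simp [mul_assoc]

open Classical in
theorem exchangePerm_apply (i : B) (t : W) (e : ZMod 2) :
    cs.exchangePerm i (t, e) =
      (cs.simple i * t * cs.simple i, e + if t = cs.simple i then 1 else 0) := rfl

open Classical in
theorem exchangePerm_mul_pow_apply (i j : B) (n : ℕ) (t : W) (e : ZMod 2) :
    ((cs.exchangePerm i * cs.exchangePerm j) ^ n) (t, e) =
      ((cs.simple i * cs.simple j) ^ n * t * ((cs.simple i * cs.simple j) ^ n)⁻¹,
        e + ∑ k ∈ Finset.range (2 * n),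
          if t = ((cs.simple i * cs.simple j) ^ k)⁻¹ * cs.simple j then 1 else 0) := by
  set x := cs.simple i * cs.simple j with hx
  have hjx : ∀ k : ℕ, cs.simple j * x ^ k = (x ^ k)⁻¹ * cs.simple j := by
    intro k
    have h : cs.simple j * x * (cs.simple j)⁻¹ = x⁻¹ := by simp [hx, mul_assoc]
    have := conj_pow (a := cs.simple j) (b := x) (i := k)
    rw [h, inv_pow] at this
    rw [this]; simp [mul_assoc]
  induction n with
  | zero => simp
  | succ n ih =>
    rw [pow_succ', Equiv.Perm.mul_apply, ih, Equiv.Perm.mul_apply, exchangePerm_apply,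
      exchangePerm_apply, show 2 * (n + 1) = 2 * n + 1 + 1 by ring, Finset.sum_range_succ,
      Finset.sum_range_succ]
    have e1 : x ^ n * t * (x ^ n)⁻¹ = cs.simple j ↔ t = (x ^ (2 * n))⁻¹ * cs.simple j := by
      rw [mul_inv_eq_iff_eq_mul, hjx, two_mul, pow_add, mul_inv_rev, mul_assoc,
        ← eq_inv_mul_iff_mul_eq]
    have e2 : cs.simple j * (x ^ n * t * (x ^ n)⁻¹) * cs.simple j = cs.simple i ↔
        t = (x ^ (2 * n + 1))⁻¹ * cs.simple j := by
      have hi : cs.simple j * (x ^ n * t * (x ^ n)⁻¹) * cs.simple j = cs.simple i ↔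
          x ^ n * t * (x ^ n)⁻¹ = x⁻¹ * cs.simple j := by
        have hx' : x⁻¹ = cs.simple j * cs.simple i := by simp [hx]
        rw [hx']
        constructor
        · intro h; rw [← h]; simp [mul_assoc]
        · intro h; rw [h]; simp [mul_assoc]
      rw [hi, mul_inv_eq_iff_eq_mul, mul_assoc, hjx, show 2 * n + 1 = n + 1 + n by ring, pow_add,
        mul_inv_rev (x ^ (n + 1)), pow_succ, mul_inv_rev (x ^ n), ← mul_right_inj (x ^ n)⁻¹,
        inv_mul_cancel_left]
      simp only [← mul_assoc]
    refine Prod.ext ?_ ?_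
    · simp [pow_succ', hx, mul_assoc]
    · simp only [e1, e2]; ring

theorem isLiftable_exchangePerm : M.IsLiftable cs.exchangePerm := by
  classical
  intro i j
  ext1 ⟨t, e⟩
  rw [exchangePerm_mul_pow_apply, simple_mul_simple_pow, two_mul, Finset.sum_range_add]
  have h2 : ∀ a : ZMod 2, a + a = 0 := by decide
  simp only [pow_add, simple_mul_simple_pow, one_mul, h2]
  simp

/-- The homomorphism extending `exchangePerm` to `W`. -/
def exchangeHom : W →* Equiv.Perm (W × ZMod 2) := cs.lift ⟨_, cs.isLiftable_exchangePerm⟩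

open Classical in
theorem exchangeHom_wordProd (ω : List B) (t : W) (e : ZMod 2) :
    cs.exchangeHom (cs.wordProd ω) (t, e) =
      (cs.wordProd ω * t * (cs.wordProd ω)⁻¹, e + ((cs.rightInvSeq ω).count t : ℕ)) := by
  induction ω with
  | nil => simp
  | cons i ω ih =>
    have h : cs.exchangeHom (cs.simple i) = cs.exchangePerm i := by
      simp [exchangeHom]
    have h' : cs.wordProd ω * t * (cs.wordProd ω)⁻¹ = cs.simple i ↔
        (cs.wordProd ω)⁻¹ * cs.simple i * cs.wordProd ω = t := by
      constructor <;> rintro h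
      · rw [← h]; group
      · rw [← h]; group
    rw [wordProd_cons, map_mul, Equiv.Perm.mul_apply, ih, h, exchangePerm_apply, rightInvSeq,
      List.count_cons]
    refine Prod.ext ?_ ?_
    · simp [mul_assoc]
    · simp only [h', beq_iff_eq]
      split_ifs <;> push_cast <;> ring

/-- The parity of the number of times `t` occurs in the inversion sequence of a word for `w`. -/
def inversionParity (w t : W) : ZMod 2 := (cs.exchangeHom w (t, 0)).2

theorem exchangeHom_apply (w t : W) (e : ZMod 2) :
    cs.exchangeHom w (t, e) = (w * t * w⁻¹, e + cs.inversionParity w t) := by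
  classical
  obtain ⟨ω, rfl⟩ := cs.wordProd_surjective w
  simp [inversionParity, exchangeHom_wordProd]

theorem inversionParity_mul (w v t : W) :
    cs.inversionParity (w * v) t = cs.inversionParity v t + cs.inversionParity w (v * t * v⁻¹) := by
  have := cs.exchangeHom_apply (w * v) t 0
  rw [map_mul, Equiv.Perm.mul_apply, exchangeHom_apply, exchangeHom_apply] at this
  simpa using (congrArg Prod.snd this).symm

theorem inversionParity_one (t : W) : cs.inversionParity 1 t = 0 := by
  simp [inversionParity]

theorem inversionParity_simple (i : B) : cs.inversionParity (cs.simple i) (cs.simple i) = 1 := by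
  classical
  have := cs.exchangeHom_wordProd [i] (cs.simple i) 0
  simp only [wordProd_singleton, rightInvSeq_singleton] at this
  rw [inversionParity, this]; simp

theorem IsReflection.inversionParity_self {cs : CoxeterSystem M W} {t : W}
    (ht : cs.IsReflection t) : cs.inversionParity t t = 1 := by
  obtain ⟨u, i, rfl⟩ := ht
  have h := cs.inversionParity_mul u⁻¹ u (cs.simple i)
  rw [inv_mul_cancel, inversionParity_one] at h
  rw [inversionParity_mul, inversionParity_mul]
  simp only [inv_inv]
  rw [show u⁻¹ * (u * cs.simple i * u⁻¹) * u = cs.simple i by group,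
    show cs.simple i * cs.simple i * (cs.simple i)⁻¹ = cs.simple i by simp, inversionParity_simple]
  generalize cs.inversionParity u (cs.simple i) = a at *
  generalize cs.inversionParity u⁻¹ _ = b at *
  revert h; revert a b; decide

/-- The strong exchange property: multiplying by a reflection which shortens `π ω` amounts to
deleting a letter of the word `ω`. -/
theorem strong_exchange {ω : List B} {t : W} (ht : cs.IsReflection t)
    (h : cs.length (cs.wordProd ω * t) < cs.length (cs.wordProd ω)) :
    ∃ j < ω.length, cs.wordProd ω * t = cs.wordProd (ω.eraseIdx j) := by
  classical
  -- The parity of `w t` at `t` differs from that of `w`; if the latter were zero, then `t` would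
  -- occur in the inversion sequence of a reduced word of `w t`, and `w t t` would be shorter.
  have h1 : cs.inversionParity (cs.wordProd ω) t ≠ 0 := by
    intro h0
    have h1 : cs.inversionParity (cs.wordProd ω * t) t = 1 := by
      rw [inversionParity_mul, ht.inversionParity_self, mul_inv_cancel_right, h0, add_zero]
    obtain ⟨ω', hω', hw'⟩ := cs.exists_isReduced (cs.wordProd ω * t)
    have hmem : t ∈ cs.rightInvSeq ω' := by
      by_contra hn
      rw [hw', inversionParity, exchangeHom_wordProd, List.count_eq_zero.2 hn] at h1
      simp at h1
    have := (cs.isRightInversion_of_mem_rightInvSeq hω' hmem).2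
    rw [← hw', mul_assoc, ht.mul_self, mul_one] at this
    omega
  have hmem : t ∈ cs.rightInvSeq ω := by
    by_contra hn
    rw [inversionParity, exchangeHom_wordProd, List.count_eq_zero.2 hn] at h1
    simp at h1
  obtain ⟨j, hj, rfl⟩ := List.mem_iff_getElem.1 hmem
  rw [length_rightInvSeq] at hj
  refine ⟨j, hj, ?_⟩
  rw [← wordProd_mul_getD_rightInvSeq, List.getD_eq_getElem]

theorem exists_erase_of_isLeftDescent {ω : List B} {i : B}
    (h : cs.IsLeftDescent (cs.wordProd ω) i) :
    ∃ j < ω.length, cs.simple i * cs.wordProd ω = cs.wordProd (ω.eraseIdx j) := by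
  have ht : cs.IsReflection ((cs.wordProd ω)⁻¹ * cs.simple i * cs.wordProd ω) := by
    simpa using (cs.isReflection_simple i).conj (cs.wordProd ω)⁻¹
  have e : cs.wordProd ω * ((cs.wordProd ω)⁻¹ * cs.simple i * cs.wordProd ω) =
      cs.simple i * cs.wordProd ω := by group
  have := cs.strong_exchange (ω := ω) ht (by rw [e]; exact h)
  rwa [e] at this

end Exchange

/-! ### Parabolic subgroups and minimal coset representatives -/

section Parabolic

variable {B W : Type u} [Group W] {M : CoxeterMatrix B} (cs : CoxeterSystem M W)

/-- The parabolic subgroup `W_J` generated by the simple reflections in `J`. -/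
def parabolic (J : Set B) : Subgroup W := Subgroup.closure (cs.simple '' J)

theorem simple_mem_parabolic {J : Set B} {i : B} (hi : i ∈ J) : cs.simple i ∈ cs.parabolic J :=
  Subgroup.subset_closure ⟨i, hi, rfl⟩

theorem wordProd_mem_parabolic {J : Set B} {ω : List B} (h : ∀ i ∈ ω, i ∈ J) :
    cs.wordProd ω ∈ cs.parabolic J := by
  induction ω with
  | nil => simp
  | cons i ω ih =>
    rw [wordProd_cons]
    exact mul_mem (cs.simple_mem_parabolic (h i (by simp))) (ih fun j hj => h j (by simp [hj]))

theorem parabolic_empty : cs.parabolic ∅ = ⊥ := by simp [parabolic]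

theorem exists_isReduced_of_mem_parabolic {J : Set B} {w : W} (hw : w ∈ cs.parabolic J) :
    ∃ ω : List B, (∀ i ∈ ω, i ∈ J) ∧ cs.IsReduced ω ∧ w = cs.wordProd ω := by
  have key : ∀ i ∈ J, ∀ v : W,
      (∃ ω : List B, (∀ i ∈ ω, i ∈ J) ∧ cs.IsReduced ω ∧ v = cs.wordProd ω) →
      ∃ ω : List B, (∀ i ∈ ω, i ∈ J) ∧ cs.IsReduced ω ∧ cs.simple i * v = cs.wordProd ω := by
    rintro i hi v ⟨ω, hJ, hred, rfl⟩
    by_cases h : cs.IsLeftDescent (cs.wordProd ω) i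
    · obtain ⟨j, hj, he⟩ := cs.exists_erase_of_isLeftDescent h
      refine ⟨ω.eraseIdx j, fun k hk => hJ k (List.mem_of_mem_eraseIdx hk), ?_, he⟩
      have h1 := List.length_eraseIdx_of_lt hj
      have h2 := cs.isLeftDescent_iff.1 h
      rw [IsReduced, ← he, h1]
      rw [hred.eq] at h2
      omega
    · refine ⟨i :: ω, by simpa using ⟨hi, hJ⟩, ?_, (cs.wordProd_cons i ω).symm⟩
      have h2 := cs.not_isLeftDescent_iff.1 h
      rw [IsReduced, wordProd_cons, h2, hred.eq, List.length_cons]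
  induction hw using Subgroup.closure_induction_left with
  | one => exact ⟨[], by simp, by simp [IsReduced], by simp⟩
  | mul_left x hx y hy ih =>
    obtain ⟨i, hi, rfl⟩ := hx
    exact key i hi _ ih
  | inv_mul_cancel x hx y hy ih =>
    obtain ⟨i, hi, rfl⟩ := hx
    rw [inv_simple]
    exact key i hi _ ih

/-- If `a` is of minimal length in `a W_J` then lengths add in `a W_J`. -/
theorem length_mul_wordProd_of_le {J : Set B} {a : W}
    (ha : ∀ w ∈ cs.parabolic J, cs.length a ≤ cs.length (a * w)) (ω : List B)
    (hJ : ∀ i ∈ ω, i ∈ J) (hω : cs.IsReduced ω) :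
    cs.length (a * cs.wordProd ω) = cs.length a + ω.length := by
  induction ω using List.reverseRecOn with
  | nil => simp
  | append_singleton ω r ih =>
    have hred : cs.IsReduced ω := by simpa using hω.take ω.length
    have hJ' : ∀ i ∈ ω, i ∈ J := fun i hi => hJ i (by simp [hi])
    have hr : r ∈ J := hJ r (by simp)
    have ih := ih hJ' hred
    rw [wordProd_append, wordProd_singleton, ← mul_assoc, List.length_append,
      List.length_singleton, ← add_assoc, ← ih]
    rcases cs.length_mul_simple (a * cs.wordProd ω) r with h | h
    · exact h
    exfalso
    obtain ⟨α, hα, haα⟩ := cs.exists_isReduced a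
    have hlen : α.length = cs.length a := by rw [haα, hα.eq]
    obtain ⟨j, hj, he⟩ := cs.strong_exchange (ω := α ++ ω) (cs.isReflection_simple r) (by
      rw [wordProd_append, ← haα]; omega)
    rw [wordProd_append, ← haα] at he
    rw [List.length_append] at hj
    rcases lt_or_ge j α.length with hj' | hj'
    · rw [List.eraseIdx_append_of_lt_length hj', wordProd_append] at he
      have h1 : a * (cs.wordProd ω * cs.simple r * (cs.wordProd ω)⁻¹) =
          cs.wordProd (α.eraseIdx j) := by
        simp only [← mul_assoc, he, mul_inv_cancel_right]
      have h2 := ha _ (mul_mem (mul_mem (cs.wordProd_mem_parabolic hJ')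
        (cs.simple_mem_parabolic hr)) (inv_mem (cs.wordProd_mem_parabolic hJ')))
      rw [h1] at h2
      have h3 := cs.length_wordProd_le (α.eraseIdx j)
      have := List.length_eraseIdx_of_lt hj'
      omega
    · rw [List.eraseIdx_append_of_length_le hj', wordProd_append, ← haα, mul_assoc,
        mul_right_inj] at he
      have h1 := hω.eq
      rw [wordProd_append, wordProd_singleton, he] at h1
      have h3 := cs.length_wordProd_le (ω.eraseIdx (j - α.length))
      have := List.length_eraseIdx_of_lt (l := ω) (i := j - α.length) (by omega)
      simp at h1
      omega

theorem mem_minReps_of_le {J : Set B} {a : W}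
    (ha : ∀ w ∈ cs.parabolic J, cs.length a ≤ cs.length (a * w)) : a ∈ cs.minReps J := by
  intro i hi
  exact lt_of_le_of_ne (ha _ (cs.simple_mem_parabolic hi)) (cs.length_mul_simple_ne a i).symm

theorem exists_le_coset (J : Set B) (z : W) :
    ∃ a, a⁻¹ * z ∈ cs.parabolic J ∧ ∀ w ∈ cs.parabolic J, cs.length a ≤ cs.length (a * w) := by
  obtain ⟨w, hw, hmin⟩ := WellFounded.has_min (measure fun w : W => cs.length (z * w)).wf
    (cs.parabolic J : Set W) ⟨1, one_mem _⟩
  refine ⟨z * w, by simpa using hw, fun v hv => ?_⟩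
  have : ¬ cs.length (z * (w * v)) < cs.length (z * w) := hmin (w * v) (mul_mem hw hv)
  rw [mul_assoc z w v]
  omega

theorem length_le_of_mem_minReps {J : Set B} {a : W} (ha : a ∈ cs.minReps J) :
    ∀ w ∈ cs.parabolic J, cs.length a ≤ cs.length (a * w) := by
  obtain ⟨x, hx, hmin⟩ := cs.exists_le_coset J a
  obtain ⟨ω, hJ, hω, hw⟩ := cs.exists_isReduced_of_mem_parabolic hx
  have hax : a = x * cs.wordProd ω := by rw [← hw]; group
  rcases List.eq_nil_or_concat ω with rfl | ⟨ω, r, rfl⟩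
  · simp at hax; rwa [hax]
  · exfalso
    have h1 := ha r (hJ r (by simp))
    have h2 := cs.length_mul_wordProd_of_le hmin _ hJ hω
    rw [← hax] at h2
    have h3 : a * cs.simple r = x * cs.wordProd ω := by
      rw [hax, wordProd_concat]; simp [mul_assoc]
    have h4 := cs.length_mul_le x (cs.wordProd ω)
    have h5 := cs.length_wordProd_le ω
    rw [h3] at h1
    simp at h2
    omega

theorem length_mul_of_mem_minReps {J : Set B} {a w : W} (ha : a ∈ cs.minReps J)
    (hw : w ∈ cs.parabolic J) : cs.length (a * w) = cs.length a + cs.length w := by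
  obtain ⟨ω, hJ, hω, rfl⟩ := cs.exists_isReduced_of_mem_parabolic hw
  rw [cs.length_mul_wordProd_of_le (cs.length_le_of_mem_minReps ha) ω hJ hω, hω.eq]

theorem exists_minReps_coset (J : Set B) (z : W) :
    ∃ a ∈ cs.minReps J, a⁻¹ * z ∈ cs.parabolic J := by
  obtain ⟨a, h, hmin⟩ := cs.exists_le_coset J z
  exact ⟨a, cs.mem_minReps_of_le hmin, h⟩

theorem eq_of_mem_minReps {J : Set B} {a b : W} (ha : a ∈ cs.minReps J) (hb : b ∈ cs.minReps J)
    (h : a⁻¹ * b ∈ cs.parabolic J) : a = b := by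
  have h1 := cs.length_mul_of_mem_minReps ha h
  have h2 := cs.length_mul_of_mem_minReps hb (inv_mem h)
  simp only [mul_inv_cancel_left, mul_inv_rev, inv_inv] at h1 h2
  have : cs.length (a⁻¹ * b) = 0 := by omega
  exact (inv_mul_eq_one.1 (cs.length_eq_zero_iff.1 this))

/-- The minimal representative of the coset `z W_J`. -/
def minRep (J : Set B) (z : W) : W := (cs.exists_minReps_coset J z).choose

theorem minRep_mem (J : Set B) (z : W) : cs.minRep J z ∈ cs.minReps J :=
  (cs.exists_minReps_coset J z).choose_spec.1

theorem minRep_inv_mul_mem (J : Set B) (z : W) : (cs.minRep J z)⁻¹ * z ∈ cs.parabolic J :=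
  (cs.exists_minReps_coset J z).choose_spec.2

theorem minRep_eq_iff {J : Set B} {a z : W} (ha : a ∈ cs.minReps J) :
    cs.minRep J z = a ↔ a⁻¹ * z ∈ cs.parabolic J := by
  constructor
  · rintro rfl; exact cs.minRep_inv_mul_mem J z
  · intro h
    refine (cs.eq_of_mem_minReps ha (cs.minRep_mem J z) ?_).symm
    have := mul_mem h (inv_mem (cs.minRep_inv_mul_mem J z))
    simpa [mul_assoc] using this

theorem minRep_self {J : Set B} {a : W} (ha : a ∈ cs.minReps J) : cs.minRep J a = a :=
  (cs.minRep_eq_iff ha).2 (by simp)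

theorem minRep_mul {J : Set B} (z : W) {w : W} (hw : w ∈ cs.parabolic J) :
    cs.minRep J (z * w) = cs.minRep J z :=
  (cs.minRep_eq_iff (cs.minRep_mem J z)).2
    (by simpa [mul_assoc] using mul_mem (cs.minRep_inv_mul_mem J z) hw)

theorem minReps_empty : cs.minReps (∅ : Set B) = Set.univ := by
  simp [minReps]

theorem simple_mul_mem_minReps {J : Set B} {a : W} {i : B} (ha : a ∈ cs.minReps J)
    (h : cs.IsLeftDescent a i) : cs.simple i * a ∈ cs.minReps J := by
  intro r hr
  have h1 := ha r hr
  have h2 := cs.isLeftDescent_iff.1 h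
  have h3 := cs.length_simple_mul (a * cs.simple r) i
  have h4 := cs.length_mul_simple_ne (cs.simple i * a) r
  rw [mul_assoc] at h4 ⊢
  omega

/-- If `i` is not a descent of `a ∈ W^J` and `s_i a ∉ W^J`, then `s_i a = a s_r` for some
`r ∈ J`. -/
theorem exists_simple_mul_eq {J : Set B} {a : W} {i : B} (ha : a ∈ cs.minReps J)
    (h : ¬ cs.IsLeftDescent a i) (h' : cs.simple i * a ∉ cs.minReps J) :
    ∃ r ∈ J, cs.simple i * a = a * cs.simple r := by
  simp only [minReps, Set.mem_ofPred_eq, not_forall, not_lt] at h'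
  obtain ⟨r, hr, hle⟩ := h'
  refine ⟨r, hr, ?_⟩
  obtain ⟨α, hα, rfl⟩ := cs.exists_isReduced a
  have hlt := lt_of_le_of_ne hle (cs.length_mul_simple_ne _ r)
  rw [← wordProd_cons] at hlt ⊢
  obtain ⟨j, hj, he⟩ := cs.strong_exchange (ω := i :: α) (cs.isReflection_simple r) hlt
  rcases j with _ | j
  · simp only [List.eraseIdx_cons_zero] at he
    rw [← he]; simp
  · exfalso
    simp only [List.eraseIdx_cons_succ, wordProd_cons, mul_assoc, mul_right_inj] at he
    have h1 := ha r hr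
    rw [he, hα.eq] at h1
    have := cs.length_wordProd_le (α.eraseIdx j)
    simp only [List.length_cons] at hj
    have := List.length_eraseIdx_of_lt (l := α) (i := j) (by omega)
    omega

end Parabolic

/-! ### The Bruhat order -/

section BruhatOrder

variable {B W : Type u} [Group W] {M : CoxeterMatrix B} (cs : CoxeterSystem M W)

theorem bruhatLE_refl (a : W) : cs.BruhatLE a a := Relation.ReflTransGen.refl

variable {cs} in
theorem BruhatLE.trans {a b c : W} (h : cs.BruhatLE a b) (h' : cs.BruhatLE b c) :
    cs.BruhatLE a c := Relation.ReflTransGen.trans h h'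

theorem bruhatLE_antisymm {a b : W} (h : cs.BruhatLE a b) (h' : cs.BruhatLE b a) : a = b :=
  cs.isPartialOrder_bruhatLE.antisymm _ _ h h'

variable {cs} in
theorem BruhatLE.length_le {a b : W} (h : cs.BruhatLE a b) : cs.length a ≤ cs.length b := by
  rcases h.eq_or_length_lt with rfl | h
  · exact le_rfl
  · exact h.le

variable {cs} in
theorem BruhatLE.length_lt {a b : W} (h : cs.BruhatLE a b) (hne : a ≠ b) :
    cs.length a < cs.length b := (h.eq_or_length_lt).resolve_left hne

theorem bruhatLE_mul_reflection {a t : W} (ht : cs.IsReflection t)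
    (h : cs.length a < cs.length (a * t)) : cs.BruhatLE a (a * t) :=
  Relation.ReflTransGen.single ⟨t, ht, rfl, h⟩

theorem bruhatLE_reflection_mul {a t : W} (ht : cs.IsReflection t)
    (h : cs.length a < cs.length (t * a)) : cs.BruhatLE a (t * a) := by
  have := ht.conj a⁻¹
  have e : a * (a⁻¹ * t * a⁻¹⁻¹) = t * a := by group
  rw [← e] at h ⊢
  exact cs.bruhatLE_mul_reflection this h

theorem simple_mul_bruhatLE {a : W} {i : B} (h : cs.IsLeftDescent a i) :
    cs.BruhatLE (cs.simple i * a) a := by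
  have := cs.bruhatLE_reflection_mul (a := cs.simple i * a) (cs.isReflection_simple i)
  simp only [simple_mul_simple_cancel_left] at this
  exact this h

theorem bruhatLE_simple_mul {a : W} {i : B} (h : ¬ cs.IsLeftDescent a i) :
    cs.BruhatLE a (cs.simple i * a) := by
  refine cs.bruhatLE_reflection_mul (cs.isReflection_simple i) ?_
  have := cs.not_isLeftDescent_iff.1 h
  omega

theorem BruhatLE.inv {a b : W} (h : cs.BruhatLE a b) : cs.BruhatLE a⁻¹ b⁻¹ := by
  induction h with
  | refl => exact cs.bruhatLE_refl _
  | tail _ hbc ih =>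
    obtain ⟨t, ht, rfl, hlt⟩ := hbc
    refine ih.trans ?_
    rw [mul_inv_rev, ht.inv]
    refine cs.bruhatLE_reflection_mul ht ?_
    rw [← cs.length_inv (t * _)]
    simpa [ht.inv] using hlt

/-- An edge `a → a t` of the Bruhat graph is moved by a simple reflection to an edge or to a
point, or it is turned around, in which case it is an edge `a → s_i a`. -/
theorem simple_mul_edge {a t : W} (i : B) (ht : cs.IsReflection t)
    (h : cs.length a < cs.length (a * t)) :
    cs.BruhatLE (cs.simple i * a) (cs.simple i * (a * t)) ∨ a * t = cs.simple i * a := by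
  rcases lt_or_gt_of_ne (ht.length_mul_left_ne (cs.simple i * a)) with h' | h'
  · right
    obtain ⟨α, hα, rfl⟩ := cs.exists_isReduced a
    rw [← wordProd_cons] at h'
    obtain ⟨j, hj, he⟩ := cs.strong_exchange ht h'
    rcases j with _ | j
    · simp only [List.eraseIdx_cons_zero] at he
      rw [wordProd_cons, mul_assoc] at he
      rw [← simple_mul_simple_cancel_left cs (w := cs.wordProd α * t) i, he]
    · exfalso
      simp only [List.eraseIdx_cons_succ, wordProd_cons, mul_assoc, mul_right_inj] at he
      rw [he, hα.eq] at h
      have := cs.length_wordProd_le (α.eraseIdx j)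
      simp only [List.length_cons] at hj
      have := List.length_eraseIdx_of_lt (l := α) (i := j) (by omega)
      omega
  · left
    rw [← mul_assoc]
    exact cs.bruhatLE_mul_reflection ht h'

theorem BruhatLE.simple_mul_le_or {a b : W} (h : cs.BruhatLE a b) (i : B) :
    cs.BruhatLE (cs.simple i * a) b ∨ cs.BruhatLE (cs.simple i * a) (cs.simple i * b) := by
  induction h with
  | refl => exact Or.inr (cs.bruhatLE_refl _)
  | @tail c d _ hcd ih =>
    obtain ⟨t, ht, rfl, hlt⟩ := hcd
    rcases ih with ih | ih
    · exact Or.inl (ih.trans (cs.bruhatLE_mul_reflection ht hlt))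
    · rcases cs.simple_mul_edge i ht hlt with h1 | h1
      · exact Or.inr (ih.trans h1)
      · rw [← h1] at ih; exact Or.inl ih

theorem BruhatLE.le_simple_mul_or {a b : W} (h : cs.BruhatLE a b) (i : B) :
    cs.BruhatLE a (cs.simple i * b) ∨ cs.BruhatLE (cs.simple i * a) (cs.simple i * b) := by
  induction h using Relation.ReflTransGen.head_induction_on with
  | refl => exact Or.inr (cs.bruhatLE_refl _)
  | @head a c hac _ ih =>
    obtain ⟨t, ht, rfl, hlt⟩ := hac
    rcases ih with ih | ih
    · exact Or.inl ((cs.bruhatLE_mul_reflection ht hlt).trans ih)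
    · rcases cs.simple_mul_edge i ht hlt with h1 | h1
      · exact Or.inr (h1.trans ih)
      · rw [h1, simple_mul_simple_cancel_left] at ih; exact Or.inl ih

/-- Lifting property: from `a ≤ b` and `s b < b` follows `s a ≤ b`. -/
theorem simple_mul_le_of_isLeftDescent {a b : W} {i : B} (h : cs.BruhatLE a b)
    (hb : cs.IsLeftDescent b i) : cs.BruhatLE (cs.simple i * a) b := by
  rcases h.simple_mul_le_or cs i with h | h
  · exact h
  · exact h.trans (cs.simple_mul_bruhatLE hb)

/-- Lifting property: from `a ≤ b` and `a < s a` follows `a ≤ s b`. -/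
theorem le_simple_mul_of_not_isLeftDescent {a b : W} {i : B} (h : cs.BruhatLE a b)
    (ha : ¬ cs.IsLeftDescent a i) : cs.BruhatLE a (cs.simple i * b) := by
  rcases h.le_simple_mul_or cs i with h | h
  · exact h
  · exact (cs.bruhatLE_simple_mul ha).trans h

/-- Lifting property: from `a ≤ b` and `s a < a` follows `s a ≤ s b`. -/
theorem simple_mul_le_simple_mul {a b : W} {i : B} (h : cs.BruhatLE a b)
    (ha : cs.IsLeftDescent a i) : cs.BruhatLE (cs.simple i * a) (cs.simple i * b) := by
  rcases h.le_simple_mul_or cs i with h | h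
  · exact (cs.simple_mul_bruhatLE ha).trans h
  · exact h

theorem le_mul_simple_of_not_isRightDescent {a b : W} {i : B} (h : cs.BruhatLE a b)
    (ha : ¬ cs.IsRightDescent a i) : cs.BruhatLE a (b * cs.simple i) := by
  have := cs.le_simple_mul_of_not_isLeftDescent (h.inv cs) (cs.isLeftDescent_inv_iff.not.2 ha)
  simpa using this.inv cs

theorem finite_lower (b : W) : {z | cs.BruhatLE z b}.Finite := by
  induction hn : cs.length b using Nat.strong_induction_on generalizing b with
  | _ n ih =>
  by_cases hb : b = 1
  · subst hb
    refine (Set.finite_singleton 1).subset fun z hz => ?_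
    have := BruhatLE.length_le hz
    rw [length_one] at this
    exact cs.length_eq_zero_iff.1 (by omega)
  · obtain ⟨i, hi⟩ := cs.exists_leftDescent_of_ne_one hb
    have hf := ih _ (hn ▸ hi) (cs.simple i * b) rfl
    refine (hf.union (hf.image (cs.simple i * ·))).subset fun z hz => ?_
    by_cases h : cs.IsLeftDescent z i
    · exact Or.inr ⟨cs.simple i * z, cs.simple_mul_le_simple_mul hz h, by simp⟩
    · exact Or.inl (cs.le_simple_mul_of_not_isLeftDescent hz h)

theorem finite_bruhatInterval (a b : W) : (cs.bruhatInterval a b).Finite :=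
  (cs.finite_lower b).subset fun _ h => h.2

theorem finite_quotientInterval (J : Set B) (a b : W) : (cs.quotientInterval J a b).Finite :=
  (cs.finite_bruhatInterval a b).subset fun _ h => h.2

/-- Every interval with more than one element contains an atom whose length exceeds that of the
least element by one. -/
theorem exists_cover {a b : W} (h : cs.BruhatLE a b) (hne : a ≠ b) :
    ∃ z, cs.BruhatLE a z ∧ cs.BruhatLE z b ∧ cs.length z = cs.length a + 1 := by
  induction hn : cs.length b using Nat.strong_induction_on generalizing a b with
  | _ n ih =>
  have hb : b ≠ 1 := by
    rintro rfl
    have := h.length_lt hne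
    simp at this
  obtain ⟨i, hi⟩ := cs.exists_leftDescent_of_ne_one hb
  have hsb := cs.simple_mul_bruhatLE hi
  have hlt : cs.length (cs.simple i * b) < n := hn ▸ hi
  have hlen := cs.isLeftDescent_iff.1 hi
  by_cases ha : cs.IsLeftDescent a i
  · have hlena := cs.isLeftDescent_iff.1 ha
    obtain ⟨z, h1, h2, h3⟩ := ih _ hlt (cs.simple_mul_le_simple_mul h ha)
      (fun e => hne (by simpa using e)) rfl
    by_cases hz : cs.IsLeftDescent z i
    · have h4 := cs.simple_mul_le_of_isLeftDescent h1 hz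
      rw [simple_mul_simple_cancel_left] at h4
      have h5 : a = z := (h4.eq_or_length_lt).resolve_right (by omega)
      subst h5
      obtain ⟨z, h6, h7, h8⟩ := ih _ hlt h2 (fun e => by
        rw [e] at ha
        simp only [IsLeftDescent, simple_mul_simple_cancel_left] at ha
        omega) rfl
      exact ⟨z, h6, h7.trans hsb, h8⟩
    · have h4 := h1.trans (cs.bruhatLE_simple_mul hz)
      refine ⟨cs.simple i * z, ?_, cs.simple_mul_le_of_isLeftDescent (h2.trans hsb) hi, ?_⟩
      · have h5 : ¬ cs.IsLeftDescent (cs.simple i * a) i := by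
          simp only [IsLeftDescent, simple_mul_simple_cancel_left]; omega
        rcases h1.simple_mul_le_or cs i with h6 | h6
        · rw [simple_mul_simple_cancel_left] at h6
          exact h6.trans (cs.bruhatLE_simple_mul hz)
        · rwa [simple_mul_simple_cancel_left] at h6
      · have := cs.not_isLeftDescent_iff.1 hz
        omega
  · by_cases hab : a = cs.simple i * b
    · exact ⟨b, h, cs.bruhatLE_refl b, by rw [hab]; omega⟩
    · obtain ⟨z, h6, h7, h8⟩ := ih _ hlt (cs.le_simple_mul_of_not_isLeftDescent h ha) hab rfl
      exact ⟨z, h6, h7.trans hsb, h8⟩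

theorem minReps_not_isRightDescent {J : Set B} {y : W} (hy : y ∈ cs.minReps J) {i : B}
    (hi : i ∈ J) : ¬ cs.IsRightDescent y i := by
  have := hy i hi
  simp only [IsRightDescent]; omega

theorem bruhatLE_mul_of_mem_minReps {J : Set B} {a w : W} (ha : a ∈ cs.minReps J)
    (hw : w ∈ cs.parabolic J) : cs.BruhatLE a (a * w) := by
  obtain ⟨ω, hJ, hω, rfl⟩ := cs.exists_isReduced_of_mem_parabolic hw
  induction ω using List.reverseRecOn with
  | nil => simpa using cs.bruhatLE_refl a
  | append_singleton ω r ih =>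
    have hred : cs.IsReduced ω := by simpa using hω.take ω.length
    have hJ' : ∀ i ∈ ω, i ∈ J := fun i hi => hJ i (by simp [hi])
    refine (ih hJ' hred (cs.wordProd_mem_parabolic hJ')).trans ?_
    have h1 := cs.length_mul_of_mem_minReps ha (cs.wordProd_mem_parabolic hJ')
    have h2 := cs.length_mul_of_mem_minReps ha hw
    rw [hω.eq] at h2
    rw [hred.eq] at h1
    simp only [wordProd_append, wordProd_singleton, ← mul_assoc, List.length_append,
      List.length_singleton] at h2 ⊢
    exact cs.bruhatLE_mul_reflection (cs.isReflection_simple r) (by omega)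

theorem minRep_bruhatLE (J : Set B) (z : W) : cs.BruhatLE (cs.minRep J z) z := by
  have := cs.bruhatLE_mul_of_mem_minReps (cs.minRep_mem J z) (cs.minRep_inv_mul_mem J z)
  simpa using this

/-- For `y ∈ W^J`, the projection `W → W^J` preserves the elements above `y`. -/
theorem bruhatLE_minRep {J : Set B} {y z : W} (hy : y ∈ cs.minReps J) (h : cs.BruhatLE y z) :
    cs.BruhatLE y (cs.minRep J z) := by
  induction hn : cs.length z using Nat.strong_induction_on generalizing z with
  | _ n ih =>
  by_cases hz : z ∈ cs.minReps J
  · rwa [cs.minRep_self hz]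
  · simp only [minReps, Set.mem_ofPred_eq, not_forall, not_lt] at hz
    obtain ⟨r, hr, hle⟩ := hz
    rw [← cs.minRep_mul z (cs.simple_mem_parabolic hr)]
    exact ih _ (hn ▸ lt_of_le_of_ne hle (cs.length_mul_simple_ne z r))
      (cs.le_mul_simple_of_not_isRightDescent h (cs.minReps_not_isRightDescent hy hr)) rfl

/-- For `a ∈ W^J`, an element of `[a, b]` lies in the coset `a W_J` if and only if `a` is the only
element of `[a, b]^J` below it. -/
theorem inv_mul_mem_parabolic_iff {J : Set B} {a z : W} (ha : a ∈ cs.minReps J)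
    (haz : cs.BruhatLE a z) :
    a⁻¹ * z ∈ cs.parabolic J ↔
      ∀ y ∈ cs.minReps J, cs.BruhatLE a y → cs.BruhatLE y z → y = a := by
  rw [← cs.minRep_eq_iff ha]
  constructor
  · rintro h y hy hay hyz
    exact (cs.bruhatLE_antisymm hay (h ▸ cs.bruhatLE_minRep hy hyz)).symm
  · intro h
    exact h _ (cs.minRep_mem J z) (cs.bruhatLE_minRep ha haz) (cs.minRep_bruhatLE J z)

end BruhatOrder

/-! ### Hecke operators and the existence of the `R`-polynomials -/

section Hecke

/-- The basis vector at `w` of the free `ℤ[q]`-module on `W`. -/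
abbrev basisVec {W : Type*} (w : W) : W →₀ ℤ[X] := Finsupp.single w 1

theorem end_ext {W N : Type*} [AddCommGroup N] [Module ℤ[X] N]
    {f g : (W →₀ ℤ[X]) →ₗ[ℤ[X]] N} (h : ∀ w, f (basisVec w) = g (basisVec w)) : f = g := by
  refine Finsupp.lhom_ext' fun w => LinearMap.ext_ring ?_
  exact h w

variable {B W : Type u} [Group W] {M : CoxeterMatrix B} (cs : CoxeterSystem M W)

open Classical in
/-- The operator with `e_w ↦ (q - 1) e_w + e_{sw}` if `sw > w` and `e_w ↦ q e_{sw}` if `sw < w`;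
up to signs, it is `q` times the inverse of the left multiplication by the standard generator
`T_s` of the Hecke algebra. -/
def leftOp (i : B) : Module.End ℤ[X] (W →₀ ℤ[X]) :=
  Finsupp.linearCombination ℤ[X] fun w =>
    if cs.IsLeftDescent w i then (X : ℤ[X]) • basisVec (cs.simple i * w)
    else (X - 1 : ℤ[X]) • basisVec w + basisVec (cs.simple i * w)

open Classical in
/-- The analogue of `leftOp` for the right multiplication. -/
def rightOp (i : B) : Module.End ℤ[X] (W →₀ ℤ[X]) :=
  Finsupp.linearCombination ℤ[X] fun w =>
    if cs.IsRightDescent w i then (X : ℤ[X]) • basisVec (w * cs.simple i)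
    else (X - 1 : ℤ[X]) • basisVec w + basisVec (w * cs.simple i)

/-- The operator `leftOp - (q - 1)`, i.e. `q` times the inverse of `leftOp`. -/
def leftDualOp (i : B) : Module.End ℤ[X] (W →₀ ℤ[X]) := cs.leftOp i - (X - 1 : ℤ[X]) • 1

/-- The analogue of `leftDualOp` for the right multiplication. -/
def rightDualOp (i : B) : Module.End ℤ[X] (W →₀ ℤ[X]) := cs.rightOp i - (X - 1 : ℤ[X]) • 1

theorem leftOp_of_isLeftDescent {w : W} {i : B} (h : cs.IsLeftDescent w i) :
    cs.leftOp i (basisVec w) = (X : ℤ[X]) • basisVec (cs.simple i * w) := by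
  simp [leftOp, basisVec, h]

theorem leftOp_of_not_isLeftDescent {w : W} {i : B} (h : ¬ cs.IsLeftDescent w i) :
    cs.leftOp i (basisVec w) = (X - 1 : ℤ[X]) • basisVec w + basisVec (cs.simple i * w) := by
  simp [leftOp, basisVec, h]

theorem rightOp_of_isRightDescent {w : W} {i : B} (h : cs.IsRightDescent w i) :
    cs.rightOp i (basisVec w) = (X : ℤ[X]) • basisVec (w * cs.simple i) := by
  simp [rightOp, basisVec, h]

theorem rightOp_of_not_isRightDescent {w : W} {i : B} (h : ¬ cs.IsRightDescent w i) :
    cs.rightOp i (basisVec w) = (X - 1 : ℤ[X]) • basisVec w + basisVec (w * cs.simple i) := by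
  simp [rightOp, basisVec, h]

theorem leftDualOp_of_isLeftDescent {w : W} {i : B} (h : cs.IsLeftDescent w i) :
    cs.leftDualOp i (basisVec w) =
      (X : ℤ[X]) • basisVec (cs.simple i * w) - (X - 1 : ℤ[X]) • basisVec w := by
  rw [leftDualOp, LinearMap.sub_apply, cs.leftOp_of_isLeftDescent h]; rfl

theorem leftDualOp_of_not_isLeftDescent {w : W} {i : B} (h : ¬ cs.IsLeftDescent w i) :
    cs.leftDualOp i (basisVec w) = basisVec (cs.simple i * w) := by
  rw [leftDualOp, LinearMap.sub_apply, cs.leftOp_of_not_isLeftDescent h, LinearMap.smul_apply,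
    Module.End.one_apply, add_sub_cancel_left]

theorem rightDualOp_of_isRightDescent {w : W} {i : B} (h : cs.IsRightDescent w i) :
    cs.rightDualOp i (basisVec w) =
      (X : ℤ[X]) • basisVec (w * cs.simple i) - (X - 1 : ℤ[X]) • basisVec w := by
  rw [rightDualOp, LinearMap.sub_apply, cs.rightOp_of_isRightDescent h]; rfl

theorem rightDualOp_of_not_isRightDescent {w : W} {i : B} (h : ¬ cs.IsRightDescent w i) :
    cs.rightDualOp i (basisVec w) = basisVec (w * cs.simple i) := by
  rw [rightDualOp, LinearMap.sub_apply, cs.rightOp_of_not_isRightDescent h, LinearMap.smul_apply,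
    Module.End.one_apply, add_sub_cancel_left]

/-- Unless `s_i w = w s_j`, the left multiplication by `s_i` does not change whether `j` is a right
descent. -/
theorem isRightDescent_simple_mul {w : W} {i j : B}
    (h : cs.simple i * w ≠ w * cs.simple j) :
    cs.IsRightDescent (cs.simple i * w) j ↔ cs.IsRightDescent w j := by
  have hne := cs.length_mul_simple_ne (cs.simple i * w) j
  by_cases hd : cs.IsRightDescent w j
  · refine iff_of_true ?_ hd
    have := cs.simple_mul_edge (a := w * cs.simple j) i (cs.isReflection_simple j)
      (by simpa [IsRightDescent] using hd)
    rw [simple_mul_simple_cancel_right] at this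
    rcases this with h1 | h1
    · have := h1.length_le
      rw [← mul_assoc] at this
      exact lt_of_le_of_ne this hne
    · refine absurd ?_ h
      conv_lhs => rw [h1]
      simp
  · refine iff_of_false ?_ hd
    have hd' := cs.not_isRightDescent_iff.1 hd
    rcases cs.simple_mul_edge (a := w) i (cs.isReflection_simple j) (by omega) with h1 | h1
    · have := h1.length_le
      rw [← mul_assoc] at this
      simp only [IsRightDescent]; omega
    · exact absurd h1.symm h

theorem isLeftDescent_mul_simple {w : W} {i j : B}
    (h : cs.simple i * w ≠ w * cs.simple j) :
    cs.IsLeftDescent (w * cs.simple j) i ↔ cs.IsLeftDescent w i := by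
  rw [← isRightDescent_inv_iff, ← isRightDescent_inv_iff, mul_inv_rev, inv_simple]
  refine cs.isRightDescent_simple_mul fun e => h ?_
  have := congrArg (·⁻¹) e
  simpa using this.symm

theorem leftDualOp_comm_rightDualOp (i j : B) :
    Commute (cs.leftDualOp i) (cs.rightDualOp j) := by
  refine end_ext fun w => ?_
  simp only [Module.End.mul_apply]
  by_cases h : cs.simple i * w = w * cs.simple j
  · have hd : cs.IsLeftDescent w i ↔ cs.IsRightDescent w j := by
      simp [IsLeftDescent, IsRightDescent, h]
    by_cases hw : cs.IsLeftDescent w i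
    · have h1 : ¬ cs.IsLeftDescent (cs.simple i * w) i :=
        cs.isLeftDescent_iff_not_isLeftDescent_mul.1 hw
      have h2 : ¬ cs.IsRightDescent (w * cs.simple j) j :=
        cs.isRightDescent_iff_not_isRightDescent_mul.1 (hd.1 hw)
      rw [cs.leftDualOp_of_isLeftDescent hw, cs.rightDualOp_of_isRightDescent (hd.1 hw), map_sub,
        map_sub, map_smul, map_smul, map_smul, map_smul, cs.leftDualOp_of_isLeftDescent hw,
        cs.rightDualOp_of_isRightDescent (hd.1 hw), h, cs.rightDualOp_of_not_isRightDescent h2,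
        ← h, cs.leftDualOp_of_not_isLeftDescent h1, h]
      simp
      rw [← h]; simp
    · have h1 : cs.IsLeftDescent (cs.simple i * w) i := by
        by_contra h1; exact hw (cs.isLeftDescent_iff_not_isLeftDescent_mul.2 h1)
      have h2 : cs.IsRightDescent (w * cs.simple j) j := by
        by_contra h1; exact hw (hd.2 (cs.isRightDescent_iff_not_isRightDescent_mul.2 h1))
      rw [cs.leftDualOp_of_not_isLeftDescent hw,
        cs.rightDualOp_of_not_isRightDescent (mt hd.2 hw),
        h, cs.rightDualOp_of_isRightDescent h2, ← h, cs.leftDualOp_of_isLeftDescent h1]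
      simp
      rw [h]; simp
  · have hl := cs.isLeftDescent_mul_simple h
    have hr := cs.isRightDescent_simple_mul h
    by_cases h1 : cs.IsLeftDescent w i <;> by_cases h2 : cs.IsRightDescent w j
    · simp only [cs.leftDualOp_of_isLeftDescent h1, cs.rightDualOp_of_isRightDescent h2, map_sub,
        map_smul, cs.leftDualOp_of_isLeftDescent (hl.2 h1),
        cs.rightDualOp_of_isRightDescent (hr.2 h2), mul_assoc, smul_sub, smul_smul]
      simp only [mul_comm (X : ℤ[X])]
      abel
    · simp only [cs.leftDualOp_of_isLeftDescent h1, cs.rightDualOp_of_not_isRightDescent h2,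
        map_sub, map_smul, cs.leftDualOp_of_isLeftDescent (hl.2 h1),
        cs.rightDualOp_of_not_isRightDescent (mt hr.1 h2), mul_assoc]
    · simp only [cs.leftDualOp_of_not_isLeftDescent h1, cs.rightDualOp_of_isRightDescent h2,
        map_sub, map_smul, cs.leftDualOp_of_not_isLeftDescent (mt hl.1 h1),
        cs.rightDualOp_of_isRightDescent (hr.2 h2), mul_assoc]
    · simp only [cs.leftDualOp_of_not_isLeftDescent h1, cs.rightDualOp_of_not_isRightDescent h2,
        cs.leftDualOp_of_not_isLeftDescent (mt hl.1 h1),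
        cs.rightDualOp_of_not_isRightDescent (mt hr.1 h2), mul_assoc]

theorem leftOp_eq (i : B) : cs.leftOp i = cs.leftDualOp i + (X - 1 : ℤ[X]) • 1 := by
  exact (sub_add_cancel (cs.leftOp i) _).symm

theorem rightOp_eq (i : B) : cs.rightOp i = cs.rightDualOp i + (X - 1 : ℤ[X]) • 1 := by
  exact (sub_add_cancel (cs.rightOp i) _).symm

theorem leftOp_comm_rightOp (i j : B) : Commute (cs.leftOp i) (cs.rightOp j) := by
  rw [leftOp_eq, rightOp_eq]
  exact ((cs.leftDualOp_comm_rightDualOp i j).add_right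
    ((Commute.one_right _).smul_right _)).add_left ((Commute.one_left _).smul_left _)

theorem leftOp_mul_leftDualOp (i : B) :
    cs.leftOp i * cs.leftDualOp i = (X : ℤ[X]) • 1 := by
  refine end_ext fun w => ?_
  rw [Module.End.mul_apply, LinearMap.smul_apply, Module.End.one_apply]
  by_cases h : cs.IsLeftDescent w i
  · rw [cs.leftDualOp_of_isLeftDescent h, map_sub, map_smul, map_smul,
      cs.leftOp_of_isLeftDescent h, cs.leftOp_of_not_isLeftDescent
        (cs.isLeftDescent_iff_not_isLeftDescent_mul.1 h), simple_mul_simple_cancel_left,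
      smul_add, smul_smul, smul_smul, mul_comm]
    abel
  · have h1 : cs.IsLeftDescent (cs.simple i * w) i := by
      by_contra h1; exact h (cs.isLeftDescent_iff_not_isLeftDescent_mul.2 h1)
    rw [cs.leftDualOp_of_not_isLeftDescent h, cs.leftOp_of_isLeftDescent h1,
      simple_mul_simple_cancel_left]

theorem leftOp_comm_leftDualOp (i : B) : Commute (cs.leftOp i) (cs.leftDualOp i) := by
  rw [leftOp_eq]
  exact (Commute.refl _).add_left ((Commute.one_left _).smul_left _)

theorem leftDualOp_mul_leftOp (i : B) :
    cs.leftDualOp i * cs.leftOp i = (X : ℤ[X]) • 1 := by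
  rw [← leftOp_mul_leftDualOp]; exact (cs.leftOp_comm_leftDualOp i).symm.eq

/-- The product of the operators `leftDualOp` along a word. -/
def wordDualOp (ω : List B) : Module.End ℤ[X] (W →₀ ℤ[X]) := (ω.map cs.leftDualOp).prod

/-- The product of the operators `leftOp` along a word. -/
def wordOp (ω : List B) : Module.End ℤ[X] (W →₀ ℤ[X]) := (ω.map cs.leftOp).prod

theorem wordDualOp_apply_one {ω : List B} (hω : cs.IsReduced ω) :
    cs.wordDualOp ω (basisVec 1) = basisVec (cs.wordProd ω) := by
  induction ω with
  | nil => simp [wordDualOp]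
  | cons i ω ih =>
    have h1 : cs.IsReduced ω := by simpa using hω.drop 1
    have h2 : ¬ cs.IsLeftDescent (cs.wordProd ω) i := by
      have := hω.eq
      rw [wordProd_cons, List.length_cons] at this
      have := h1.eq
      simp only [IsLeftDescent]; omega
    have := ih h1
    simp only [wordDualOp, List.map_cons, List.prod_cons, Module.End.mul_apply] at this ⊢
    rw [this, cs.leftDualOp_of_not_isLeftDescent h2, wordProd_cons]

theorem wordDualOp_comm (ω : List B) (j : B) :
    Commute (cs.wordDualOp ω) (cs.rightDualOp j) := by
  refine Commute.list_prod_left _ _ fun x hx => ?_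
  obtain ⟨i, _, rfl⟩ := List.mem_map.1 hx
  exact cs.leftDualOp_comm_rightDualOp i j

theorem wordOp_comm (ω : List B) (j : B) : Commute (cs.wordOp ω) (cs.rightOp j) := by
  refine Commute.list_prod_left _ _ fun x hx => ?_
  obtain ⟨i, _, rfl⟩ := List.mem_map.1 hx
  exact cs.leftOp_comm_rightOp i j

/-- An operator commuting with all right operators is determined by its value at `e_1`. Hence
`wordDualOp ω`, for a reduced word `ω`, depends only on the product of `ω`. -/
theorem wordDualOp_eq {ω ω' : List B} (hω : cs.IsReduced ω) (hω' : cs.IsReduced ω')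
    (h : cs.wordProd ω = cs.wordProd ω') : cs.wordDualOp ω = cs.wordDualOp ω' := by
  refine end_ext fun w => ?_
  induction hn : cs.length w using Nat.strong_induction_on generalizing w with
  | _ n ih =>
  by_cases hw : w = 1
  · rw [hw, cs.wordDualOp_apply_one hω, cs.wordDualOp_apply_one hω', h]
  · obtain ⟨j, hj⟩ := cs.exists_rightDescent_of_ne_one hw
    have hj' := cs.isRightDescent_iff_not_isRightDescent_mul.1 hj
    have hb : basisVec w = cs.rightDualOp j (basisVec (w * cs.simple j)) := by
      rw [cs.rightDualOp_of_not_isRightDescent hj', simple_mul_simple_cancel_right]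
    rw [hb, ← Module.End.mul_apply, ← Module.End.mul_apply, (cs.wordDualOp_comm ω j).eq,
      (cs.wordDualOp_comm ω' j).eq, Module.End.mul_apply, Module.End.mul_apply,
      ih _ (hn ▸ hj) _ rfl]

theorem wordOp_mul_wordDualOp_reverse (ω : List B) :
    cs.wordOp ω * cs.wordDualOp ω.reverse = (X ^ ω.length : ℤ[X]) • 1 := by
  induction ω with
  | nil => simp [wordOp, wordDualOp]
  | cons i ω ih =>
    simp only [wordOp, wordDualOp, List.map_cons, List.prod_cons, List.reverse_cons,
      List.map_append, List.prod_append, List.map_nil, List.prod_nil, mul_one] at ih ⊢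
    rw [mul_assoc, ← mul_assoc _ _ (cs.leftDualOp i), ih, smul_mul_assoc, one_mul, mul_smul_comm,
      leftOp_mul_leftDualOp, smul_smul, List.length_cons, pow_succ]

theorem wordDualOp_reverse_mul_wordOp (ω : List B) :
    cs.wordDualOp ω.reverse * cs.wordOp ω = (X ^ ω.length : ℤ[X]) • 1 := by
  induction ω with
  | nil => simp [wordOp, wordDualOp]
  | cons i ω ih =>
    simp only [wordOp, wordDualOp, List.map_cons, List.prod_cons, List.reverse_cons,
      List.map_append, List.prod_append, List.map_nil, List.prod_nil, mul_one] at ih ⊢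
    rw [mul_assoc, ← mul_assoc (cs.leftDualOp i), leftDualOp_mul_leftOp, smul_mul_assoc, one_mul,
      mul_smul_comm, ih, smul_smul, List.length_cons, pow_succ']

/-- `wordOp ω * wordDualOp ω.reverse` is a power of `q`, so the uniqueness for `wordDualOp` carries
over to `wordOp`. -/
theorem wordOp_eq {ω ω' : List B} (hω : cs.IsReduced ω) (hω' : cs.IsReduced ω')
    (h : cs.wordProd ω = cs.wordProd ω') : cs.wordOp ω = cs.wordOp ω' := by
  have hlen : ω'.length = ω.length := by rw [← hω.eq, ← hω'.eq, h]
  have h1 : cs.wordDualOp ω.reverse = cs.wordDualOp ω'.reverse :=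
    cs.wordDualOp_eq hω.reverse hω'.reverse (by simp [h])
  have h2 := cs.wordOp_mul_wordDualOp_reverse ω
  have h3 := cs.wordDualOp_reverse_mul_wordOp ω'
  have h4 : (X ^ ω.length : ℤ[X]) • cs.wordOp ω = (X ^ ω.length : ℤ[X]) • cs.wordOp ω' := by
    calc (X ^ ω.length : ℤ[X]) • cs.wordOp ω
        = cs.wordOp ω * (cs.wordDualOp ω'.reverse * cs.wordOp ω') := by
          rw [h3, hlen, mul_smul_comm, mul_one]
      _ = (X ^ ω.length : ℤ[X]) • cs.wordOp ω' := by
          rw [← mul_assoc, ← h1, h2, smul_mul_assoc, one_mul]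
  refine LinearMap.ext fun f => Finsupp.ext fun a => ?_
  have h5 := DFunLike.congr_fun (DFunLike.congr_fun h4 f) a
  simp only [LinearMap.smul_apply, Finsupp.smul_apply, smul_eq_mul] at h5
  exact mul_left_cancel₀ (pow_ne_zero _ X_ne_zero) h5

/-- A reduced word of `w`. -/
def reducedWord (w : W) : List B := (cs.exists_isReduced w).choose

theorem isReduced_reducedWord (w : W) : cs.IsReduced (cs.reducedWord w) :=
  (cs.exists_isReduced w).choose_spec.1

theorem wordProd_reducedWord (w : W) : cs.wordProd (cs.reducedWord w) = w :=
  (cs.exists_isReduced w).choose_spec.2.symm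

/-- The column of the matrix of `R`-polynomials at `w`. -/
def rColumn (w : W) : W →₀ ℤ[X] := cs.wordOp (cs.reducedWord w) (basisVec 1)

theorem rColumn_eq {ω : List B} (hω : cs.IsReduced ω) :
    cs.rColumn (cs.wordProd ω) = cs.wordOp ω (basisVec 1) := by
  rw [rColumn, cs.wordOp_eq (cs.isReduced_reducedWord _) hω (cs.wordProd_reducedWord _)]

theorem rColumn_one : cs.rColumn 1 = basisVec 1 := by
  have := cs.rColumn_eq (ω := []) (by simp [IsReduced])
  simpa [wordOp] using this

theorem rColumn_simple_mul {w : W} {i : B} (h : ¬ cs.IsLeftDescent w i) :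
    cs.rColumn (cs.simple i * w) = cs.leftOp i (cs.rColumn w) := by
  have hr := cs.isReduced_reducedWord w
  have hp := cs.wordProd_reducedWord w
  have hred : cs.IsReduced (i :: cs.reducedWord w) := by
    rw [IsReduced, wordProd_cons, hp, cs.not_isLeftDescent_iff.1 h, List.length_cons, ← hr.eq, hp]
  have := cs.rColumn_eq hred
  rw [wordProd_cons, hp] at this
  rw [this]; simp [wordOp, rColumn]

theorem leftOp_basisVec_one (i : B) :
    cs.leftOp i (basisVec 1) = cs.rightOp i (basisVec 1) := by
  rw [cs.leftOp_of_not_isLeftDescent (cs.not_isLeftDescent_one i),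
    cs.rightOp_of_not_isRightDescent (cs.not_isRightDescent_one i), one_mul, mul_one]

/-- The recursion on the right holds because `rColumn w` is obtained from `e_1` by left operators,
which commute with the right ones. -/
theorem rColumn_mul_simple {w : W} {i : B} (h : ¬ cs.IsRightDescent w i) :
    cs.rColumn (w * cs.simple i) = cs.rightOp i (cs.rColumn w) := by
  have hr := cs.isReduced_reducedWord w
  have hp := cs.wordProd_reducedWord w
  have hred : cs.IsReduced (cs.reducedWord w ++ [i]) := by
    rw [IsReduced, wordProd_append, hp, wordProd_singleton, cs.not_isRightDescent_iff.1 h,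
      List.length_append, ← hr.eq, hp, List.length_singleton]
  have := cs.rColumn_eq hred
  rw [wordProd_append, wordProd_singleton, hp] at this
  rw [this, rColumn, ← Module.End.mul_apply, ← (cs.wordOp_comm _ i).eq, Module.End.mul_apply,
    ← leftOp_basisVec_one]
  simp [wordOp]

open Classical in
theorem leftOp_apply (i : B) (f : W →₀ ℤ[X]) (a : W) :
    cs.leftOp i f a = if cs.IsLeftDescent a i then f (cs.simple i * a)
      else (X - 1) * f a + X * f (cs.simple i * a) := by
  induction f using Finsupp.induction_linear with
  | zero => simp
  | add f g hf hg =>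
    rw [map_add, Finsupp.add_apply, hf, hg, Finsupp.add_apply, Finsupp.add_apply]
    split_ifs <;> ring
  | single w c =>
    have e : Finsupp.single w c = c • basisVec w := by simp [basisVec]
    have hsw : cs.simple i * a = w ↔ a = cs.simple i * w := by
      constructor
      · rintro rfl; simp
      · rintro rfl; simp
    rw [e, map_smul]
    simp only [Finsupp.smul_apply, basisVec, Finsupp.single_apply, smul_eq_mul,
      eq_comm (a := w), hsw]
    by_cases hw : cs.IsLeftDescent w i
    · rw [cs.leftOp_of_isLeftDescent hw]
      have h1 := cs.isLeftDescent_iff_not_isLeftDescent_mul.1 hw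
      simp only [Finsupp.smul_apply, basisVec, Finsupp.single_apply, smul_eq_mul,
        eq_comm (b := a)]
      by_cases h2 : a = cs.simple i * w
      · subst h2
        have : ¬ cs.simple i * w = w := fun h => cs.length_simple_mul_ne w i (by rw [h])
        simp [h1, this]; ring
      · by_cases h3 : a = w
        · subst h3; simp [h2, hw]
        · simp [h2, h3]
    · rw [cs.leftOp_of_not_isLeftDescent hw]
      have h1 : cs.IsLeftDescent (cs.simple i * w) i := by
        by_contra h1; exact hw (cs.isLeftDescent_iff_not_isLeftDescent_mul.2 h1)
      simp only [Finsupp.add_apply, Finsupp.smul_apply, basisVec, Finsupp.single_apply,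
        smul_eq_mul, eq_comm (b := a)]
      by_cases h2 : a = cs.simple i * w
      · subst h2
        have : ¬ cs.simple i * w = w := fun h => cs.length_simple_mul_ne w i (by rw [h])
        simp [h1, this]
      · by_cases h3 : a = w
        · subst h3; simp [h2, hw]; ring
        · simp [h2, h3]

theorem exists_eq_simple_mul {b : W} {i : B} (h : cs.IsLeftDescent b i) :
    ∃ c, ¬ cs.IsLeftDescent c i ∧ b = cs.simple i * c ∧ cs.length b = cs.length c + 1 := by
  refine ⟨cs.simple i * b, cs.isLeftDescent_iff_not_isLeftDescent_mul.1 h, by simp, ?_⟩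
  exact (cs.isLeftDescent_iff.1 h).symm

theorem rColumn_apply_of_isLeftDescent {a b : W} {i : B} (hb : cs.IsLeftDescent b i)
    (ha : cs.IsLeftDescent a i) :
    cs.rColumn b a = cs.rColumn (cs.simple i * b) (cs.simple i * a) := by
  obtain ⟨c, hc, rfl, _⟩ := cs.exists_eq_simple_mul hb
  rw [cs.rColumn_simple_mul hc, leftOp_apply, if_pos ha, simple_mul_simple_cancel_left]

theorem rColumn_apply_of_not_isLeftDescent {a b : W} {i : B} (hb : cs.IsLeftDescent b i)
    (ha : ¬ cs.IsLeftDescent a i) :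
    cs.rColumn b a = (X - 1) * cs.rColumn (cs.simple i * b) a +
      X * cs.rColumn (cs.simple i * b) (cs.simple i * a) := by
  obtain ⟨c, hc, rfl, _⟩ := cs.exists_eq_simple_mul hb
  rw [cs.rColumn_simple_mul hc, leftOp_apply, if_neg ha, simple_mul_simple_cancel_left]

theorem rColumn_apply_eq_zero {a b : W} (h : ¬ cs.BruhatLE a b) : cs.rColumn b a = 0 := by
  classical
  induction hn : cs.length b using Nat.strong_induction_on generalizing a b with
  | _ n ih =>
  by_cases hb : b = 1
  · subst hb
    rw [rColumn_one, basisVec, Finsupp.single_apply, if_neg]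
    rintro rfl; exact h (cs.bruhatLE_refl _)
  · obtain ⟨i, hi⟩ := cs.exists_leftDescent_of_ne_one hb
    have hsb := cs.simple_mul_bruhatLE hi
    by_cases ha : cs.IsLeftDescent a i
    · rw [cs.rColumn_apply_of_isLeftDescent hi ha]
      refine ih _ (hn ▸ hi) (fun h' => h ?_) rfl
      simpa using cs.simple_mul_le_of_isLeftDescent (h'.trans hsb) hi
    · rw [cs.rColumn_apply_of_not_isLeftDescent hi ha,
        ih _ (hn ▸ hi) (fun h' => h (h'.trans hsb)) rfl,
        ih _ (hn ▸ hi) (fun h' => h (((cs.bruhatLE_simple_mul ha).trans h').trans hsb)) rfl]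
      ring

theorem rColumn_apply_self (a : W) : cs.rColumn a a = 1 := by
  induction hn : cs.length a using Nat.strong_induction_on generalizing a with
  | _ n ih =>
  by_cases hb : a = 1
  · subst hb; simp [rColumn_one]
  · obtain ⟨i, hi⟩ := cs.exists_leftDescent_of_ne_one hb
    rw [cs.rColumn_apply_of_isLeftDescent hi hi]
    exact ih _ (hn ▸ hi) _ rfl

theorem natDegree_rColumn_le (a b : W) :
    (cs.rColumn b a).natDegree ≤ cs.length b - cs.length a := by
  classical
  induction hn : cs.length b using Nat.strong_induction_on generalizing a b with
  | _ n ih =>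
  subst hn
  by_cases hab : cs.BruhatLE a b
  swap
  · rw [cs.rColumn_apply_eq_zero hab]; simp
  by_cases hb : b = 1
  · subst hb
    rw [rColumn_one, basisVec, Finsupp.single_apply]
    split_ifs <;> simp
  · obtain ⟨i, hi⟩ := cs.exists_leftDescent_of_ne_one hb
    have hlen := cs.isLeftDescent_iff.1 hi
    by_cases ha : cs.IsLeftDescent a i
    · rw [cs.rColumn_apply_of_isLeftDescent hi ha]
      refine (ih _ hi _ _ rfl).trans ?_
      have := cs.isLeftDescent_iff.1 ha
      omega
    · rw [cs.rColumn_apply_of_not_isLeftDescent hi ha]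
      have h1 := ih _ hi a _ rfl
      have h2 := ih _ hi (cs.simple i * a) _ rfl
      have h3 := cs.not_isLeftDescent_iff.1 ha
      have h4 := (cs.le_simple_mul_of_not_isLeftDescent hab ha).length_le
      refine natDegree_add_le_of_degree_le ?_ ?_
      · refine natDegree_mul_le.trans ?_
        have : (X - 1 : ℤ[X]).natDegree ≤ 1 := by compute_degree
        omega
      · by_cases h5 : cs.BruhatLE (cs.simple i * a) (cs.simple i * b)
        · refine natDegree_mul_le.trans ?_
          have := h5.length_le
          have : (X : ℤ[X]).natDegree ≤ 1 := by compute_degree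
          omega
        · rw [cs.rColumn_apply_eq_zero h5]; simp

end Hecke

/-! ### Parabolic `R`-polynomials -/

section ParabolicR

variable {B W : Type u} [Group W] {M : CoxeterMatrix B} (cs : CoxeterSystem M W)

open Classical in
/-- The coefficient `(-x) ^ (ℓ(z) - ℓ(a))` if `z ∈ a W_J`, and zero otherwise. -/
def cosetCoeff (J : Set B) (x : ℤ[X]) (a z : W) : ℤ[X] :=
  if a⁻¹ * z ∈ cs.parabolic J then (-x) ^ (cs.length z - cs.length a) else 0

/-- The functional `∑ f(z) e_z ↦ ∑_{z ∈ a W_J} (-x) ^ (ℓ(z) - ℓ(a)) f(z)`. It sends the column of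
`R`-polynomials at `b` to Deodhar's `R^{J,x}_{a,b}`. -/
def cosetFunctional (J : Set B) (x : ℤ[X]) (a : W) : (W →₀ ℤ[X]) →ₗ[ℤ[X]] ℤ[X] :=
  Finsupp.linearCombination ℤ[X] (cs.cosetCoeff J x a)

theorem cosetFunctional_basisVec (J : Set B) (x : ℤ[X]) (a z : W) :
    cs.cosetFunctional J x a (basisVec z) = cs.cosetCoeff J x a z := by
  simp [cosetFunctional, basisVec]

theorem cosetFunctional_apply (J : Set B) (x : ℤ[X]) (a : W) (f : W →₀ ℤ[X]) (S : Finset W)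
    (hS : f.support ⊆ S) :
    cs.cosetFunctional J x a f = ∑ z ∈ S, f z * cs.cosetCoeff J x a z := by
  rw [cosetFunctional, Finsupp.linearCombination_apply, Finsupp.sum_of_support_subset _ hS]
  · simp
  · simp

variable {cs} in
theorem cosetCoeff_of_mem {J : Set B} {x : ℤ[X]} {a w : W} (ha : a ∈ cs.minReps J)
    (hw : w ∈ cs.parabolic J) : cs.cosetCoeff J x a (a * w) = (-x) ^ cs.length w := by
  rw [cosetCoeff, if_pos (by simpa using hw), cs.length_mul_of_mem_minReps ha hw,
    Nat.add_sub_cancel_left]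

theorem cosetCoeff_of_notMem {J : Set B} {x : ℤ[X]} {a z : W}
    (h : a⁻¹ * z ∉ cs.parabolic J) : cs.cosetCoeff J x a z = 0 := if_neg h

theorem simple_mul_inv_mul (a z : W) (i : B) :
    (cs.simple i * a)⁻¹ * z = a⁻¹ * (cs.simple i * z) := by simp [mul_assoc]

/-- The functionals of `a` and `s a < a` are interchanged by `leftOp`: the cosets `a W_J` and
`s a W_J` are different, and `s` maps one to the other, changing every length by one. -/
theorem cosetFunctional_leftOp_of_isLeftDescent {J : Set B} (x : ℤ[X]) {a : W} {i : B}
    (ha : a ∈ cs.minReps J) (hi : cs.IsLeftDescent a i) (f : W →₀ ℤ[X]) :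
    cs.cosetFunctional J x a (cs.leftOp i f) = cs.cosetFunctional J x (cs.simple i * a) f := by
  have hsa := cs.simple_mul_mem_minReps ha hi
  have hne : ¬ cs.simple i * a = a := fun h => cs.length_simple_mul_ne a i (by rw [h])
  have hlen := cs.isLeftDescent_iff.1 hi
  suffices (cs.cosetFunctional J x a) ∘ₗ (cs.leftOp i) =
      cs.cosetFunctional J x (cs.simple i * a) from DFunLike.congr_fun this f
  refine end_ext fun z => ?_
  rw [LinearMap.comp_apply, cosetFunctional_basisVec]
  by_cases h1 : a⁻¹ * z ∈ cs.parabolic J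
  · obtain ⟨w, hw, rfl⟩ : ∃ w ∈ cs.parabolic J, z = a * w := ⟨_, h1, by simp⟩
    have h2 := cs.length_mul_of_mem_minReps ha hw
    have h3 := cs.length_mul_of_mem_minReps hsa hw
    have h4 : cs.IsLeftDescent (a * w) i := by
      rw [mul_assoc] at h3
      simp only [IsLeftDescent]; omega
    have h5 : (cs.simple i * a)⁻¹ * (a * w) ∉ cs.parabolic J := by
      intro h5
      refine hne (cs.eq_of_mem_minReps hsa ha ?_)
      simpa [mul_assoc] using mul_mem h5 (inv_mem hw)
    rw [cs.leftOp_of_isLeftDescent h4, map_smul, cosetFunctional_basisVec,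
      cosetCoeff_of_notMem _ h5, cosetCoeff_of_notMem _ (by rwa [← simple_mul_inv_mul]), smul_zero]
  · by_cases h5 : (cs.simple i * a)⁻¹ * z ∈ cs.parabolic J
    · obtain ⟨w, hw, rfl⟩ : ∃ w ∈ cs.parabolic J, z = cs.simple i * a * w :=
        ⟨_, h5, (mul_inv_cancel_left _ _).symm⟩
      have h2 := cs.length_mul_of_mem_minReps ha hw
      have h3 := cs.length_mul_of_mem_minReps hsa hw
      have h4 : ¬ cs.IsLeftDescent (cs.simple i * a * w) i := by
        rw [mul_assoc] at h3 ⊢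
        simp only [IsLeftDescent, simple_mul_simple_cancel_left]; omega
      rw [cs.leftOp_of_not_isLeftDescent h4, map_add, map_smul, cosetFunctional_basisVec,
        cosetFunctional_basisVec, cosetCoeff_of_notMem _ h1, cosetCoeff_of_mem hsa hw, mul_assoc,
        simple_mul_simple_cancel_left, cosetCoeff_of_mem ha hw, smul_zero, zero_add]
    · have h6 := h5
      rw [simple_mul_inv_mul] at h6
      rw [cosetCoeff_of_notMem _ h5]
      by_cases h4 : cs.IsLeftDescent z i
      · rw [cs.leftOp_of_isLeftDescent h4, map_smul, cosetFunctional_basisVec,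
          cosetCoeff_of_notMem _ h6, smul_zero]
      · rw [cs.leftOp_of_not_isLeftDescent h4, map_add, map_smul, cosetFunctional_basisVec,
          cosetFunctional_basisVec, cosetCoeff_of_notMem _ h6, cosetCoeff_of_notMem _ h1,
          smul_zero, zero_add]

theorem leftOp_leftOp (i : B) (f : W →₀ ℤ[X]) :
    cs.leftOp i (cs.leftOp i f) = (X - 1 : ℤ[X]) • cs.leftOp i f + (X : ℤ[X]) • f := by
  have := DFunLike.congr_fun (cs.leftDualOp_mul_leftOp i) f
  rw [Module.End.mul_apply, leftDualOp, LinearMap.sub_apply] at this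
  exact (sub_eq_iff_eq_add'.1 this)

theorem cosetFunctional_leftOp_of_mem {J : Set B} (x : ℤ[X]) {a : W} {i : B}
    (hi : ¬ cs.IsLeftDescent a i) (hsa : cs.simple i * a ∈ cs.minReps J) (f : W →₀ ℤ[X]) :
    cs.cosetFunctional J x a (cs.leftOp i f) = (X - 1) * cs.cosetFunctional J x a f +
      X * cs.cosetFunctional J x (cs.simple i * a) f := by
  have hi' : cs.IsLeftDescent (cs.simple i * a) i := by
    by_contra h1; exact hi (cs.isLeftDescent_iff_not_isLeftDescent_mul.2 h1)
  have h := fun g => cs.cosetFunctional_leftOp_of_isLeftDescent x hsa hi' g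
  simp only [simple_mul_simple_cancel_left] at h
  rw [← h, leftOp_leftOp, map_add, map_smul, map_smul, h, smul_eq_mul, smul_eq_mul]

/-- The common part of the computations for `leftOp` and `rightOp` on a stable coset. -/
theorem cosetCoeff_step {J : Set B} {x : ℤ[X]} {a z z' : W} (ha : a ∈ cs.minReps J)
    (h : a⁻¹ * z ∈ cs.parabolic J ↔ a⁻¹ * z' ∈ cs.parabolic J)
    (hlen : cs.length z' = cs.length z + 1) :
    cs.cosetCoeff J x a z' = -x * cs.cosetCoeff J x a z := by
  by_cases hz : a⁻¹ * z ∈ cs.parabolic J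
  · have := cs.length_mul_of_mem_minReps ha hz
    rw [mul_inv_cancel_left] at this
    rw [cosetCoeff, if_pos (h.1 hz), cosetCoeff, if_pos hz, ← pow_succ']
    congr 1
    omega
  · rw [cs.cosetCoeff_of_notMem hz, cs.cosetCoeff_of_notMem (mt h.2 hz), mul_zero]

/-- If `s a ∉ W^J`, then `s a W_J = a W_J`, and the functional of `a` is an eigenvector of `leftOp`.
The hypothesis on `x` is the quadratic equation satisfied by `-1` and by `q`. -/
theorem cosetFunctional_leftOp_of_notMem {J : Set B} {x : ℤ[X]} (hx : X = (X - 1 - x) * -x)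
    {a : W} {i : B} (ha : a ∈ cs.minReps J) (hi : ¬ cs.IsLeftDescent a i)
    (hsa : cs.simple i * a ∉ cs.minReps J) (f : W →₀ ℤ[X]) :
    cs.cosetFunctional J x a (cs.leftOp i f) = (X - 1 - x) * cs.cosetFunctional J x a f := by
  obtain ⟨r, hr, he⟩ := cs.exists_simple_mul_eq ha hi hsa
  have hmem : ∀ z, a⁻¹ * z ∈ cs.parabolic J ↔ a⁻¹ * (cs.simple i * z) ∈ cs.parabolic J := by
    intro z
    have : a⁻¹ * (cs.simple i * z) = cs.simple r * (a⁻¹ * z) := by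
      rw [← simple_mul_inv_mul, he]; simp [mul_assoc]
    rw [this, Subgroup.mul_mem_cancel_left _ (cs.simple_mem_parabolic hr)]
  suffices (cs.cosetFunctional J x a) ∘ₗ (cs.leftOp i) =
      (X - 1 - x) • cs.cosetFunctional J x a from DFunLike.congr_fun this f
  refine end_ext fun z => ?_
  rw [LinearMap.comp_apply, LinearMap.smul_apply, cosetFunctional_basisVec, smul_eq_mul]
  by_cases h : cs.IsLeftDescent z i
  · rw [cs.leftOp_of_isLeftDescent h, map_smul, cosetFunctional_basisVec,
      cs.cosetCoeff_step ha (hmem z).symm (cs.isLeftDescent_iff.1 h).symm, smul_eq_mul]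
    conv_lhs => rw [hx]
    ring
  · rw [cs.leftOp_of_not_isLeftDescent h, map_add, map_smul, cosetFunctional_basisVec,
      cosetFunctional_basisVec, cs.cosetCoeff_step ha (hmem z) (cs.not_isLeftDescent_iff.1 h),
      smul_eq_mul]
    ring

theorem cosetFunctional_rightOp {J : Set B} {x : ℤ[X]} (hx : X = (X - 1 - x) * -x)
    {a : W} {r : B} (ha : a ∈ cs.minReps J) (hr : r ∈ J) (f : W →₀ ℤ[X]) :
    cs.cosetFunctional J x a (cs.rightOp r f) = (X - 1 - x) * cs.cosetFunctional J x a f := by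
  have hmem : ∀ z, a⁻¹ * z ∈ cs.parabolic J ↔ a⁻¹ * (z * cs.simple r) ∈ cs.parabolic J := by
    intro z
    rw [← mul_assoc, Subgroup.mul_mem_cancel_right _ (cs.simple_mem_parabolic hr)]
  suffices (cs.cosetFunctional J x a) ∘ₗ (cs.rightOp r) =
      (X - 1 - x) • cs.cosetFunctional J x a from DFunLike.congr_fun this f
  refine end_ext fun z => ?_
  rw [LinearMap.comp_apply, LinearMap.smul_apply, cosetFunctional_basisVec, smul_eq_mul]
  by_cases h : cs.IsRightDescent z r
  · rw [cs.rightOp_of_isRightDescent h, map_smul, cosetFunctional_basisVec,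
      cs.cosetCoeff_step ha (hmem z).symm (cs.isRightDescent_iff.1 h).symm, smul_eq_mul]
    conv_lhs => rw [hx]
    ring
  · rw [cs.rightOp_of_not_isRightDescent h, map_add, map_smul, cosetFunctional_basisVec,
      cosetFunctional_basisVec, cs.cosetCoeff_step ha (hmem z) (cs.not_isRightDescent_iff.1 h),
      smul_eq_mul]
    ring

/-- Moving `b` inside the coset `z W_J` multiplies the value of the functional at the column of
`b` by a power of `q - 1 - x`. -/
theorem cosetFunctional_rColumn_mul {J : Set B} {x : ℤ[X]} (hx : X = (X - 1 - x) * -x)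
    {a z w : W} (ha : a ∈ cs.minReps J) (hz : z ∈ cs.minReps J) (hw : w ∈ cs.parabolic J) :
    cs.cosetFunctional J x a (cs.rColumn (z * w)) =
      (X - 1 - x) ^ cs.length w * cs.cosetFunctional J x a (cs.rColumn z) := by
  obtain ⟨ω, hJ, hω, rfl⟩ := cs.exists_isReduced_of_mem_parabolic hw
  induction ω using List.reverseRecOn with
  | nil => simp
  | append_singleton ω r ih =>
    have hred : cs.IsReduced ω := by simpa using hω.take ω.length
    have hJ' : ∀ i ∈ ω, i ∈ J := fun i hi => hJ i (by simp [hi])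
    have h1 := cs.length_mul_of_mem_minReps hz (cs.wordProd_mem_parabolic hJ')
    have h2 := cs.length_mul_of_mem_minReps hz hw
    have ih := ih hJ' hred (cs.wordProd_mem_parabolic hJ')
    rw [hred.eq] at h1 ih
    rw [hω.eq] at h2 ⊢
    simp only [wordProd_append, wordProd_singleton, ← mul_assoc, List.length_append,
      List.length_singleton] at h2 ⊢
    rw [cs.rColumn_mul_simple (by rw [not_isRightDescent_iff]; omega),
      cs.cosetFunctional_rightOp hx ha (hJ r (by simp)), ih]
    ring

theorem rColumn_support_subset (b : W) :
    (cs.rColumn b).support ⊆ (cs.finite_lower b).toFinset := by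
  intro z hz
  rw [Set.Finite.mem_toFinset]
  by_contra h
  exact (Finsupp.mem_support_iff.1 hz) (cs.rColumn_apply_eq_zero h)

theorem bruhatLE_of_inv_mul_mem {J : Set B} {a z : W} (ha : a ∈ cs.minReps J)
    (h : a⁻¹ * z ∈ cs.parabolic J) : cs.BruhatLE a z := by
  simpa using cs.bruhatLE_mul_of_mem_minReps ha h

theorem cosetFunctional_rColumn_eq_zero {J : Set B} (x : ℤ[X]) {a b : W}
    (ha : a ∈ cs.minReps J) (h : ¬ cs.BruhatLE a b) :
    cs.cosetFunctional J x a (cs.rColumn b) = 0 := by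
  rw [cs.cosetFunctional_apply J x a _ _ (cs.rColumn_support_subset b)]
  refine Finset.sum_eq_zero fun z hz => ?_
  rw [Set.Finite.mem_toFinset] at hz
  rw [cosetCoeff_of_notMem, mul_zero]
  exact fun h' => h ((cs.bruhatLE_of_inv_mul_mem ha h').trans hz)

theorem cosetFunctional_rColumn_self {J : Set B} (x : ℤ[X]) {a : W} (ha : a ∈ cs.minReps J) :
    cs.cosetFunctional J x a (cs.rColumn a) = 1 := by
  rw [cs.cosetFunctional_apply J x a _ _ (cs.rColumn_support_subset a),
    Finset.sum_eq_single a]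
  · rw [rColumn_apply_self, cosetCoeff]; simp
  · intro z hz hne
    rw [Set.Finite.mem_toFinset] at hz
    rw [cosetCoeff_of_notMem, mul_zero]
    exact fun h' => hne (cs.bruhatLE_antisymm hz (cs.bruhatLE_of_inv_mul_mem ha h'))
  · intro h
    exact absurd (cs.bruhatLE_refl a) (by simpa using h)

open Classical in
theorem isParabolicRFamily_cosetFunctional (J : Set B) {x : ℤ[X]} (hx : X = (X - 1 - x) * -x) :
    cs.IsParabolicRFamily J x fun a b =>
      if a ∈ cs.minReps J ∧ b ∈ cs.minReps J then cs.cosetFunctional J x a (cs.rColumn b)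
      else 0 where
  eq_zero a b h := by
    split_ifs with h'
    · exact cs.cosetFunctional_rColumn_eq_zero x h'.1 fun h'' => h ⟨h'.1, h'.2, h''⟩
    · rfl
  diag a ha := by rw [if_pos ⟨ha, ha⟩, cs.cosetFunctional_rColumn_self x ha]
  descent a ha b hb hab hne i hbi hai := by
    obtain ⟨c, hc, rfl, _⟩ := cs.exists_eq_simple_mul hbi
    rw [if_pos ⟨ha, hb⟩, if_pos ⟨cs.simple_mul_mem_minReps ha hai,
      cs.simple_mul_mem_minReps hb hbi⟩, cs.rColumn_simple_mul hc,
      cs.cosetFunctional_leftOp_of_isLeftDescent x ha hai, simple_mul_simple_cancel_left]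
  ascent_mem a ha b hb hab hne i hbi hai hsa := by
    have hsb := cs.simple_mul_mem_minReps hb hbi
    obtain ⟨c, hc, rfl, _⟩ := cs.exists_eq_simple_mul hbi
    have hi' : cs.IsLeftDescent (cs.simple i * a) i := by
      by_contra h1; exact hai (cs.isLeftDescent_iff_not_isLeftDescent_mul.2 h1)
    rw [if_pos ⟨ha, hb⟩, if_pos ⟨hsa, hb⟩, if_pos ⟨hsa, hsb⟩, cs.rColumn_simple_mul hc,
      cs.cosetFunctional_leftOp_of_mem x hai hsa,
      cs.cosetFunctional_leftOp_of_isLeftDescent x hsa hi', simple_mul_simple_cancel_left,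
      simple_mul_simple_cancel_left]
  ascent_notMem a ha b hb hab hne i hbi hai hsa := by
    have hsb := cs.simple_mul_mem_minReps hb hbi
    obtain ⟨c, hc, rfl, _⟩ := cs.exists_eq_simple_mul hbi
    rw [if_pos ⟨ha, hb⟩, if_pos ⟨ha, hsb⟩, cs.rColumn_simple_mul hc,
      cs.cosetFunctional_leftOp_of_notMem hx ha hai hsa, simple_mul_simple_cancel_left]

variable {cs} in
theorem IsParabolicRFamily.unique {J : Set B} {x : ℤ[X]} {R R' : W → W → ℤ[X]}
    (h : cs.IsParabolicRFamily J x R) (h' : cs.IsParabolicRFamily J x R') : R = R' := by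
  funext a b
  induction hn : cs.length b using Nat.strong_induction_on generalizing a b with
  | _ n ih =>
  subst hn
  by_cases hab : a ∈ cs.minReps J ∧ b ∈ cs.minReps J ∧ cs.BruhatLE a b
  swap
  · rw [h.eq_zero _ _ hab, h'.eq_zero _ _ hab]
  obtain ⟨ha, hb, hab⟩ := hab
  by_cases hne : a = b
  · subst hne; rw [h.diag _ ha, h'.diag _ ha]
  have hb1 : b ≠ 1 := by
    rintro rfl
    have := hab.length_lt hne
    simp at this
  obtain ⟨i, hi⟩ := cs.exists_leftDescent_of_ne_one hb1
  by_cases hai : cs.IsLeftDescent a i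
  · rw [h.descent a ha b hb hab hne i hi hai, h'.descent a ha b hb hab hne i hi hai]
    exact ih _ hi _ _ rfl
  · by_cases hsa : cs.simple i * a ∈ cs.minReps J
    · rw [h.ascent_mem a ha b hb hab hne i hi hai hsa, h'.ascent_mem a ha b hb hab hne i hi hai hsa,
        ih _ hi (cs.simple i * a) _ rfl]
      congr 2
      have hi' : cs.IsLeftDescent (cs.simple i * a) i := by
        by_contra h1; exact hai (cs.isLeftDescent_iff_not_isLeftDescent_mul.2 h1)
      by_cases heq : cs.simple i * a = b
      · rw [heq, h.diag _ hb, h'.diag _ hb]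
      · have hle := cs.simple_mul_le_of_isLeftDescent hab hi
        rw [h.descent _ hsa b hb hle heq i hi hi', h'.descent _ hsa b hb hle heq i hi hi']
        exact ih _ hi _ _ rfl
    · rw [h.ascent_notMem a ha b hb hab hne i hi hai hsa,
        h'.ascent_notMem a ha b hb hab hne i hi hai hsa, ih _ hi a _ rfl]

theorem isParabolicRFamily_parabolicRPoly (J : Set B) {x : ℤ[X]} (hx : X = (X - 1 - x) * -x) :
    cs.IsParabolicRFamily J x (cs.parabolicRPoly J x) :=
  Classical.epsilon_spec ⟨_, cs.isParabolicRFamily_cosetFunctional J hx⟩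

theorem parabolicRPoly_eq {J : Set B} {x : ℤ[X]} (hx : X = (X - 1 - x) * -x) {a b : W}
    (ha : a ∈ cs.minReps J) (hb : b ∈ cs.minReps J) :
    cs.parabolicRPoly J x a b = cs.cosetFunctional J x a (cs.rColumn b) := by
  classical
  rw [(cs.isParabolicRFamily_parabolicRPoly J hx).unique
    (cs.isParabolicRFamily_cosetFunctional J hx)]
  simp [ha, hb]

/-- For `J = ∅` and any `x`, parabolic `R`-polynomials are `R`-polynomials. -/
theorem isRFamily_iff (x : ℤ[X]) (R : W → W → ℤ[X]) :
    cs.IsRFamily R ↔ cs.IsParabolicRFamily ∅ x R := by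
  have h : ∀ a, a ∈ cs.minReps (∅ : Set B) := by simp [minReps_empty]
  constructor
  · intro hR
    exact ⟨fun a b hab => hR.eq_zero a b fun h' => hab ⟨h a, h b, h'⟩, fun a _ => hR.diag a,
      fun a _ b _ => hR.descent a b, fun a _ b _ hab hne i hb ha _ => hR.ascent a b hab hne i hb ha,
      fun a _ b _ hab hne i hb ha h' => absurd (h _) h'⟩
  · intro hR
    exact ⟨fun a b hab => hR.eq_zero a b fun h' => hab h'.2.2, fun a => hR.diag a (h a),
      fun a b => hR.descent a (h a) b (h b),
      fun a b hab hne i hb ha => hR.ascent_mem a (h a) b (h b) hab hne i hb ha (h _)⟩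

theorem rPoly_eq_parabolicRPoly (x : ℤ[X]) : cs.rPoly = cs.parabolicRPoly ∅ x := by
  have : cs.IsRFamily = cs.IsParabolicRFamily ∅ x := funext fun R => propext (cs.isRFamily_iff x R)
  rw [rPoly, parabolicRPoly, this]

theorem rPoly_eq (a b : W) : cs.rPoly a b = cs.rColumn b a := by
  classical
  have hx : (X : ℤ[X]) = (X - 1 - (-1)) * -(-1) := by ring
  rw [cs.rPoly_eq_parabolicRPoly (-1), cs.parabolicRPoly_eq hx (by simp [minReps_empty])
    (by simp [minReps_empty]), cosetFunctional_apply _ _ _ _ _ _ (Finset.subset_insert a _),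
    Finset.sum_eq_single_of_mem a (Finset.mem_insert_self a _)]
  · simp [cosetCoeff]
  · intro z _ hz
    rw [cosetCoeff_of_notMem, mul_zero]
    rw [parabolic_empty, Subgroup.mem_bot, inv_mul_eq_one]
    exact fun h => hz h.symm

end ParabolicR

/-! ### The inversion formula for parabolic `R`-polynomials -/

section Inversion

theorem reflect_finset_sum {ι : Type*} (S : Finset ι) (f : ι → ℤ[X]) (n : ℕ) :
    (∑ i ∈ S, f i).reflect n = ∑ i ∈ S, (f i).reflect n := by
  classical
  induction S using Finset.induction_on with
  | empty => simp
  | insert i S hi ih => rw [Finset.sum_insert hi, Finset.sum_insert hi, reflect_add, ih]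

theorem reflect_reflect (n : ℕ) (p : ℤ[X]) : (p.reflect n).reflect n = p := by
  ext i; rw [coeff_reflect, coeff_reflect, revAt_invol]

theorem reflect_mul_of_add {p q : ℤ[X]} {m n k : ℕ} (h : m + n = k) (hp : p.natDegree ≤ m)
    (hq : q.natDegree ≤ n) : (p * q).reflect k = p.reflect m * q.reflect n := by
  rw [← h, reflect_mul p q hp hq]

theorem quadratic_of_type {x : ℤ[X]} (hx : x = -1 ∨ x = X) : X = (X - 1 - x) * -x := by
  rcases hx with rfl | rfl <;> ring

theorem natDegree_neg_pow_le {x : ℤ[X]} (hx : x = -1 ∨ x = X) (k : ℕ) :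
    ((-x) ^ k).natDegree ≤ k := by
  rcases hx with rfl | rfl
  · simp
  · refine natDegree_pow_le.trans ?_
    simp

theorem reflect_neg_pow {x : ℤ[X]} (hx : x = -1 ∨ x = X) (k : ℕ) :
    ((-x) ^ k).reflect k = (X - 1 - x) ^ k := by
  rcases hx with rfl | rfl
  · rw [neg_neg, one_pow, reflect_one]
    ring
  · have e : (-X : ℤ[X]) ^ k = C ((-1) ^ k) * X ^ k := by
      rw [neg_pow]; simp
    rw [e, reflect_C_mul, reflect_monomial, revAt_le le_rfl]
    simp

variable {B W : Type u} [Group W] {M : CoxeterMatrix B} (cs : CoxeterSystem M W)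

/-- The identity `q ^ (ℓ(b) - ℓ(a)) R_{a,b}(q⁻¹) = (-1) ^ (ℓ(b) - ℓ(a)) R_{a,b}(q)`. -/
theorem reflect_rColumn (a b : W) :
    (cs.rColumn b a).reflect (cs.length b - cs.length a) =
      (-1) ^ (cs.length b + cs.length a) * cs.rColumn b a := by
  induction hn : cs.length b using Nat.strong_induction_on generalizing a b with
  | _ n ih =>
  subst hn
  by_cases hab : cs.BruhatLE a b
  swap
  · rw [cs.rColumn_apply_eq_zero hab]; simp
  by_cases hne : a = b
  · subst hne
    rw [rColumn_apply_self, ← two_mul, pow_mul, Nat.sub_self]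
    simp
  have hb : b ≠ 1 := by
    rintro rfl
    have := hab.length_lt hne
    simp at this
  obtain ⟨i, hi⟩ := cs.exists_leftDescent_of_ne_one hb
  have hlen := cs.isLeftDescent_iff.1 hi
  by_cases ha : cs.IsLeftDescent a i
  · have hlena := cs.isLeftDescent_iff.1 ha
    rw [cs.rColumn_apply_of_isLeftDescent hi ha,
      show cs.length b - cs.length a =
        cs.length (cs.simple i * b) - cs.length (cs.simple i * a) by omega,
      ih _ hi _ _ rfl, ← hlen, ← hlena]
    ring
  · have hlena := cs.not_isLeftDescent_iff.1 ha
    have hle := (cs.le_simple_mul_of_not_isLeftDescent hab ha).length_le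
    rw [cs.rColumn_apply_of_not_isLeftDescent hi ha, reflect_add]
    have h1 : ((X - 1) * cs.rColumn (cs.simple i * b) a).reflect (cs.length b - cs.length a) =
        (-1) ^ (cs.length b + cs.length a) * ((X - 1) * cs.rColumn (cs.simple i * b) a) := by
      rw [reflect_mul_of_add (m := 1) (n := cs.length (cs.simple i * b) - cs.length a) (by omega)
        (by compute_degree) (cs.natDegree_rColumn_le _ _), ih _ hi _ _ rfl, ← hlen, reflect_sub,
        reflect_one_X, reflect_one, pow_one]
      ring
    rw [h1, mul_add]
    congr 1
    by_cases h5 : cs.BruhatLE (cs.simple i * a) (cs.simple i * b)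
    · have h6 := h5.length_le
      have h7 : (X : ℤ[X]).reflect 2 = X := by
        have := reflect_monomial (R := ℤ) 2 1
        rw [revAt_le (by norm_num)] at this
        simpa using this
      rw [reflect_mul_of_add (m := 2)
        (n := cs.length (cs.simple i * b) - cs.length (cs.simple i * a)) (by omega)
        (by rw [natDegree_X]; norm_num) (cs.natDegree_rColumn_le _ _), ih _ hi _ _ rfl, h7, ← hlen,
        hlena]
      ring
    · rw [cs.rColumn_apply_eq_zero h5]; simp

/-- The matrix of `R`-polynomials with signs, `e_w ↦ (-1) ^ ℓ(w) ∑ R_{a,w} e_a`. -/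
def signedMatrix : Module.End ℤ[X] (W →₀ ℤ[X]) :=
  Finsupp.linearCombination ℤ[X] fun w => ((-1) ^ cs.length w : ℤ[X]) • cs.rColumn w

theorem signedMatrix_basisVec (w : W) :
    cs.signedMatrix (basisVec w) = ((-1) ^ cs.length w : ℤ[X]) • cs.rColumn w := by
  simp [signedMatrix, basisVec]

/-- The signed matrix of `R`-polynomials intertwines `leftOp` and `-leftDualOp`: up to signs and
powers of `q`, it is the matrix of the bar involution. -/
theorem signedMatrix_leftOp (i : B) (f : W →₀ ℤ[X]) :
    cs.signedMatrix (cs.leftOp i f) = -cs.leftDualOp i (cs.signedMatrix f) := by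
  suffices cs.signedMatrix ∘ₗ cs.leftOp i = -(cs.leftDualOp i ∘ₗ cs.signedMatrix) from
    DFunLike.congr_fun this f
  refine end_ext fun w => ?_
  rw [LinearMap.neg_apply, LinearMap.comp_apply, LinearMap.comp_apply, signedMatrix_basisVec,
    map_smul]
  by_cases hw : cs.IsLeftDescent w i
  · obtain ⟨c, hc, rfl, hlen⟩ := cs.exists_eq_simple_mul hw
    have h := DFunLike.congr_fun (cs.leftDualOp_mul_leftOp i) (cs.rColumn c)
    rw [Module.End.mul_apply, ← cs.rColumn_simple_mul hc] at h
    rw [cs.leftOp_of_isLeftDescent hw, map_smul, simple_mul_simple_cancel_left,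
      signedMatrix_basisVec, h, hlen, LinearMap.smul_apply, Module.End.one_apply, smul_smul,
      smul_smul, ← neg_smul]
    congr 1
    ring
  · rw [cs.leftOp_of_not_isLeftDescent hw, map_add, map_smul, signedMatrix_basisVec,
      signedMatrix_basisVec, leftDualOp, LinearMap.sub_apply, ← cs.rColumn_simple_mul hw,
      cs.not_isLeftDescent_iff.1 hw, LinearMap.smul_apply, Module.End.one_apply, smul_sub,
      smul_smul, smul_smul, mul_comm (X - 1 : ℤ[X]), pow_succ, mul_neg, mul_one, neg_smul]
    abel

/-- The square of the signed matrix of `R`-polynomials is the identity. -/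
theorem signedMatrix_rColumn (b : W) :
    cs.signedMatrix (cs.rColumn b) = ((-1) ^ cs.length b : ℤ[X]) • basisVec b := by
  induction hn : cs.length b using Nat.strong_induction_on generalizing b with
  | _ n ih =>
  subst hn
  by_cases hb : b = 1
  · subst hb
    rw [rColumn_one, signedMatrix_basisVec, rColumn_one]
  · obtain ⟨i, hi⟩ := cs.exists_leftDescent_of_ne_one hb
    obtain ⟨c, hc, rfl, hlen⟩ := cs.exists_eq_simple_mul hi
    rw [cs.rColumn_simple_mul hc, signedMatrix_leftOp, ih _ (by omega) c rfl, map_smul,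
      cs.leftDualOp_of_not_isLeftDescent hc, hlen, pow_succ, mul_neg, mul_one, neg_smul]

open Classical in
/-- The polynomial `q ^ (ℓ(b) - ℓ(z)) R^{J,x}_{z,b}(q⁻¹)` as a sum over the coset of `z`. -/
theorem reflect_cosetFunctional {J : Set B} {x : ℤ[X]} (hx : x = -1 ∨ x = X) {z b : W}
    (hz : z ∈ cs.minReps J) :
    (cs.cosetFunctional J x z (cs.rColumn b)).reflect (cs.length b - cs.length z) =
      ∑ y ∈ (cs.finite_lower b).toFinset with cs.minRep J y = z,
        (X - 1 - x) ^ (cs.length (z⁻¹ * y)) *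
          ((-1) ^ (cs.length b + cs.length y) * cs.rColumn b y) := by
  rw [cs.cosetFunctional_apply J x z _ _ (cs.rColumn_support_subset b), reflect_finset_sum,
    Finset.sum_filter]
  refine Finset.sum_congr rfl fun y hy => ?_
  rw [Set.Finite.mem_toFinset] at hy
  rw [cs.minRep_eq_iff hz]
  split_ifs with h
  · have hlen := cs.length_mul_of_mem_minReps hz h
    rw [mul_inv_cancel_left] at hlen
    have hle := BruhatLE.length_le hy
    rw [← reflect_rColumn, cosetCoeff, if_pos h, hlen, Nat.add_sub_cancel_left, mul_comm,
      reflect_mul_of_add (m := cs.length (z⁻¹ * y)) (n := cs.length b - cs.length y) (by omega)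
      (natDegree_neg_pow_le hx _) (cs.natDegree_rColumn_le _ _), reflect_neg_pow hx, ← hlen]
  · rw [cosetCoeff_of_notMem _ h, mul_zero, reflect_zero]

/-- The bar involution is an involution: the matrix `(R^{J,x}_{a,b})` is inverse to the matrix
`(q ^ (ℓ(b) - ℓ(a)) R^{J,x}_{a,b}(q⁻¹))`. -/
theorem sum_parabolicRPoly_mul_reflect {J : Set B} {x : ℤ[X]} (hx : x = -1 ∨ x = X) {a b : W}
    (ha : a ∈ cs.minReps J) (hb : b ∈ cs.minReps J) (hne : a ≠ b) :
    ∑ᶠ z ∈ cs.quotientInterval J a b, cs.parabolicRPoly J x a z *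
      (cs.parabolicRPoly J x z b).reflect (cs.length b - cs.length z) = 0 := by
  classical
  have hx' := quadratic_of_type hx
  set S := (cs.finite_lower b).toFinset with hS
  have h1 : ∑ᶠ z ∈ cs.quotientInterval J a b, cs.parabolicRPoly J x a z *
      (cs.parabolicRPoly J x z b).reflect (cs.length b - cs.length z) =
      ∑ z ∈ S with z ∈ cs.minReps J, cs.parabolicRPoly J x a z *
      (cs.parabolicRPoly J x z b).reflect (cs.length b - cs.length z) := by
    refine finsum_mem_eq_sum_of_inter_support_eq _ ?_
    ext z
    simp only [Set.mem_inter_iff, Function.mem_support, Finset.coe_filter, Set.mem_ofPred_eq, hS,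
      Set.Finite.mem_toFinset, quotientInterval, bruhatInterval]
    constructor
    · rintro ⟨⟨h1, h2, h3⟩, h4⟩; exact ⟨⟨h3, h1⟩, h4⟩
    · rintro ⟨⟨h1, h2⟩, h3⟩
      refine ⟨⟨h2, ?_, h1⟩, h3⟩
      by_contra h4
      rw [(cs.isParabolicRFamily_parabolicRPoly J hx').eq_zero a z fun h => h4 h.2.2,
        zero_mul] at h3
      exact h3 rfl
  -- Expanding the reflected factor over the coset of `z` turns the sum over minimal
  -- representatives into a sum over all of the lower set of `b`.
  have h2 : ∀ z ∈ S.filter (· ∈ cs.minReps J), cs.parabolicRPoly J x a z *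
      (cs.parabolicRPoly J x z b).reflect (cs.length b - cs.length z) =
      ∑ y ∈ S with cs.minRep J y = z, cs.rColumn b y * ((-1) ^ (cs.length b + cs.length y) *
        cs.cosetFunctional J x a (cs.rColumn y)) := by
    intro z hz
    have hz := (Finset.mem_filter.1 hz).2
    rw [cs.parabolicRPoly_eq hx' ha hz, cs.parabolicRPoly_eq hx' hz hb,
      cs.reflect_cosetFunctional hx hz, Finset.mul_sum]
    refine Finset.sum_congr rfl fun y hy => ?_
    have hy := (cs.minRep_eq_iff hz).1 (Finset.mem_filter.1 hy).2
    have h3 := cs.cosetFunctional_rColumn_mul hx' ha hz hy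
    rw [mul_inv_cancel_left] at h3
    rw [h3]; ring
  rw [h1, Finset.sum_congr rfl h2]
  refine (Finset.sum_fiberwise_of_maps_to (g := cs.minRep J) ?_ _).trans ?_
  rotate_left
  · have h3 := congrArg (cs.cosetFunctional J x a) (cs.signedMatrix_rColumn b)
    rw [map_smul, cosetFunctional_basisVec, cosetCoeff_of_notMem _
      (fun h => hne (cs.eq_of_mem_minReps ha hb h)), smul_zero, signedMatrix,
      Finsupp.linearCombination_apply,
      Finsupp.sum_of_support_subset _ (cs.rColumn_support_subset b) _ (by simp), map_sum] at h3
    simp only [map_smul, smul_eq_mul] at h3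
    rw [← mul_zero ((-1 : ℤ[X]) ^ cs.length b), ← h3, Finset.mul_sum]
    refine Finset.sum_congr rfl fun y _ => ?_
    rw [pow_add]; ring
  · intro y hy
    rw [hS, Set.Finite.mem_toFinset] at hy
    rw [Finset.mem_filter, hS, Set.Finite.mem_toFinset]
    exact ⟨(cs.minRep_bruhatLE J y).trans hy, cs.minRep_mem J y⟩

theorem natDegree_parabolicRPoly_le {J : Set B} {x : ℤ[X]} (hx : x = -1 ∨ x = X) {a b : W}
    (ha : a ∈ cs.minReps J) (hb : b ∈ cs.minReps J) :
    (cs.parabolicRPoly J x a b).natDegree ≤ cs.length b - cs.length a := by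
  rw [cs.parabolicRPoly_eq (quadratic_of_type hx) ha hb,
    cs.cosetFunctional_apply J x a _ _ (cs.rColumn_support_subset b)]
  refine natDegree_sum_le_of_forall_le _ _ fun y hy => ?_
  rw [Set.Finite.mem_toFinset] at hy
  by_cases h : a⁻¹ * y ∈ cs.parabolic J
  · have hlen := cs.length_mul_of_mem_minReps ha h
    rw [mul_inv_cancel_left] at hlen
    rw [cosetCoeff, if_pos h, hlen, Nat.add_sub_cancel_left]
    refine natDegree_mul_le.trans ?_
    have h1 := cs.natDegree_rColumn_le y b
    have h2 := natDegree_neg_pow_le hx (cs.length (a⁻¹ * y))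
    have := BruhatLE.length_le hy
    omega
  · rw [cosetCoeff_of_notMem _ h]; simp

end Inversion

/-! ### Existence and uniqueness of the Kazhdan–Lusztig polynomials -/

section KLExistence

/-- The part of a polynomial of degree less than `n / 2`. -/
def lowPart (n : ℕ) (p : ℤ[X]) : ℤ[X] := ∑ i ∈ Finset.range ((n + 1) / 2), monomial i (p.coeff i)

theorem coeff_lowPart (n : ℕ) (p : ℤ[X]) (i : ℕ) :
    (lowPart n p).coeff i = if 2 * i < n then p.coeff i else 0 := by
  have h : i < (n + 1) / 2 ↔ 2 * i < n := by omega
  simp [lowPart, coeff_monomial, h]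

theorem natDegree_lowPart {n : ℕ} (hn : 0 < n) (p : ℤ[X]) :
    2 * (lowPart n p).natDegree + 1 ≤ n := by
  by_cases h : lowPart n p = 0
  · rw [h]; simp; omega
  · have h1 := leadingCoeff_ne_zero.2 h
    rw [leadingCoeff, coeff_lowPart] at h1
    split_ifs at h1 with h2
    · omega
    · exact absurd rfl h1

/-- If `p` is antisymmetric under `reflect n`, then `P = -lowPart n p` solves
`P.reflect n = P + p`. -/
theorem reflect_neg_lowPart {n : ℕ} {p : ℤ[X]} (hp : p.reflect n = -p) :
    (-lowPart n p).reflect n = -lowPart n p + p := by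
  ext i
  have h1 : ∀ j, p.coeff (revAt n j) = -p.coeff j := fun j => by
    rw [← coeff_reflect, hp, coeff_neg]
  have h2 := h1 i
  rw [coeff_reflect, coeff_add, coeff_neg, coeff_neg, coeff_lowPart, coeff_lowPart]
  rcases le_or_gt i n with h | h
  · rw [revAt_le h] at h2 ⊢
    rcases lt_trichotomy (2 * i) n with h3 | h3 | h3
    · rw [if_neg (by omega), if_pos h3]; ring
    · rw [if_neg (by omega), if_neg (by omega)]
      rw [show n - i = i by omega] at h2
      omega
    · rw [if_pos (by omega), if_neg (by omega)]; omega
  · have h3 : revAt n i = i := revAt_eq_self_of_lt h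
    rw [h3] at h2 ⊢
    rw [if_neg (by omega)]; omega

/-- A polynomial of degree less than `n / 2` is determined by the antisymmetric part of its
reflection. -/
theorem eq_of_reflect_sub_eq {n : ℕ} {p p' : ℤ[X]} (hp : 2 * p.natDegree + 1 ≤ n)
    (hp' : 2 * p'.natDegree + 1 ≤ n) (h : p.reflect n - p = p'.reflect n - p') : p = p' := by
  ext i
  by_cases hi : 2 * i < n
  · have h1 := congrArg (fun r => r.coeff i) h
    simp only [coeff_sub, coeff_reflect] at h1
    rw [revAt_le (by omega), coeff_eq_zero_of_natDegree_lt (p := p) (n := n - i) (by omega),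
      coeff_eq_zero_of_natDegree_lt (p := p') (n := n - i) (by omega)] at h1
    omega
  · rw [coeff_eq_zero_of_natDegree_lt (by omega), coeff_eq_zero_of_natDegree_lt (by omega)]

variable {B W : Type u} [Group W] {M : CoxeterMatrix B} (cs : CoxeterSystem M W)

open Classical in
/-- The parabolic Kazhdan–Lusztig polynomial `P^{J,x}_{a,b}`, computed by recursion on the length
of `[a, b]`. The top element `b`, which is fixed in the recursion, is the first argument. -/
def klRec (J : Set B) (x : ℤ[X]) (b a : W) : ℤ[X] :=
  if a ∈ cs.minReps J ∧ b ∈ cs.minReps J ∧ cs.BruhatLE a b then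
    if a = b then 1
    else -lowPart (cs.length b - cs.length a) (∑ z ∈ (cs.finite_lower b).toFinset,
      if _h : cs.BruhatLE a z ∧ a ≠ z ∧ cs.BruhatLE z b then
        cs.parabolicRPoly J x a z * klRec J x b z else 0)
  else 0
termination_by cs.length b - cs.length a
decreasing_by
  have h1 := _h.1.length_lt _h.2.1
  have h2 := _h.2.2.length_le
  omega

theorem finsum_quotientInterval_eq {J : Set B} {a y b : W} (hyb : cs.BruhatLE y b) (f : W → ℤ[X])
    (hf : ∀ z, ¬ z ∈ cs.quotientInterval J a y → f z = 0) :
    ∑ᶠ z ∈ cs.quotientInterval J a y, f z = ∑ z ∈ (cs.finite_lower b).toFinset, f z := by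
  refine finsum_mem_eq_sum_of_inter_support_eq _ ?_
  ext z
  simp only [Set.mem_inter_iff, Function.mem_support, Set.Finite.coe_toFinset, Set.mem_ofPred_eq]
  constructor
  · rintro ⟨h1, h2⟩; exact ⟨h1.2.2.trans hyb, h2⟩
  · rintro ⟨h1, h2⟩
    refine ⟨?_, h2⟩
    by_contra h3
    exact h2 (hf z h3)

theorem parabolicRPoly_mul_eq_zero {J : Set B} {x : ℤ[X]} (hx : x = -1 ∨ x = X) {a b z : W}
    {P : W → ℤ[X]} (hP : ∀ z, ¬ (z ∈ cs.minReps J ∧ cs.BruhatLE z b) → P z = 0)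
    (h : ¬ z ∈ cs.quotientInterval J a b) : cs.parabolicRPoly J x a z * P z = 0 := by
  have hR := cs.isParabolicRFamily_parabolicRPoly J (quadratic_of_type hx)
  by_cases h1 : z ∈ cs.minReps J ∧ cs.BruhatLE z b
  · rw [hR.eq_zero a z fun h2 => h ⟨h1.1, h2.2.2, h1.2⟩, zero_mul]
  · rw [hP z h1, mul_zero]

/-- The inversion formula with the two factors exchanged, as a sum over a lower set. -/
theorem sum_reflect_mul_parabolicRPoly {J : Set B} {x : ℤ[X]} (hx : x = -1 ∨ x = X) {a y b : W}
    (ha : a ∈ cs.minReps J) (hyb : cs.BruhatLE y b) (hne : a ≠ y) :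
    ∑ z ∈ (cs.finite_lower b).toFinset,
      (cs.parabolicRPoly J x a z).reflect (cs.length z - cs.length a) *
        cs.parabolicRPoly J x z y = 0 := by
  have hR := cs.isParabolicRFamily_parabolicRPoly J (quadratic_of_type hx)
  by_cases hy : y ∈ cs.minReps J
  swap
  · exact Finset.sum_eq_zero fun z _ => by rw [hR.eq_zero z y fun h => hy h.2.1, mul_zero]
  have h1 := cs.sum_parabolicRPoly_mul_reflect hx ha hy hne
  rw [cs.finsum_quotientInterval_eq hyb] at h1
  · have h2 := congrArg (fun p : ℤ[X] => p.reflect (cs.length y - cs.length a)) h1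
    simp only [reflect_finset_sum, reflect_zero] at h2
    rw [← h2]
    refine Finset.sum_congr rfl fun z _ => ?_
    by_cases h3 : z ∈ cs.minReps J ∧ cs.BruhatLE a z ∧ cs.BruhatLE z y
    · have h4 := h3.2.1.length_le
      have h5 := h3.2.2.length_le
      rw [reflect_mul_of_add (m := cs.length z - cs.length a) (n := cs.length y - cs.length z)
        (by omega) (cs.natDegree_parabolicRPoly_le hx ha h3.1), reflect_reflect]
      refine (natDegree_reflect_le).trans ?_
      have := cs.natDegree_parabolicRPoly_le hx h3.1 hy
      omega
    · by_cases h4 : z ∈ cs.minReps J ∧ cs.BruhatLE a z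
      · rw [hR.eq_zero z y fun h => h3 ⟨h.1, h4.2, h.2.2⟩]; simp
      · rw [hR.eq_zero a z fun h => h4 ⟨h.2.1, h.2.2⟩]; simp
  · intro z hz
    refine cs.parabolicRPoly_mul_eq_zero (b := y) hx
      (P := fun z => (cs.parabolicRPoly J x z y).reflect (cs.length y - cs.length z)) ?_ hz
    intro z hz
    rw [hR.eq_zero z y fun h => hz ⟨h.1, h.2.2⟩, reflect_zero]

theorem klRec_eq_zero {J : Set B} {x : ℤ[X]} {a b : W}
    (h : ¬ (a ∈ cs.minReps J ∧ b ∈ cs.minReps J ∧ cs.BruhatLE a b)) : cs.klRec J x b a = 0 := by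
  rw [klRec, if_neg h]

theorem klRec_self {J : Set B} {x : ℤ[X]} {a : W} (ha : a ∈ cs.minReps J) :
    cs.klRec J x a a = 1 := by
  rw [klRec, if_pos ⟨ha, ha, cs.bruhatLE_refl a⟩, if_pos rfl]

open Classical in
theorem klRec_of_ne {J : Set B} {x : ℤ[X]} (hx : x = -1 ∨ x = X) {a b : W}
    (ha : a ∈ cs.minReps J) (hb : b ∈ cs.minReps J) (hab : cs.BruhatLE a b) (hne : a ≠ b) :
    cs.klRec J x b a = -lowPart (cs.length b - cs.length a)
      (∑ z ∈ (cs.finite_lower b).toFinset.erase a, cs.parabolicRPoly J x a z *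
        cs.klRec J x b z) := by
  rw [klRec, if_pos ⟨ha, hb, hab⟩, if_neg hne, ← Finset.add_sum_erase _ _
    (by simpa using hab : a ∈ (cs.finite_lower b).toFinset), dif_neg (by simp), zero_add]
  congr 2
  refine Finset.sum_congr rfl fun z hz => ?_
  have hR := cs.isParabolicRFamily_parabolicRPoly J (quadratic_of_type hx)
  rw [Finset.mem_erase, Set.Finite.mem_toFinset] at hz
  split_ifs with h
  · rfl
  · rw [hR.eq_zero a z fun h' => h ⟨h'.2.2, hz.1.symm, hz.2⟩, zero_mul]

theorem two_mul_natDegree_klRec {J : Set B} {x : ℤ[X]} (hx : x = -1 ∨ x = X) {a b : W}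
    (ha : a ∈ cs.minReps J) (hb : b ∈ cs.minReps J) (hab : cs.BruhatLE a b) (hne : a ≠ b) :
    2 * (cs.klRec J x b a).natDegree + 1 ≤ cs.length b - cs.length a := by
  classical
  rw [cs.klRec_of_ne hx ha hb hab hne, natDegree_neg]
  exact natDegree_lowPart (by have := hab.length_lt hne; omega) _

theorem natDegree_klRec_le {J : Set B} {x : ℤ[X]} (hx : x = -1 ∨ x = X) {a b : W} :
    (cs.klRec J x b a).natDegree ≤ cs.length b - cs.length a := by
  by_cases h : a ∈ cs.minReps J ∧ b ∈ cs.minReps J ∧ cs.BruhatLE a b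
  · by_cases hne : a = b
    · subst hne; rw [cs.klRec_self h.1]; simp
    · have := cs.two_mul_natDegree_klRec hx h.1 h.2.1 h.2.2 hne
      omega
  · rw [cs.klRec_eq_zero h]; simp

/-- The inversion formula for `klRec`. The terms of index `z ≠ a` of its right-hand side have an
antisymmetric sum, by induction and the inversion formula for parabolic `R`-polynomials, so that
`reflect_neg_lowPart` applies. -/
theorem reflect_klRec {J : Set B} {x : ℤ[X]} (hx : x = -1 ∨ x = X) {a b : W}
    (ha : a ∈ cs.minReps J) (hb : b ∈ cs.minReps J) (hab : cs.BruhatLE a b) :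
    (cs.klRec J x b a).reflect (cs.length b - cs.length a) =
      ∑ z ∈ (cs.finite_lower b).toFinset, cs.parabolicRPoly J x a z * cs.klRec J x b z := by
  classical
  have hR := cs.isParabolicRFamily_parabolicRPoly J (quadratic_of_type hx)
  induction hn : cs.length b - cs.length a using Nat.strong_induction_on generalizing a with
  | _ n ih =>
  subst hn
  set S := (cs.finite_lower b).toFinset with hS
  have haS : a ∈ S := by simpa [hS] using hab
  by_cases hne : a = b
  · subst hne
    rw [Finset.sum_eq_single_of_mem a haS, hR.diag a ha, cs.klRec_self ha]
    · simp
    · intro z hz hza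
      rw [hS, Set.Finite.mem_toFinset] at hz
      rw [hR.eq_zero a z fun h => hza (cs.bruhatLE_antisymm hz h.2.2), zero_mul]
  rw [← Finset.add_sum_erase _ _ haS, hR.diag a ha, one_mul]
  conv_lhs => rw [cs.klRec_of_ne hx ha hb hab hne]
  conv_rhs => rw [cs.klRec_of_ne hx ha hb hab hne]
  refine reflect_neg_lowPart ?_
  have h1 : ∀ z ∈ S.erase a, (cs.parabolicRPoly J x a z * cs.klRec J x b z).reflect
      (cs.length b - cs.length a) = ∑ y ∈ S, cs.klRec J x b y *
        ((cs.parabolicRPoly J x a z).reflect (cs.length z - cs.length a) *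
          cs.parabolicRPoly J x z y) := by
    intro z hz
    rw [Finset.mem_erase, hS, Set.Finite.mem_toFinset] at hz
    obtain ⟨hza, hzb⟩ := hz
    by_cases h2 : z ∈ cs.minReps J ∧ cs.BruhatLE a z
    · have h3 := h2.2.length_lt hza.symm
      have h4 := BruhatLE.length_le hzb
      rw [reflect_mul_of_add (m := cs.length z - cs.length a) (n := cs.length b - cs.length z)
        (by omega) (cs.natDegree_parabolicRPoly_le hx ha h2.1) (cs.natDegree_klRec_le hx),
        ih _ (by omega) h2.1 hzb rfl, Finset.mul_sum]
      exact Finset.sum_congr rfl fun y _ => by ring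
    · rw [hR.eq_zero a z fun h => h2 ⟨h.2.1, h.2.2⟩]; simp
  have h2 : ∀ y ∈ S, ∑ z ∈ S.erase a,
      (cs.parabolicRPoly J x a z).reflect (cs.length z - cs.length a) *
        cs.parabolicRPoly J x z y = (if y = a then 1 else 0) - cs.parabolicRPoly J x a y := by
    intro y hy
    rw [hS, Set.Finite.mem_toFinset] at hy
    have h3 : (cs.parabolicRPoly J x a a).reflect (cs.length a - cs.length a) *
        cs.parabolicRPoly J x a y = cs.parabolicRPoly J x a y := by
      rw [hR.diag a ha]; simp
    split_ifs with h4
    · subst h4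
      rw [hR.diag y ha, sub_self]
      refine Finset.sum_eq_zero fun z hz => ?_
      rw [Finset.mem_erase] at hz
      by_cases h5 : cs.BruhatLE y z
      · rw [hR.eq_zero z y fun h => hz.1 (cs.bruhatLE_antisymm h.2.2 h5), mul_zero]
      · rw [hR.eq_zero y z fun h => h5 h.2.2]; simp
    · have h5 := cs.sum_reflect_mul_parabolicRPoly hx ha hy (Ne.symm h4)
      rw [← hS, ← Finset.add_sum_erase _ _ haS, h3] at h5
      rw [zero_sub]
      exact eq_neg_of_add_eq_zero_right h5
  rw [reflect_finset_sum, Finset.sum_congr rfl h1, Finset.sum_comm]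
  simp only [← Finset.mul_sum]
  rw [Finset.sum_congr rfl fun y hy => by rw [h2 y hy]]
  simp only [mul_sub, Finset.sum_sub_distrib, mul_ite, mul_one, mul_zero]
  rw [Finset.sum_ite_eq' S a, if_pos haS, ← Finset.add_sum_erase _ _ haS, hR.diag a ha, mul_one,
    sub_add_cancel_left, neg_inj]
  exact Finset.sum_congr rfl fun y _ => mul_comm _ _

theorem isParabolicKLFamily_klRec (J : Set B) {x : ℤ[X]} (hx : x = -1 ∨ x = X) :
    cs.IsParabolicKLFamily J x fun a b => cs.klRec J x b a where
  eq_zero _ _ h := cs.klRec_eq_zero h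
  diag _ ha := cs.klRec_self ha
  degree _ ha _ hb hab hne := cs.two_mul_natDegree_klRec hx ha hb hab hne
  inversion a ha b hb hab := by
    rw [cs.reflect_klRec hx ha hb hab, cs.finsum_quotientInterval_eq (cs.bruhatLE_refl b)]
    intro z hz
    exact cs.parabolicRPoly_mul_eq_zero hx (P := fun z => cs.klRec J x b z)
      (fun z hz => cs.klRec_eq_zero fun h => hz ⟨h.1, h.2.2⟩) hz

theorem isParabolicKLFamily_parabolicKLPoly (J : Set B) {x : ℤ[X]} (hx : x = -1 ∨ x = X) :
    cs.IsParabolicKLFamily J x (cs.parabolicKLPoly J x) :=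
  Classical.epsilon_spec ⟨_, cs.isParabolicKLFamily_klRec J hx⟩

variable {cs} in
/-- The inversion formula with the term of index `a` moved to the left. -/
theorem IsParabolicKLFamily.reflect_sub {J : Set B} {x : ℤ[X]} {P : W → W → ℤ[X]}
    (h : cs.IsParabolicKLFamily J x P) (hx : x = -1 ∨ x = X) {a b : W}
    (ha : a ∈ cs.minReps J) (hb : b ∈ cs.minReps J) (hab : cs.BruhatLE a b) :
    (P a b).reflect (cs.length b - cs.length a) - P a b =
      ∑ᶠ z ∈ cs.quotientInterval J a b \ {a}, cs.parabolicRPoly J x a z * P z b := by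
  have hR := cs.isParabolicRFamily_parabolicRPoly J (quadratic_of_type hx)
  have haI : a ∈ cs.quotientInterval J a b := ⟨ha, cs.bruhatLE_refl a, hab⟩
  have hfin := cs.finite_quotientInterval J a b
  have h2 := finsum_mem_inter_add_sdiff (f := fun z => cs.parabolicRPoly J x a z * P z b)
    ({a} : Set W) hfin
  rw [Set.inter_eq_self_of_subset_right (by simpa using haI), finsum_mem_singleton, hR.diag a ha,
    one_mul] at h2
  rw [h.inversion a ha b hb hab, ← h2, add_sub_cancel_left]

variable {cs} in
theorem IsParabolicKLFamily.unique {J : Set B} {x : ℤ[X]} {P P' : W → W → ℤ[X]}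
    (hx : x = -1 ∨ x = X)
    (h : cs.IsParabolicKLFamily J x P) (h' : cs.IsParabolicKLFamily J x P') : P = P' := by
  funext a b
  induction hn : cs.length b - cs.length a using Nat.strong_induction_on generalizing a with
  | _ n ih =>
  subst hn
  by_cases hab : a ∈ cs.minReps J ∧ b ∈ cs.minReps J ∧ cs.BruhatLE a b
  swap
  · rw [h.eq_zero _ _ hab, h'.eq_zero _ _ hab]
  obtain ⟨ha, hb, hab⟩ := hab
  by_cases hne : a = b
  · subst hne; rw [h.diag _ ha, h'.diag _ ha]
  refine eq_of_reflect_sub_eq (h.degree a ha b hb hab hne) (h'.degree a ha b hb hab hne) ?_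
  rw [h.reflect_sub hx ha hb hab, h'.reflect_sub hx ha hb hab]
  refine finsum_mem_congr rfl fun z hz => ?_
  have h1 := hz.1.2.1.length_lt (Ne.symm hz.2)
  have h2 := hz.1.2.2.length_le
  rw [ih _ (by omega) z rfl]

/-- For `J = ∅` and any `x`, parabolic Kazhdan–Lusztig polynomials are Kazhdan–Lusztig
polynomials. -/
theorem isKLFamily_iff (x : ℤ[X]) (P : W → W → ℤ[X]) :
    cs.IsKLFamily P ↔ cs.IsParabolicKLFamily ∅ x P := by
  have h : ∀ a, a ∈ cs.minReps (∅ : Set B) := by simp [minReps_empty]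
  have hI : ∀ a b, cs.quotientInterval ∅ a b = cs.bruhatInterval a b := by
    intro a b; ext z; simp [quotientInterval, h]
  constructor
  · intro hP
    refine ⟨fun a b hab => hP.eq_zero a b fun h' => hab ⟨h a, h b, h'⟩, fun a _ => hP.diag a,
      fun a _ b _ => hP.degree a b, fun a _ b _ hab => ?_⟩
    rw [hI, ← rPoly_eq_parabolicRPoly]
    exact hP.inversion a b hab
  · intro hP
    refine ⟨fun a b hab => hP.eq_zero a b fun h' => hab h'.2.2, fun a => hP.diag a (h a),
      fun a b => hP.degree a (h a) b (h b), fun a b hab => ?_⟩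
    rw [← hI, cs.rPoly_eq_parabolicRPoly x]
    exact hP.inversion a (h a) b (h b) hab

theorem klPoly_eq_parabolicKLPoly (x : ℤ[X]) : cs.klPoly = cs.parabolicKLPoly ∅ x := by
  have : cs.IsKLFamily = cs.IsParabolicKLFamily ∅ x :=
    funext fun P => propext (cs.isKLFamily_iff x P)
  rw [klPoly, parabolicKLPoly, this]

end KLExistence

/-! ### Isomorphic intervals -/

section IntervalIso

variable {B W : Type u} [Group W] {M : CoxeterMatrix B} (cs : CoxeterSystem M W)
variable {B' W' : Type u} [Group W'] {M' : CoxeterMatrix B'} (cs' : CoxeterSystem M' W')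

/-- The map `f` restricts to a poset isomorphism `[a, b] → [a', b']`. Working with a map which is
defined on all of `W` makes the restriction to smaller intervals immediate. -/
structure IsIntervalIso (f : W → W') (a b : W) (a' b' : W') : Prop where
  bijOn : Set.BijOn f (cs.bruhatInterval a b) (cs'.bruhatInterval a' b')
  le_iff : ∀ y ∈ cs.bruhatInterval a b, ∀ z ∈ cs.bruhatInterval a b,
    cs.BruhatLE y z ↔ cs'.BruhatLE (f y) (f z)

theorem left_mem_bruhatInterval {a b : W} (h : cs.BruhatLE a b) : a ∈ cs.bruhatInterval a b :=
  ⟨cs.bruhatLE_refl a, h⟩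

theorem right_mem_bruhatInterval {a b : W} (h : cs.BruhatLE a b) : b ∈ cs.bruhatInterval a b :=
  ⟨h, cs.bruhatLE_refl b⟩

open Classical in
theorem exists_extension_relIso {a b : W} {a' b' : W'}
    (Φ : cs.inducedOrder (cs.bruhatInterval a b) ≃r cs'.inducedOrder (cs'.bruhatInterval a' b')) :
    ∃ f, IsIntervalIso cs cs' f a b a' b' ∧ ∀ z : cs.bruhatInterval a b, f z = Φ z := by
  let f : W → W' := fun z => if h : z ∈ cs.bruhatInterval a b then (Φ ⟨z, h⟩ : W') else 1
  have hf : ∀ z : cs.bruhatInterval a b, f z = Φ z := by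
    rintro ⟨z, hz⟩; simp [f, hz]
  refine ⟨f, ⟨⟨?_, ?_, ?_⟩, ?_⟩, hf⟩
  · intro z hz
    have := hf ⟨z, hz⟩
    rw [this]; exact (Φ ⟨z, hz⟩).2
  · intro y hy z hz h
    rw [hf ⟨y, hy⟩, hf ⟨z, hz⟩] at h
    exact congrArg Subtype.val (Φ.injective (Subtype.ext h))
  · intro z hz
    obtain ⟨y, hy⟩ := Φ.surjective ⟨z, hz⟩
    exact ⟨y, y.2, by rw [hf y, hy]⟩
  · intro y hy z hz
    rw [hf ⟨y, hy⟩, hf ⟨z, hz⟩]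
    exact (Φ.map_rel_iff (a := ⟨y, hy⟩) (b := ⟨z, hz⟩)).symm

variable {cs cs'} {f : W → W'} {a b : W} {a' b' : W'}

theorem IsIntervalIso.nonempty_relIso (h : IsIntervalIso cs cs' f a b a' b') :
    Nonempty (cs.inducedOrder (cs.bruhatInterval a b) ≃r
      cs'.inducedOrder (cs'.bruhatInterval a' b')) :=
  ⟨⟨h.bijOn.equiv f, fun {y z} => (h.le_iff y y.2 z z.2).symm⟩⟩

theorem IsIntervalIso.map_left (h : IsIntervalIso cs cs' f a b a' b') (hab : cs.BruhatLE a b)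
    (hab' : cs'.BruhatLE a' b') : f a = a' := by
  obtain ⟨y, hy, hya⟩ := h.bijOn.surjOn (cs'.left_mem_bruhatInterval hab')
  refine cs'.bruhatLE_antisymm ?_ (h.bijOn.mapsTo (cs.left_mem_bruhatInterval hab)).1
  rw [← hya]
  exact (h.le_iff _ (cs.left_mem_bruhatInterval hab) _ hy).1 hy.1

theorem IsIntervalIso.map_right (h : IsIntervalIso cs cs' f a b a' b') (hab : cs.BruhatLE a b)
    (hab' : cs'.BruhatLE a' b') : f b = b' := by
  obtain ⟨y, hy, hyb⟩ := h.bijOn.surjOn (cs'.right_mem_bruhatInterval hab')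
  refine cs'.bruhatLE_antisymm (h.bijOn.mapsTo (cs.right_mem_bruhatInterval hab)).2 ?_
  rw [← hyb]
  exact (h.le_iff _ hy _ (cs.right_mem_bruhatInterval hab)).1 hy.2

theorem IsIntervalIso.restrict (h : IsIntervalIso cs cs' f a b a' b') {y z : W}
    (hay : cs.BruhatLE a y) (hyz : cs.BruhatLE y z)
    (hzb : cs.BruhatLE z b) : IsIntervalIso cs cs' f y z (f y) (f z) := by
  have hsub : cs.bruhatInterval y z ⊆ cs.bruhatInterval a b :=
    fun w hw => ⟨hay.trans hw.1, hw.2.trans hzb⟩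
  have hy := hsub (cs.left_mem_bruhatInterval hyz)
  have hz := hsub (cs.right_mem_bruhatInterval hyz)
  refine ⟨⟨fun w hw => ?_, h.bijOn.injOn.mono hsub, fun w' hw' => ?_⟩,
    fun w hw v hv => h.le_iff w (hsub hw) v (hsub hv)⟩
  · exact ⟨(h.le_iff _ hy _ (hsub hw)).1 hw.1, (h.le_iff _ (hsub hw) _ hz).1 hw.2⟩
  · obtain ⟨w, hw, rfl⟩ := h.bijOn.surjOn
      (show w' ∈ cs'.bruhatInterval a' b' from
        ⟨(h.bijOn.mapsTo hy).1.trans hw'.1, hw'.2.trans (h.bijOn.mapsTo hz).2⟩)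
    exact ⟨w, ⟨(h.le_iff _ hy _ hw).2 hw'.1, (h.le_iff _ hw _ hz).2 hw'.2⟩, rfl⟩

theorem IsIntervalIso.symm (h : IsIntervalIso cs cs' f a b a' b') :
    ∃ g, IsIntervalIso cs' cs g a' b' a b := by
  obtain ⟨Φ⟩ := h.nonempty_relIso
  obtain ⟨g, hg, _⟩ := exists_extension_relIso cs' cs Φ.symm
  exact ⟨g, hg⟩

/-- An isomorphism of intervals preserves the difference of the lengths of the end points, as the
Bruhat order is graded. -/
theorem IsIntervalIso.length_sub_le (h : IsIntervalIso cs cs' f a b a' b')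
    (hab : cs.BruhatLE a b) (hab' : cs'.BruhatLE a' b') :
    cs.length b - cs.length a ≤ cs'.length b' - cs'.length a' := by
  induction hn : cs.length b - cs.length a using Nat.strong_induction_on generalizing a a' with
  | _ n ih =>
  subst hn
  by_cases hne : a = b
  · rw [hne]; simp
  obtain ⟨z, haz, hzb, hz⟩ := cs.exists_cover hab hne
  have h1 := hab.length_lt hne
  have hmem : z ∈ cs.bruhatInterval a b := ⟨haz, hzb⟩
  have hfz := h.bijOn.mapsTo hmem
  have h2 := h.restrict haz hzb (cs.bruhatLE_refl b)
  rw [h.map_right hab hab'] at h2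
  have h3 := ih _ (by omega) h2 hzb hfz.2 rfl
  have h4 : a' ≠ f z := by
    intro h4
    rw [← h.map_left hab hab'] at h4
    have := h.bijOn.injOn (cs.left_mem_bruhatInterval hab) hmem h4
    rw [← this] at hz; omega
  have h5 := hfz.1.length_lt h4
  have h6 := hfz.2.length_le
  omega

theorem IsIntervalIso.length_sub_eq (h : IsIntervalIso cs cs' f a b a' b')
    (hab : cs.BruhatLE a b) (hab' : cs'.BruhatLE a' b') :
    cs.length b - cs.length a = cs'.length b' - cs'.length a' := by
  obtain ⟨g, hg⟩ := h.symm
  exact le_antisymm (h.length_sub_le hab hab') (hg.length_sub_le hab' hab)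

/-- `R`-polynomials are determined by the Kazhdan–Lusztig polynomials of all subintervals. -/
theorem IsIntervalIso.rPoly_eq
    (hKL : ∀ (f : W → W') (a b : W) (a' b' : W'), IsIntervalIso cs cs' f a b a' b' →
      cs.BruhatLE a b → cs'.BruhatLE a' b' → cs.klPoly a b = cs'.klPoly a' b')
    (h : IsIntervalIso cs cs' f a b a' b')
    (hab : cs.BruhatLE a b) (hab' : cs'.BruhatLE a' b') :
    cs.rPoly a b = cs'.rPoly a' b' := by
  induction hn : cs.length b - cs.length a using Nat.strong_induction_on generalizing b b' with
  | _ n ih =>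
  subst hn
  have hP := (cs.isKLFamily_iff (-1) _).2 (cs.klPoly_eq_parabolicKLPoly (-1) ▸
    cs.isParabolicKLFamily_parabolicKLPoly ∅ (Or.inl rfl))
  have hP' := (cs'.isKLFamily_iff (-1) _).2 (cs'.klPoly_eq_parabolicKLPoly (-1) ▸
    cs'.isParabolicKLFamily_parabolicKLPoly ∅ (Or.inl rfl))
  have hb := cs.right_mem_bruhatInterval hab
  have hb' := cs'.right_mem_bruhatInterval hab'
  -- The term of index `b` in the inversion formula is `R_{a,b}`; the other terms are known.
  have h1 := hP.inversion a b hab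
  have h1' := hP'.inversion a' b' hab'
  rw [← finsum_mem_add_sdiff (s := {b}) (by simpa using hb) (cs.finite_bruhatInterval a b),
    finsum_mem_singleton, hP.diag, mul_one] at h1
  rw [← finsum_mem_add_sdiff (s := {b'}) (by simpa using hb') (cs'.finite_bruhatInterval a' b'),
    finsum_mem_singleton, hP'.diag, mul_one] at h1'
  have h2 : ∑ᶠ z ∈ cs.bruhatInterval a b \ {b}, cs.rPoly a z * cs.klPoly z b =
      ∑ᶠ z ∈ cs'.bruhatInterval a' b' \ {b'}, cs'.rPoly a' z * cs'.klPoly z b' := by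
    refine finsum_mem_eq_of_bijOn f ?_ ?_
    · have := h.bijOn.sdiff_singleton hb
      rwa [h.map_right hab hab'] at this
    · rintro z ⟨hz, hzb⟩
      have hfz := h.bijOn.mapsTo hz
      have h3 := h.restrict hz.1 hz.2 (cs.bruhatLE_refl b)
      rw [h.map_right hab hab'] at h3
      have h4 := h.restrict (cs.bruhatLE_refl a) hz.1 hz.2
      rw [h.map_left hab hab'] at h4
      have h5 := hz.2.length_lt hzb
      have h6 := hz.1.length_le
      rw [hKL _ _ _ _ _ h3 hz.2 hfz.2, ih _ (by omega) h4 hz.1 hfz.1 rfl]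
  rw [h2, hKL _ _ _ _ _ h hab hab', h.length_sub_eq hab hab', h1'] at h1
  exact (add_right_cancel h1).symm

/-- Deodhar's formula for parabolic `R`-polynomials, as a sum over a set which is described by the
posets `[a, b]^J ⊆ [a, b]` only. -/
theorem parabolicRPoly_eq_finsum {J : Set B} {x : ℤ[X]} (hx : x = -1 ∨ x = X)
    (ha : a ∈ cs.minReps J) (hb : b ∈ cs.minReps J) :
    cs.parabolicRPoly J x a b =
      ∑ᶠ z ∈ {z | z ∈ cs.bruhatInterval a b ∧
        ∀ y ∈ cs.minReps J, cs.BruhatLE a y → cs.BruhatLE y z → y = a},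
      (-x) ^ (cs.length z - cs.length a) * cs.rPoly z b := by
  classical
  rw [cs.parabolicRPoly_eq (quadratic_of_type hx) ha hb,
    cs.cosetFunctional_apply J x a _ _ (cs.rColumn_support_subset b)]
  have : ∀ z ∈ (cs.finite_lower b).toFinset, cs.rColumn b z * cs.cosetCoeff J x a z =
      if a⁻¹ * z ∈ (cs.parabolic J : Set W) then
        (-x) ^ (cs.length z - cs.length a) * cs.rPoly z b else 0 := by
    intro z _
    rw [cosetCoeff, SetLike.mem_coe, CoxeterSystem.rPoly_eq]
    split_ifs <;> ring
  rw [Finset.sum_congr rfl this, ← Finset.sum_filter]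
  symm
  refine finsum_mem_eq_sum_of_inter_support_eq _ ?_
  congr 1
  ext z
  simp only [Set.mem_ofPred_eq, Finset.coe_filter, Set.Finite.mem_toFinset, SetLike.mem_coe,
    bruhatInterval]
  constructor
  · rintro ⟨⟨h1, h2⟩, h3⟩
    exact ⟨h2, (cs.inv_mul_mem_parabolic_iff ha h1).2 h3⟩
  · rintro ⟨h1, h2⟩
    have h3 := cs.bruhatLE_of_inv_mul_mem ha h2
    exact ⟨⟨h3, h1⟩, (cs.inv_mul_mem_parabolic_iff ha h3).1 h2⟩

/-- Parabolic `R`-polynomials are invariants of the pair `[a, b]^J ⊆ [a, b]`, provided that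
Kazhdan–Lusztig polynomials are invariants of `[a, b]`. -/
theorem IsIntervalIso.parabolicRPoly_eq
    (hKL : ∀ (f : W → W') (a b : W) (a' b' : W'), IsIntervalIso cs cs' f a b a' b' →
      cs.BruhatLE a b → cs'.BruhatLE a' b' → cs.klPoly a b = cs'.klPoly a' b')
    (h : IsIntervalIso cs cs' f a b a' b')
    (hab : cs.BruhatLE a b) (hab' : cs'.BruhatLE a' b') {J : Set B} {J' : Set B'} {x : ℤ[X]}
    (hx : x = -1 ∨ x = X)
    (hJ : ∀ z ∈ cs.bruhatInterval a b, z ∈ cs.minReps J ↔ f z ∈ cs'.minReps J')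
    (ha : a ∈ cs.minReps J) (hb : b ∈ cs.minReps J) :
    cs.parabolicRPoly J x a b = cs'.parabolicRPoly J' x a' b' := by
  have hma := h.map_left hab hab'
  have hmb := h.map_right hab hab'
  have haI := cs.left_mem_bruhatInterval hab
  rw [parabolicRPoly_eq_finsum hx ha hb, parabolicRPoly_eq_finsum hx
    (hma ▸ (hJ a haI).1 ha)
    (hmb ▸ (hJ b (cs.right_mem_bruhatInterval hab)).1 hb)]
  refine finsum_mem_eq_of_bijOn f ⟨?_, h.bijOn.injOn.mono fun z hz => hz.1, ?_⟩ ?_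
  · rintro z ⟨hz, hz'⟩
    refine ⟨h.bijOn.mapsTo hz, fun y' hy' hay' hyz' => ?_⟩
    obtain ⟨y, hy, rfl⟩ := h.bijOn.surjOn
      (show y' ∈ cs'.bruhatInterval a' b' from ⟨hay', hyz'.trans (h.bijOn.mapsTo hz).2⟩)
    rw [hz' y ((hJ y hy).2 hy') hy.1 ((h.le_iff _ hy _ hz).2 hyz'), hma]
  · rintro z' ⟨hz', hy'⟩
    obtain ⟨z, hz, rfl⟩ := h.bijOn.surjOn hz'
    refine ⟨z, ⟨hz, fun y hy hay hyz => ?_⟩, rfl⟩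
    have hyI : y ∈ cs.bruhatInterval a b := ⟨hay, hyz.trans hz.2⟩
    have := hy' (f y) ((hJ y hyI).1 hy) (h.bijOn.mapsTo hyI).1 ((h.le_iff _ hyI _ hz).1 hyz)
    exact h.bijOn.injOn hyI haI (this.trans hma.symm)
  · rintro z ⟨hz, _⟩
    have h3 := h.restrict hz.1 hz.2 (cs.bruhatLE_refl b)
    have h4 := h.restrict (cs.bruhatLE_refl a) hz.1 hz.2
    have hfz := h.bijOn.mapsTo hz
    rw [hma] at h4
    rw [hmb] at h3
    rw [h3.rPoly_eq hKL hz.2 hfz.2, h4.length_sub_eq hz.1 hfz.1]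

/-- Parabolic Kazhdan–Lusztig polynomials are invariants of the pair `[a, b]^J ⊆ [a, b]`, provided
that Kazhdan–Lusztig polynomials are invariants of `[a, b]`. -/
theorem IsIntervalIso.parabolicKLPoly_eq
    (hKL : ∀ (f : W → W') (a b : W) (a' b' : W'), IsIntervalIso cs cs' f a b a' b' →
      cs.BruhatLE a b → cs'.BruhatLE a' b' → cs.klPoly a b = cs'.klPoly a' b')
    (h : IsIntervalIso cs cs' f a b a' b')
    (hab : cs.BruhatLE a b) (hab' : cs'.BruhatLE a' b') {J : Set B} {J' : Set B'} {x : ℤ[X]}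
    (hx : x = -1 ∨ x = X)
    (hJ : ∀ z ∈ cs.bruhatInterval a b, z ∈ cs.minReps J ↔ f z ∈ cs'.minReps J')
    (ha : a ∈ cs.minReps J) (hb : b ∈ cs.minReps J) :
    cs.parabolicKLPoly J x a b = cs'.parabolicKLPoly J' x a' b' := by
  induction hn : cs.length b - cs.length a using Nat.strong_induction_on generalizing a a' with
  | _ n ih =>
  subst hn
  have hP := cs.isParabolicKLFamily_parabolicKLPoly J hx
  have hP' := cs'.isParabolicKLFamily_parabolicKLPoly J' hx
  have hma := h.map_left hab hab'
  have hmb := h.map_right hab hab'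
  have haI := cs.left_mem_bruhatInterval hab
  have hbI := cs.right_mem_bruhatInterval hab
  have ha' : a' ∈ cs'.minReps J' := hma ▸ (hJ a haI).1 ha
  have hb' : b' ∈ cs'.minReps J' := hmb ▸ (hJ b hbI).1 hb
  by_cases hne : a = b
  · subst hne
    rw [← hma, ← hmb, hP.diag a ha, hP'.diag _ (hma ▸ ha')]
  have hne' : a' ≠ b' := by
    rw [← hma, ← hmb]; exact fun e => hne (h.bijOn.injOn haI hbI e)
  have hlen := h.length_sub_eq hab hab'
  refine eq_of_reflect_sub_eq (hP.degree a ha b hb hab hne)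
    (hlen ▸ hP'.degree a' ha' b' hb' hab' hne') ?_
  rw [hP.reflect_sub hx ha hb hab, hlen, hP'.reflect_sub hx ha' hb' hab']
  refine finsum_mem_eq_of_bijOn f ⟨?_, h.bijOn.injOn.mono fun z hz => hz.1.2, ?_⟩ ?_
  · rintro z ⟨⟨hzJ, hz⟩, hza⟩
    refine ⟨⟨(hJ z hz).1 hzJ, h.bijOn.mapsTo hz⟩, fun e => hza ?_⟩
    exact h.bijOn.injOn hz haI (Eq.trans e hma.symm)
  · rintro z' ⟨⟨hzJ, hz'⟩, hza⟩
    obtain ⟨z, hz, rfl⟩ := h.bijOn.surjOn hz'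
    refine ⟨z, ⟨⟨(hJ z hz).2 hzJ, hz⟩, ?_⟩, rfl⟩
    rintro rfl
    exact hza hma
  · rintro z ⟨⟨hzJ, hz⟩, hza⟩
    have hfz := h.bijOn.mapsTo hz
    have h3 := h.restrict hz.1 hz.2 (cs.bruhatLE_refl b)
    have h4 := h.restrict (cs.bruhatLE_refl a) hz.1 hz.2
    rw [hma] at h4
    rw [hmb] at h3
    have h5 := hz.1.length_lt (Ne.symm hza)
    have h6 := hz.2.length_le
    rw [h4.parabolicRPoly_eq hKL hz.1 hfz.1 hx
      (fun w hw => hJ w ⟨hw.1, hw.2.trans hz.2⟩) ha hzJ,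
      ih _ (by omega) h3 hz.2 hfz.2 (fun w hw => hJ w ⟨hz.1.trans hw.1, hw.2⟩) hzJ rfl]

end IntervalIso

/-- Combinatorial invariance implies its parabolic version: an isomorphism `[a, b] ≃ [a', b']` which
extends one of the quotient intervals matches the elements of `[a, b]^J` with those of
`[a', b']^{J'}`. -/
theorem mariettiConjecture_of_lusztigDyerConjecture
    {C : ∀ ⦃B : Type u⦄, CoxeterMatrix B → Prop} (h : LusztigDyerConjecture.{u} C) :
    MariettiConjecture.{u} C := by
  intro B B' W W' _ _ M M' cs cs' hM hM' J J' a ha b hb a' ha' b' hb' hab hab' hiso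
  obtain ⟨φ, Φ, hφ⟩ := hiso
  obtain ⟨f, hf, hfΦ⟩ := exists_extension_relIso cs cs' Φ
  have hKL : ∀ (f : W → W') (a b : W) (a' b' : W'), IsIntervalIso cs cs' f a b a' b' →
      cs.BruhatLE a b → cs'.BruhatLE a' b' → cs.klPoly a b = cs'.klPoly a' b' :=
    fun f a b a' b' hf hab hab' =>
      h B B' W W' M M' cs cs' hM hM' a b a' b' hab hab' hf.nonempty_relIso
  have hJ : ∀ z ∈ cs.bruhatInterval a b, z ∈ cs.minReps J ↔ f z ∈ cs'.minReps J' := by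
    intro z hz
    constructor
    · intro hzJ
      have h1 := hφ ⟨z, hzJ, hz⟩
      have h2 := hfΦ ⟨z, hz⟩
      simp only at h1 h2
      rw [h2, h1]
      exact (φ ⟨z, hzJ, hz⟩).2.1
    · intro hzJ
      obtain ⟨y, hy⟩ := φ.surjective ⟨f z, hzJ, hf.bijOn.mapsTo hz⟩
      have h1 := hφ y
      rw [hy, ← hfΦ] at h1
      have : (y : W) = z := hf.bijOn.injOn y.2.2 hz h1
      exact this ▸ y.2.1
  exact ⟨hf.parabolicKLPoly_eq hKL hab hab' (Or.inl rfl) hJ ha hb,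
    hf.parabolicKLPoly_eq hKL hab hab' (Or.inr rfl) hJ ha hb⟩

/-! ### The geometric representation and positivity of roots -/

section Geometric

open Real

variable {B W : Type*} [Group W] {M : CoxeterMatrix B}

/-- The solution of `c (n + 2) = K c (n + 1) - c n` with `c 0 = 0` and `c 1 = 1`; for
`K = 2 cos θ` it is `sin (n θ) / sin θ`. -/
def dihedralCoeff (K : ℝ) : ℕ → ℝ
  | 0 => 0
  | 1 => 1
  | n + 2 => K * dihedralCoeff K (n + 1) - dihedralCoeff K n

theorem dihedralCoeff_two (n : ℕ) : dihedralCoeff 2 n = n := by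
  induction n using Nat.twoStepInduction with
  | zero => simp [dihedralCoeff]
  | one => simp [dihedralCoeff]
  | more n h1 h2 => rw [dihedralCoeff, h1, h2]; push_cast; ring

theorem sin_mul_dihedralCoeff (θ : ℝ) (n : ℕ) :
    sin θ * dihedralCoeff (2 * cos θ) n = sin (n * θ) := by
  induction n using Nat.twoStepInduction with
  | zero => simp [dihedralCoeff]
  | one => simp [dihedralCoeff]
  | more n h1 h2 =>
    rw [dihedralCoeff, mul_sub, mul_left_comm, h1, h2]
    push_cast
    rw [show ((n : ℝ) + 2) * θ = (n + 1) * θ + θ by ring,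
      show (n : ℝ) * θ = (n + 1) * θ - θ by ring, sin_add, sin_sub]
    ring

theorem dihedralCoeff_nonneg {m : ℕ} (hm : m ≠ 1) {n : ℕ} (h : m = 0 ∨ n ≤ m) :
    0 ≤ dihedralCoeff (2 * cos (π / m)) n := by
  by_cases h0 : m = 0
  · subst h0; simp [dihedralCoeff_two]
  · have hn : n ≤ m := h.resolve_left h0
    have hm2 : (2 : ℝ) ≤ m := by exact_mod_cast (by omega : 2 ≤ m)
    have hθ : 0 < π / m := by positivity
    have h1 : 0 < sin (π / m) := by
      refine sin_pos_of_pos_of_lt_pi hθ ?_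
      rw [div_lt_iff₀ (by linarith)]
      nlinarith [pi_pos]
    have h2 : 0 ≤ sin (n * (π / m)) := by
      refine sin_nonneg_of_nonneg_of_le_pi (by positivity) ?_
      rw [← mul_div_assoc, div_le_iff₀ (by linarith), mul_comm]
      have : (n : ℝ) ≤ m := by exact_mod_cast hn
      nlinarith [pi_pos]
    rw [← sin_mul_dihedralCoeff] at h2
    exact nonneg_of_mul_nonneg_right h2 h1

variable (M) in
/-- The `i`-th simple coroot of the geometric representation on the real vector space with basis
`B`, with value `-2 cos (π / m(i, j))` at the `j`-th simple root. As `m = ∞` is encoded by `0` and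
`π / 0 = 0`, this value is `-2` if `m(i, j) = ∞`. -/
def coroot (i : B) : Module.Dual ℝ (B →₀ ℝ) :=
  Finsupp.linearCombination ℝ fun j => -(2 * cos (π / M i j))

/-- The simple root at `i`. -/
abbrev simpleRoot (i : B) : B →₀ ℝ := Finsupp.single i 1

theorem coroot_simpleRoot (i j : B) : coroot M i (simpleRoot j) = -(2 * cos (π / M i j)) := by
  simp [coroot]

theorem coroot_simpleRoot_self (i : B) : coroot M i (simpleRoot i) = 2 := by
  simp [coroot]

variable (M) in
/-- The simple reflection of the geometric representation. -/
def rootReflection (i : B) : (B →₀ ℝ) ≃ₗ[ℝ] (B →₀ ℝ) :=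
  Module.reflection (coroot_simpleRoot_self (M := M) i)

theorem rootReflection_apply (i : B) (v : B →₀ ℝ) :
    rootReflection M i v = v - coroot M i v • simpleRoot i :=
  Module.reflection_apply _ _

/-- The braid relations: the powers of a product of two reflections are given by Chebyshev
polynomials evaluated at `2 cos (2 π / m)`. -/
theorem isLiftable_rootReflection : M.IsLiftable (rootReflection M) := by
  intro i j
  ext1 z
  by_cases hij : i = j
  · subst hij
    rw [M.diagonal, pow_one, LinearEquiv.mul_apply]
    exact Module.involutive_reflection _ z
  have hM := M.off_diagonal i j hij
  have hsymm := M.symmetric i j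
  by_cases h0 : M i j = 0
  · rw [h0]; simp
  set m := M i j with hm
  set θ : ℝ := π / m with hθ
  have hm0 : (m : ℝ) ≠ 0 := by exact_mod_cast h0
  have hmθ : m * θ = π := by rw [hθ]; field_simp
  have ht : coroot M i (simpleRoot j) * coroot M j (simpleRoot i) - 2 = 2 * cos (2 * θ) := by
    rw [coroot_simpleRoot, coroot_simpleRoot, ← hsymm, ← hm, cos_two_mul]
    ring
  have key := Module.reflection_mul_reflection_pow_apply
    (coroot_simpleRoot_self (M := M) i) (coroot_simpleRoot_self (M := M) j) m z _ ht.symm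
  change ((rootReflection M i * rootReflection M j) ^ m) z = _ at key
  rw [key]
  by_cases h2 : m = 2
  · have hθ2 : θ = π / 2 := by rw [hθ, h2]; norm_num
    have e1 : coroot M i (simpleRoot j) = 0 := by
      rw [coroot_simpleRoot, ← hm, ← hθ, hθ2]; simp
    have e2 : coroot M j (simpleRoot i) = 0 := by
      rw [coroot_simpleRoot, ← hsymm, ← hθ, hθ2]; simp
    rw [e1, e2, h2, hθ2, mul_div_cancel₀ π two_ne_zero, cos_pi]
    norm_num
    abel
  have hm3 : 3 ≤ m := by omega
  have hm3' : (3 : ℝ) ≤ m := by exact_mod_cast hm3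
  have hsin : sin (2 * θ) ≠ 0 := by
    refine (sin_pos_of_pos_of_lt_pi (by positivity) ?_).ne'
    rw [hθ, ← mul_div_assoc, div_lt_iff₀ (by linarith)]
    nlinarith [pi_pos]
  have hS : ∀ n : ℤ, ((Chebyshev.S ℝ n).eval (2 * cos (2 * θ))) * sin (2 * θ) =
      sin ((n + 1) * (2 * θ)) := fun n => Chebyshev.S_two_mul_real_cos _ n
  rcases Nat.even_or_odd' m with ⟨k, hk | hk⟩
  · have d1 : ((m : ℤ) - 2) / 2 = (k : ℤ) - 1 := by omega
    have d2 : ((m : ℤ) - 1) / 2 = (k : ℤ) - 1 := by omega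
    have hz : (Chebyshev.S ℝ ((k : ℤ) - 1)).eval (2 * cos (2 * θ)) = 0 := by
      have := hS ((k : ℤ) - 1)
      push_cast at this
      rw [show ((k : ℝ) - 1 + 1) * (2 * θ) = m * θ by rw [hk]; push_cast; ring, hmθ, sin_pi] at this
      exact (mul_eq_zero.1 this).resolve_right hsin
    rw [d1, d2, hz]
    simp
  · have d1 : ((m : ℤ) - 2) / 2 = (k : ℤ) - 1 := by omega
    have d2 : ((m : ℤ) - 1) / 2 = (k : ℤ) := by omega
    have d3 : ((m : ℤ) - 3) / 2 = (k : ℤ) - 1 := by omega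
    have d4 : (m : ℤ) / 2 = (k : ℤ) := by omega
    have hz : (Chebyshev.S ℝ (k : ℤ)).eval (2 * cos (2 * θ)) +
        (Chebyshev.S ℝ ((k : ℤ) - 1)).eval (2 * cos (2 * θ)) = 0 := by
      have h1 := hS ((k : ℤ) - 1)
      have h2 := hS k
      push_cast at h1 h2
      rw [show ((k : ℝ) - 1 + 1) * (2 * θ) = π - θ by rw [← hmθ, hk]; push_cast; ring,
        sin_pi_sub] at h1
      rw [show ((k : ℝ) + 1) * (2 * θ) = θ + π by rw [← hmθ, hk]; push_cast; ring,
        sin_add_pi] at h2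
      have : ((Chebyshev.S ℝ (k : ℤ)).eval (2 * cos (2 * θ)) +
        (Chebyshev.S ℝ ((k : ℤ) - 1)).eval (2 * cos (2 * θ))) * sin (2 * θ) = 0 := by
        rw [add_mul, h1, h2]; ring
      exact (mul_eq_zero.1 this).resolve_right hsin
    rw [d1, d2, d3, d4, hz]
    simp

end Geometric

section Positivity

open Real

variable {B W : Type u} [Group W] {M : CoxeterMatrix B} (cs : CoxeterSystem M W)

/-- The geometric representation. -/
def rootRep : W →* ((B →₀ ℝ) ≃ₗ[ℝ] (B →₀ ℝ)) := cs.lift ⟨_, isLiftable_rootReflection (M := M)⟩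

theorem rootRep_simple (i : B) (v : B →₀ ℝ) :
    cs.rootRep (cs.simple i) v = v - coroot M i v • simpleRoot i := by
  rw [rootRep, lift_apply_simple, rootReflection_apply]

theorem rootRep_simple_self (i : B) :
    cs.rootRep (cs.simple i) (simpleRoot i) = -simpleRoot i := by
  rw [rootRep_simple, coroot_simpleRoot_self, two_smul]; abel

/-- The coefficients of the roots of a dihedral parabolic subgroup. -/
theorem rootRep_alternatingWord (i j : B) (n : ℕ) :
    cs.rootRep (cs.wordProd (alternatingWord i j n)) (simpleRoot i) =
      if Even n then dihedralCoeff (2 * cos (π / M i j)) (n + 1) • simpleRoot i +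
          dihedralCoeff (2 * cos (π / M i j)) n • simpleRoot j
        else dihedralCoeff (2 * cos (π / M i j)) n • simpleRoot i +
          dihedralCoeff (2 * cos (π / M i j)) (n + 1) • simpleRoot j := by
  induction n with
  | zero => simp [dihedralCoeff, alternatingWord]
  | succ n ih =>
    rw [alternatingWord_succ', wordProd_cons, map_mul, LinearEquiv.mul_apply, ih]
    have hji := coroot_simpleRoot (M := M) j i
    rw [← M.symmetric i j] at hji
    by_cases hn : Even n
    · rw [if_pos hn, if_pos hn, if_neg (by simpa [Nat.even_add_one] using hn), map_add, map_smul,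
        map_smul, rootRep_simple_self, rootRep_simple, hji, dihedralCoeff]
      module
    · rw [if_neg hn, if_neg hn, if_pos (by simpa [Nat.even_add_one] using hn), map_add, map_smul,
        map_smul, rootRep_simple_self, rootRep_simple, coroot_simpleRoot, dihedralCoeff]
      module

/-- A reduced word in two letters is alternating. -/
theorem eq_alternatingWord {i j : B} {ω : List B} (hω : ∀ k ∈ ω, k ∈ ({i, j} : Set B))
    (hred : cs.IsReduced (ω ++ [i])) : ω = alternatingWord i j ω.length := by
  induction ω using List.reverseRecOn generalizing i j with
  | nil => rfl
  | append_singleton ω k ih =>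
    have hk : k = i ∨ k = j := hω k (by simp)
    have hki : k ≠ i := by
      rintro rfl
      have h1 := hred.eq
      simp only [wordProd_append, wordProd_singleton, simple_mul_simple_cancel_right,
        List.length_append, List.length_singleton] at h1
      have := cs.length_wordProd_le ω
      omega
    obtain rfl := hk.resolve_left hki
    have hred' : cs.IsReduced (ω ++ [k]) := by
      have := hred.take (ω ++ [k]).length
      rwa [List.take_left'] at this
      rfl
    have := ih (i := k) (j := i) (fun l hl => by
      have := hω l (by simp [hl])
      simpa [or_comm] using this) hred'
    rw [List.length_append, List.length_singleton, alternatingWord_succ, List.concat_eq_append,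
      ← this]

/-- If `ℓ(w s_i) > ℓ(w)`, then `w` maps the simple root `α_i` to a positive root. -/
theorem rootRep_nonneg {w : W} {i : B} (h : ¬ cs.IsRightDescent w i) :
    0 ≤ cs.rootRep w (simpleRoot i) := by
  induction hn : cs.length w using Nat.strong_induction_on generalizing w i with
  | _ n ih =>
  subst hn
  by_cases hw : w = 1
  · subst hw
    simp [simpleRoot]
  obtain ⟨j, hj⟩ := cs.exists_rightDescent_of_ne_one hw
  have hij : i ≠ j := by rintro rfl; exact h hj
  set J : Set B := {i, j} with hJ
  set v := cs.minRep J w with hv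
  have hvJ : v ∈ cs.minReps J := cs.minRep_mem J w
  obtain ⟨ω, hωJ, hω, hu⟩ := cs.exists_isReduced_of_mem_parabolic (cs.minRep_inv_mul_mem J w)
  rw [← hv] at hu
  have hw' : w = v * cs.wordProd ω := by rw [← hu]; group
  have hωmem := cs.wordProd_mem_parabolic hωJ
  have hlen := cs.length_mul_of_mem_minReps hvJ hωmem
  rw [← hw', hω.eq] at hlen
  have hvw : cs.length v < cs.length w := by
    rcases Nat.eq_zero_or_pos ω.length with h0 | h0
    · rw [List.length_eq_zero_iff] at h0
      rw [h0, wordProd_nil, mul_one] at hw'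
      exact absurd (hw' ▸ hj) (cs.minReps_not_isRightDescent hvJ (by simp [hJ]))
    · omega
  have h1 := ih _ hvw (cs.minReps_not_isRightDescent hvJ (i := i) (by simp [hJ])) rfl
  have h2 := ih _ hvw (cs.minReps_not_isRightDescent hvJ (i := j) (by simp [hJ])) rfl
  have hred : cs.IsReduced (ω ++ [i]) := by
    have h3 := cs.length_mul_of_mem_minReps hvJ
      (mul_mem hωmem (cs.simple_mem_parabolic (J := J) (i := i) (by simp [hJ])))
    rw [← mul_assoc, ← hw', cs.not_isRightDescent_iff.1 h] at h3
    rw [IsReduced, wordProd_append, wordProd_singleton, List.length_append, List.length_singleton]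
    omega
  have halt := cs.eq_alternatingWord hωJ hred
  -- `w = v u` with `u` in the dihedral subgroup and `v` shorter than `w`. As `u s_i` is reduced and
  -- alternating, the coefficients of `u α_i` are nonnegative.
  have hm : M i j = 0 ∨ ω.length + 1 ≤ M i j := by
    by_contra! hc
    refine cs.not_isReduced_alternatingWord j i (m := ω.length + 1)
      (by rw [← M.symmetric]; exact hc.1) (by rw [← M.symmetric]; omega) ?_
    rw [alternatingWord_succ, ← halt, List.concat_eq_append]
    exact hred
  have hM := M.off_diagonal i j hij
  have c1 := dihedralCoeff_nonneg hM hm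
  have c2 := dihedralCoeff_nonneg hM (n := ω.length) (hm.imp_right fun h => by omega)
  rw [hw', map_mul, LinearEquiv.mul_apply, halt, rootRep_alternatingWord]
  split_ifs
  · rw [map_add, map_smul, map_smul]
    exact add_nonneg (smul_nonneg c1 h1) (smul_nonneg c2 h2)
  · rw [map_add, map_smul, map_smul]
    exact add_nonneg (smul_nonneg c2 h1) (smul_nonneg c1 h2)

/-- If `ℓ(w s_i) < ℓ(w)`, then `w` maps the simple root `α_i` to a negative root. -/
theorem rootRep_nonpos {w : W} {i : B} (h : cs.IsRightDescent w i) :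
    cs.rootRep w (simpleRoot i) ≤ 0 := by
  have := cs.rootRep_nonneg (cs.isRightDescent_iff_not_isRightDescent_mul.1 h)
  rw [map_mul, LinearEquiv.mul_apply, rootRep_simple_self, map_neg] at this
  exact neg_nonneg.1 this

theorem not_isRightDescent_of_pos {w : W} {i k : B} (h : 0 < cs.rootRep w (simpleRoot i) k) :
    ¬ cs.IsRightDescent w i := fun h' => absurd (cs.rootRep_nonpos h' k) (not_le.2 h)

theorem not_isRightDescent_iff_nonneg {w : W} {i : B} :
    ¬ cs.IsRightDescent w i ↔ 0 ≤ cs.rootRep w (simpleRoot i) := by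
  refine ⟨cs.rootRep_nonneg, fun h h' => ?_⟩
  have h0 := le_antisymm (cs.rootRep_nonpos h') h
  rw [LinearEquiv.map_eq_zero_iff] at h0
  simp [simpleRoot] at h0

end Positivity

/-! ### Adding a node to the Coxeter diagram -/

section Extension

open Real

variable {B W : Type u} [Group W] {M : CoxeterMatrix B} (cs : CoxeterSystem M W)

/-- The Coxeter matrix obtained from `M` by adding a node `none` with `m(none, s) = n` for all
`s : B`. -/
def extendMatrix (M : CoxeterMatrix B) (n : ℕ) (hn : n ≠ 1) : CoxeterMatrix (Option B) where
  M := fun s t => match s, t with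
    | none, none => 1
    | none, some _ => n
    | some _, none => n
    | some i, some j => M i j
  isSymm := by
    ext s t
    rcases s with _ | s <;> rcases t with _ | t <;> simp [Matrix.transpose, M.symmetric]
  diagonal s := by rcases s with _ | s <;> simp
  off_diagonal s t h := by
    rcases s with _ | s <;> rcases t with _ | t
    · exact absurd rfl h
    · exact hn
    · exact hn
    · exact M.off_diagonal s t fun e => h (by rw [e])

variable {n : ℕ} (hn : n ≠ 1)

/-- The Coxeter system of the extended Coxeter matrix. -/
def extendSystem (M : CoxeterMatrix B) {n : ℕ} (hn : n ≠ 1) :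
    CoxeterSystem (extendMatrix M n hn) (extendMatrix M n hn).Group :=
  (extendMatrix M n hn).toCoxeterSystem

theorem isLiftable_extendSystem :
    M.IsLiftable fun i => (extendSystem M hn).simple (some i) := fun i j =>
  (extendSystem M hn).simple_mul_simple_pow (some i) (some j)

/-- The canonical homomorphism from `W` to the extended Coxeter group. -/
def extendHom : W →* (extendMatrix M n hn).Group :=
  cs.lift ⟨_, isLiftable_extendSystem hn⟩

theorem extendHom_simple (i : B) :
    cs.extendHom hn (cs.simple i) = (extendSystem M hn).simple (some i) :=
  cs.lift_apply_simple (isLiftable_extendSystem hn) i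

theorem extendHom_wordProd (ω : List B) :
    cs.extendHom hn (cs.wordProd ω) = (extendSystem M hn).wordProd (ω.map some) := by
  induction ω with
  | nil => simp
  | cons i ω ih =>
    rw [wordProd_cons, map_mul, extendHom_simple, ih, List.map_cons, wordProd_cons]

/-- The inclusion of the geometric representation of `W` in that of the extended group. -/
def extendRoot : (B →₀ ℝ) →ₗ[ℝ] (Option B →₀ ℝ) := Finsupp.lmapDomain ℝ ℝ some

theorem extendRoot_simpleRoot (i : B) : extendRoot (simpleRoot i) = simpleRoot (some i) := by
  simp [extendRoot, simpleRoot]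

theorem extendRoot_apply_some (v : B →₀ ℝ) (i : B) : extendRoot v (some i) = v i := by
  simp [extendRoot, Finsupp.mapDomain_apply (Option.some_injective B)]

theorem extendRoot_apply_none (v : B →₀ ℝ) : extendRoot v none = 0 := by
  simp [extendRoot, Finsupp.mapDomain_of_notMem_range]

theorem coroot_extendRoot (i : B) (v : B →₀ ℝ) :
    coroot (extendMatrix M n hn) (some i) (extendRoot v) = coroot M i v := by
  suffices coroot (extendMatrix M n hn) (some i) ∘ₗ extendRoot = coroot M i from
    DFunLike.congr_fun this v
  refine Finsupp.lhom_ext' fun j => LinearMap.ext_ring ?_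
  have h1 := coroot_simpleRoot (M := extendMatrix M n hn) (some i) (some j)
  have h2 := coroot_simpleRoot (M := M) i j
  rw [← extendRoot_simpleRoot] at h1
  exact h1.trans h2.symm

theorem rootRep_extendHom (w : W) (v : B →₀ ℝ) :
    (extendSystem M hn).rootRep (cs.extendHom hn w) (extendRoot v) =
      extendRoot (cs.rootRep w v) := by
  induction w using cs.simple_induction_left with
  | one => simp
  | mul_simple_left w i ih =>
    rw [map_mul, map_mul, map_mul, LinearEquiv.mul_apply, LinearEquiv.mul_apply, ih,
      extendHom_simple, rootRep_simple, rootRep_simple, map_sub, map_smul, coroot_extendRoot,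
      extendRoot_simpleRoot]

theorem rootRep_extendHom_apply_none (w : W) (v : Option B →₀ ℝ) :
    (extendSystem M hn).rootRep (cs.extendHom hn w) v none = v none := by
  induction w using cs.simple_induction_left with
  | one => simp
  | mul_simple_left w i ih =>
    rw [map_mul, map_mul, LinearEquiv.mul_apply, extendHom_simple, rootRep_simple,
      Finsupp.sub_apply, ih]
    simp [simpleRoot]

theorem isRightDescent_extendHom {w : W} {i : B} :
    (extendSystem M hn).IsRightDescent (cs.extendHom hn w) (some i) ↔ cs.IsRightDescent w i := by
  rw [← not_iff_not, not_isRightDescent_iff_nonneg, not_isRightDescent_iff_nonneg,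
    ← extendRoot_simpleRoot, rootRep_extendHom]
  constructor
  · intro h j
    have := h (some j)
    rwa [extendRoot_apply_some] at this
  · rintro h (_ | j)
    · rw [extendRoot_apply_none]; rfl
    · rw [extendRoot_apply_some]; exact h j

/-- The map `extendHom` preserves lengths because, by the positivity of roots, it preserves right
descents. -/
theorem length_extendHom (w : W) :
    (extendSystem M hn).length (cs.extendHom hn w) = cs.length w := by
  induction hl : cs.length w using Nat.strong_induction_on generalizing w with
  | _ l ih =>
  by_cases hw : w = 1
  · subst hw
    rw [← hl]; simp
  · obtain ⟨i, hi⟩ := cs.exists_rightDescent_of_ne_one hw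
    have h1 := (extendSystem M hn).isRightDescent_iff.1 ((cs.isRightDescent_extendHom hn).2 hi)
    have h2 := cs.isRightDescent_iff.1 hi
    rw [← cs.extendHom_simple hn, ← map_mul, ih _ (hl ▸ hi) _ rfl] at h1
    omega

theorem extendHom_injective : Function.Injective (cs.extendHom hn) := by
  refine (injective_iff_map_eq_one (cs.extendHom hn)).2 fun w hw => ?_
  rw [← cs.length_eq_zero_iff, ← cs.length_extendHom hn, hw, length_one]

/-- The embedding `w ↦ w s` of `W`, where `s` is the new simple reflection. -/
def extendMap (w : W) : (extendMatrix M n hn).Group :=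
  cs.extendHom hn w * (extendSystem M hn).simple none

theorem extendMap_injective : Function.Injective (cs.extendMap hn) :=
  fun _ _ h => cs.extendHom_injective hn (mul_right_cancel h)

theorem simple_mul_extendMap (i : B) (w : W) :
    (extendSystem M hn).simple (some i) * cs.extendMap hn w =
      cs.extendMap hn (cs.simple i * w) := by
  rw [extendMap, extendMap, map_mul, extendHom_simple, mul_assoc]

/-- The coefficient of the new simple root is invariant under `W`, so it is `1` at the image of the
new simple root, which hence is positive. -/
theorem length_extendMap (w : W) :
    (extendSystem M hn).length (cs.extendMap hn w) = cs.length w + 1 := by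
  have : ¬ (extendSystem M hn).IsRightDescent (cs.extendHom hn w) none := by
    refine not_isRightDescent_of_pos _ (k := none) ?_
    rw [rootRep_extendHom_apply_none]
    simp [simpleRoot]
  rw [extendMap, (extendSystem M hn).not_isRightDescent_iff.1 this, length_extendHom]

theorem isLeftDescent_extendMap {w : W} {i : B} :
    (extendSystem M hn).IsLeftDescent (cs.extendMap hn w) (some i) ↔ cs.IsLeftDescent w i := by
  rw [IsLeftDescent, IsLeftDescent, simple_mul_extendMap, length_extendMap, length_extendMap]
  omega

/-- The image under `w s` of an old simple root `α_i` has coefficient `2 cos (π / n) > 0` at the new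
simple root, hence it is positive. -/
theorem extendMap_mem_minReps (hn2 : n ≠ 2) (w : W) :
    cs.extendMap hn w ∈ (extendSystem M hn).minReps {none}ᶜ := by
  rintro (_ | i) hi
  · simp at hi
  have : ¬ (extendSystem M hn).IsRightDescent (cs.extendMap hn w) (some i) := by
    refine not_isRightDescent_of_pos _ (k := none) ?_
    rw [extendMap, map_mul, LinearEquiv.mul_apply, rootRep_extendHom_apply_none, rootRep_simple,
      coroot_simpleRoot]
    have hM : (extendMatrix M n hn) none (some i) = n := rfl
    rw [hM]
    have hcos : 0 < cos (π / n) := by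
      by_cases h0 : n = 0
      · simp [h0]
      · have h3 : (3 : ℝ) ≤ n := by exact_mod_cast (by omega : 3 ≤ n)
        have : 0 < π / n := by positivity
        refine cos_pos_of_mem_Ioo ⟨by linarith [pi_pos], ?_⟩
        rw [div_lt_div_iff₀ (by linarith) two_pos]
        nlinarith [pi_pos]
    simp [simpleRoot, hcos]
  have h := (extendSystem M hn).not_isRightDescent_iff.1 this
  omega

theorem isReflection_extendHom {t : W} (ht : cs.IsReflection t) :
    (extendSystem M hn).IsReflection (cs.extendHom hn t) := by
  obtain ⟨w, i, rfl⟩ := ht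
  exact ⟨cs.extendHom hn w, some i, by rw [map_mul, map_mul, extendHom_simple, map_inv]⟩

theorem extendMap_bruhatLE {a b : W} (h : cs.BruhatLE a b) :
    (extendSystem M hn).BruhatLE (cs.extendMap hn a) (cs.extendMap hn b) := by
  induction h with
  | refl => exact bruhatLE_refl _ _
  | @tail c d _ hcd ih =>
    obtain ⟨t, ht, rfl, hlt⟩ := hcd
    refine ih.trans ?_
    have ht' := (cs.isReflection_extendHom hn ht).conj ((extendSystem M hn).simple none)
    have e : cs.extendMap hn (c * t) = cs.extendMap hn c *
        ((extendSystem M hn).simple none * cs.extendHom hn t *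
          ((extendSystem M hn).simple none)⁻¹) := by
      simp [extendMap, ← mul_assoc]
    rw [e]
    refine (extendSystem M hn).bruhatLE_mul_reflection ht' ?_
    rw [← e, length_extendMap, length_extendMap]
    omega

theorem bruhatLE_of_erase {ω : List B} (hω : cs.IsReduced ω) {j : ℕ} (hj : j < ω.length) :
    cs.BruhatLE (cs.wordProd (ω.eraseIdx j)) (cs.wordProd ω) := by
  have h1 := cs.wordProd_mul_getD_rightInvSeq ω j
  have hj' : j < (cs.rightInvSeq ω).length := by simpa using hj
  have hmem : (cs.rightInvSeq ω)[j] ∈ cs.rightInvSeq ω := List.getElem_mem _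
  rw [List.getD_eq_getElem _ _ hj'] at h1
  have ht := cs.isReflection_of_mem_rightInvSeq ω hmem
  have hlt := (cs.isRightInversion_of_mem_rightInvSeq hω hmem).2
  have h2 := cs.bruhatLE_mul_reflection (a := cs.wordProd (ω.eraseIdx j)) ht
  rw [← h1, mul_assoc, ht.mul_self, mul_one] at h2
  rw [← h1]
  exact h2 hlt

/-- Everything below an element of `W` is in `W`: a step down in the Bruhat order deletes a
letter. -/
theorem exists_of_bruhatLE_extendHom {b : W} {z : (extendMatrix M n hn).Group}
    (h : (extendSystem M hn).BruhatLE z (cs.extendHom hn b)) :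
    ∃ c, cs.BruhatLE c b ∧ cs.extendHom hn c = z := by
  induction h using Relation.ReflTransGen.head_induction_on with
  | refl => exact ⟨b, cs.bruhatLE_refl b, rfl⟩
  | @head z y hzy _ ih =>
    obtain ⟨t, ht, rfl, hlt⟩ := hzy
    obtain ⟨c, hc, hcy⟩ := ih
    obtain ⟨ω, hω, rfl⟩ := cs.exists_isReduced c
    have hz : z = z * t * t := by rw [mul_assoc, ht.mul_self, mul_one]
    have hword : z * t = (extendSystem M hn).wordProd (ω.map some) := by
      rw [← hcy, extendHom_wordProd]
    obtain ⟨j, hj, he⟩ := (extendSystem M hn).strong_exchange (ω := ω.map some) ht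
      (by rw [← hword, ← hz]; exact hlt)
    rw [← hword, ← hz] at he
    rw [List.length_map] at hj
    refine ⟨_, (cs.bruhatLE_of_erase hω hj).trans hc, ?_⟩
    rw [he, List.eraseIdx_map, ← cs.extendHom_wordProd hn]

/-- Everything below `b s` is of the form `c s` or `c` with `c ≤ b`. -/
theorem exists_of_bruhatLE_extendMap {b : W} {z : (extendMatrix M n hn).Group}
    (h : (extendSystem M hn).BruhatLE z (cs.extendMap hn b)) :
    ∃ c, cs.BruhatLE c b ∧ (z = cs.extendMap hn c ∨ z = cs.extendHom hn c) := by
  induction h using Relation.ReflTransGen.head_induction_on with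
  | refl => exact ⟨b, cs.bruhatLE_refl b, Or.inl rfl⟩
  | @head z y hzy _ ih =>
    obtain ⟨c, hc, hcy | rfl⟩ := ih
    · obtain ⟨t, ht, rfl, hlt⟩ := hzy
      obtain ⟨ω, hω, rfl⟩ := cs.exists_isReduced c
      have hz : z = z * t * t := by rw [mul_assoc, ht.mul_self, mul_one]
      have hword : z * t = (extendSystem M hn).wordProd (ω.map some ++ [none]) := by
        rw [hcy, extendMap, extendHom_wordProd, wordProd_append, wordProd_singleton]
      obtain ⟨j, hj, he⟩ := (extendSystem M hn).strong_exchange (ω := ω.map some ++ [none]) ht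
        (by rw [← hword, ← hz]; exact hlt)
      rw [← hword, ← hz] at he
      simp only [List.length_append, List.length_map, List.length_singleton] at hj
      rcases lt_or_ge j ω.length with hj' | hj'
      · refine ⟨_, (cs.bruhatLE_of_erase hω hj').trans hc, Or.inl ?_⟩
        rw [he, List.eraseIdx_append_of_lt_length (by simpa using hj'), List.eraseIdx_map,
          wordProd_append, wordProd_singleton, ← cs.extendHom_wordProd hn, extendMap]
      · refine ⟨_, hc, Or.inr ?_⟩
        obtain rfl : j = ω.length := by omega
        rw [he, List.eraseIdx_append_of_length_le (by simp), List.length_map, Nat.sub_self]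
        simp [extendHom_wordProd]
    · obtain ⟨d, hd, rfl⟩ := cs.exists_of_bruhatLE_extendHom hn (.single hzy)
      exact ⟨d, hd.trans hc, Or.inr rfl⟩

theorem extendMap_ne_extendHom (a c : W) : cs.extendMap hn a ≠ cs.extendHom hn c := by
  intro h
  have h1 : cs.extendMap hn (c⁻¹ * a) = 1 := by
    rw [extendMap] at h ⊢
    rw [map_mul, mul_assoc, h, map_inv, inv_mul_cancel]
  have := cs.length_extendMap hn (c⁻¹ * a)
  rw [h1, length_one] at this
  omega

theorem extendMap_bruhatLE_iff {a b : W} :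
    (extendSystem M hn).BruhatLE (cs.extendMap hn a) (cs.extendMap hn b) ↔ cs.BruhatLE a b := by
  refine ⟨fun h => ?_, cs.extendMap_bruhatLE hn⟩
  obtain ⟨c, hc, h | h⟩ := cs.exists_of_bruhatLE_extendMap hn h
  · rwa [cs.extendMap_injective hn h]
  · exact absurd h (cs.extendMap_ne_extendHom hn a c)

theorem exists_of_mem_bruhatInterval_extendMap {a b : W} {z : (extendMatrix M n hn).Group}
    (h : z ∈ (extendSystem M hn).bruhatInterval (cs.extendMap hn a) (cs.extendMap hn b)) :
    ∃ c ∈ cs.bruhatInterval a b, cs.extendMap hn c = z := by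
  obtain ⟨c, hc, rfl | rfl⟩ := cs.exists_of_bruhatLE_extendMap hn h.2
  · exact ⟨c, ⟨(cs.extendMap_bruhatLE_iff hn).1 h.1, hc⟩, rfl⟩
  · obtain ⟨d, _, hd⟩ := cs.exists_of_bruhatLE_extendHom hn h.1
    exact absurd hd.symm (cs.extendMap_ne_extendHom hn a d)

end Extension

/-! ### Kazhdan–Lusztig polynomials as parabolic ones of a maximal quotient -/

section MaximalQuotient

variable {B W : Type u} [Group W] {M : CoxeterMatrix B} (cs : CoxeterSystem M W)
variable {n : ℕ} (hn : n ≠ 1)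

theorem bijOn_extendMap_bruhatInterval (a b : W) :
    Set.BijOn (cs.extendMap hn) (cs.bruhatInterval a b)
      ((extendSystem M hn).bruhatInterval (cs.extendMap hn a) (cs.extendMap hn b)) :=
  ⟨fun _ hz => ⟨cs.extendMap_bruhatLE hn hz.1, cs.extendMap_bruhatLE hn hz.2⟩,
    (cs.extendMap_injective hn).injOn,
    fun _ hz => cs.exists_of_mem_bruhatInterval_extendMap hn hz⟩

theorem isIntervalIso_extendMap (a b : W) :
    IsIntervalIso cs (extendSystem M hn) (cs.extendMap hn) a b
      (cs.extendMap hn a) (cs.extendMap hn b) :=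
  ⟨cs.bijOn_extendMap_bruhatInterval hn a b, fun _ _ _ _ => (cs.extendMap_bruhatLE_iff hn).symm⟩

/-- All of the interval `[a s, b s]` lies in the maximal quotient: it is the image of `[a, b]`. -/
theorem quotientInterval_extendMap (hn2 : n ≠ 2) (a b : W) :
    (extendSystem M hn).quotientInterval {none}ᶜ (cs.extendMap hn a) (cs.extendMap hn b) =
      (extendSystem M hn).bruhatInterval (cs.extendMap hn a) (cs.extendMap hn b) := by
  refine Set.Subset.antisymm (fun z hz => hz.2) fun z hz => ⟨?_, hz⟩
  obtain ⟨c, _, rfl⟩ := cs.exists_of_mem_bruhatInterval_extendMap hn hz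
  exact cs.extendMap_mem_minReps hn hn2 c

theorem isRFamily_extendMap (hn2 : n ≠ 2) {x : ℤ[X]} (hx : x = -1 ∨ x = X) :
    cs.IsRFamily fun a b => (extendSystem M hn).parabolicRPoly {none}ᶜ x
      (cs.extendMap hn a) (cs.extendMap hn b) := by
  have h := (extendSystem M hn).isParabolicRFamily_parabolicRPoly {none}ᶜ (quadratic_of_type hx)
  have hmem := cs.extendMap_mem_minReps hn hn2
  refine ⟨fun a b hab => h.eq_zero _ _ fun h' => hab ((cs.extendMap_bruhatLE_iff hn).1 h'.2.2),
    fun a => h.diag _ (hmem a), fun a b hab hne i hb ha => ?_, fun a b hab hne i hb ha => ?_⟩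
  · have := h.descent _ (hmem a) _ (hmem b) (cs.extendMap_bruhatLE hn hab)
      ((cs.extendMap_injective hn).ne hne) (some i) ((cs.isLeftDescent_extendMap hn).2 hb)
      ((cs.isLeftDescent_extendMap hn).2 ha)
    rwa [simple_mul_extendMap, simple_mul_extendMap] at this
  · have := h.ascent_mem _ (hmem a) _ (hmem b) (cs.extendMap_bruhatLE hn hab)
      ((cs.extendMap_injective hn).ne hne) (some i) ((cs.isLeftDescent_extendMap hn).2 hb)
      (mt (cs.isLeftDescent_extendMap hn).1 ha) (by rw [simple_mul_extendMap]; exact hmem _)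
    rwa [simple_mul_extendMap, simple_mul_extendMap] at this

theorem parabolicRPoly_extendMap (hn2 : n ≠ 2) {x : ℤ[X]} (hx : x = -1 ∨ x = X) (a b : W) :
    (extendSystem M hn).parabolicRPoly {none}ᶜ x (cs.extendMap hn a) (cs.extendMap hn b) =
      cs.rPoly a b := by
  have h := ((cs.isRFamily_iff x _).1 (cs.isRFamily_extendMap hn hn2 hx)).unique
    (cs.isParabolicRFamily_parabolicRPoly ∅ (quadratic_of_type hx))
  rw [cs.rPoly_eq_parabolicRPoly x, ← h]

theorem isKLFamily_extendMap (hn2 : n ≠ 2) {x : ℤ[X]} (hx : x = -1 ∨ x = X) :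
    cs.IsKLFamily fun a b => (extendSystem M hn).parabolicKLPoly {none}ᶜ x
      (cs.extendMap hn a) (cs.extendMap hn b) := by
  have h := (extendSystem M hn).isParabolicKLFamily_parabolicKLPoly {none}ᶜ hx
  have hmem := cs.extendMap_mem_minReps hn hn2
  have hlen : ∀ a b, (extendSystem M hn).length (cs.extendMap hn b) -
      (extendSystem M hn).length (cs.extendMap hn a) = cs.length b - cs.length a := by
    intro a b
    rw [length_extendMap, length_extendMap]
    omega
  refine ⟨fun a b hab => h.eq_zero _ _ fun h' => hab ((cs.extendMap_bruhatLE_iff hn).1 h'.2.2),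
    fun a => h.diag _ (hmem a), fun a b hab hne => ?_, fun a b hab => ?_⟩
  · rw [← hlen]
    exact h.degree _ (hmem a) _ (hmem b) (cs.extendMap_bruhatLE hn hab)
      ((cs.extendMap_injective hn).ne hne)
  · have := h.inversion _ (hmem a) _ (hmem b) (cs.extendMap_bruhatLE hn hab)
    rw [hlen, quotientInterval_extendMap cs hn hn2] at this
    rw [this]
    refine (finsum_mem_eq_of_bijOn _ (cs.bijOn_extendMap_bruhatInterval hn a b) fun z _ => ?_).symm
    rw [parabolicRPoly_extendMap cs hn hn2 hx]

/-- Ordinary Kazhdan–Lusztig polynomials are parabolic ones for a maximal quotient of the extended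
system. -/
theorem parabolicKLPoly_extendMap (hn2 : n ≠ 2) {x : ℤ[X]} (hx : x = -1 ∨ x = X) (a b : W) :
    (extendSystem M hn).parabolicKLPoly {none}ᶜ x (cs.extendMap hn a) (cs.extendMap hn b) =
      cs.klPoly a b := by
  have h := ((cs.isKLFamily_iff x _).1 (cs.isKLFamily_extendMap hn hn2 hx)).unique hx
    (cs.isParabolicKLFamily_parabolicKLPoly ∅ hx)
  rw [cs.klPoly_eq_parabolicKLPoly x, ← h]

end MaximalQuotient

/-- If the class `C` is stable under adding a node joined to all others by edges with the same
label, then combinatorial invariance for maximal quotients implies combinatorial invariance. -/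
theorem lusztigDyerConjecture_of_maximalQuotientConjecture
    {C : ∀ ⦃B : Type u⦄, CoxeterMatrix B → Prop} {n : ℕ} (hn : n ≠ 1) (hn2 : n ≠ 2)
    (hC : ∀ (B : Type u) (M : CoxeterMatrix B), C M → C (extendMatrix M n hn))
    (h : MaximalQuotientConjecture.{u} C) : LusztigDyerConjecture.{u} C := by
  rintro B B' W W' _ _ M M' cs cs' hM hM' a b a' b' hab hab' ⟨Φ⟩
  obtain ⟨Ψ₁⟩ := (cs.isIntervalIso_extendMap hn a b).nonempty_relIso
  obtain ⟨Ψ₂⟩ := (cs'.isIntervalIso_extendMap hn a' b').nonempty_relIso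
  have hiso : (extendSystem M hn).ExtendableIso (extendSystem M' hn) {none}ᶜ {none}ᶜ
      (cs.extendMap hn a) (cs.extendMap hn b) (cs'.extendMap hn a') (cs'.extendMap hn b') := by
    let Θ := (Ψ₁.symm.trans Φ).trans Ψ₂
    have e₁ := quotientInterval_extendMap cs hn hn2 a b
    have e₂ := quotientInterval_extendMap cs' hn hn2 a' b'
    exact ⟨⟨((Equiv.setCongr e₁).trans Θ.toEquiv).trans (Equiv.setCongr e₂.symm),
      fun {y z} => Θ.map_rel_iff (a := ⟨y, y.2.2⟩) (b := ⟨z, z.2.2⟩)⟩, Θ, fun z => rfl⟩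
  have := (h _ _ _ _ _ _ (extendSystem M hn) (extendSystem M' hn) (hC _ _ hM) (hC _ _ hM')
    none none _ (cs.extendMap_mem_minReps hn hn2 a) _ (cs.extendMap_mem_minReps hn hn2 b)
    _ (cs'.extendMap_mem_minReps hn hn2 a') _ (cs'.extendMap_mem_minReps hn hn2 b')
    (cs.extendMap_bruhatLE hn hab) (cs'.extendMap_bruhatLE hn hab') hiso).1
  rwa [parabolicKLPoly_extendMap cs hn hn2 (Or.inl rfl),
    parabolicKLPoly_extendMap cs' hn hn2 (Or.inl rfl)] at this

theorem maximalQuotientConjecture_of_mariettiConjecture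
    {C : ∀ ⦃B : Type u⦄, CoxeterMatrix B → Prop} (h : MariettiConjecture.{u} C) :
    MaximalQuotientConjecture.{u} C :=
  fun B B' W W' _ _ M M' cs cs' hM hM' s s' => h B B' W W' M M' cs cs' hM hM' {s}ᶜ {s'}ᶜ

theorem conjectures_equivalent {C : ∀ ⦃B : Type u⦄, CoxeterMatrix B → Prop} {n : ℕ} (hn : n ≠ 1)
    (hn2 : n ≠ 2) (hC : ∀ (B : Type u) (M : CoxeterMatrix B), C M → C (extendMatrix M n hn)) :
    (LusztigDyerConjecture.{u} C ↔ MariettiConjecture.{u} C) ∧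
      (MariettiConjecture.{u} C ↔ MaximalQuotientConjecture.{u} C) :=
  have h₁ := mariettiConjecture_of_lusztigDyerConjecture (C := C)
  have h₂ := maximalQuotientConjecture_of_mariettiConjecture (C := C)
  have h₃ := lusztigDyerConjecture_of_maximalQuotientConjecture (C := C) hn hn2 hC
  ⟨⟨h₁, fun h => h₃ (h₂ h)⟩, h₂, fun h => h₁ (h₃ h)⟩

theorem ofClass_extendMatrix {E : Set ℕ∞} {n : ℕ} (hn : n ≠ 1)
    (hnE : (if n = 0 then (⊤ : ℕ∞) else (n : ℕ∞)) ∈ E) (B : Type u) (M : CoxeterMatrix B)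
    (hM : OfClass E M) : OfClass E (extendMatrix M n hn) := by
  rintro (_ | s) (_ | t)
  · simp [extendMatrix]
  · exact Or.inl hnE
  · exact Or.inl hnE
  · exact hM s t

end CoxeterSystem

end

theorem theorem2 :
    ((CoxeterSystem.LusztigDyerConjecture.{u} CoxeterSystem.AllSystems ↔
        CoxeterSystem.MariettiConjecture.{u} CoxeterSystem.AllSystems) ∧
      (CoxeterSystem.MariettiConjecture.{u} CoxeterSystem.AllSystems ↔
        CoxeterSystem.MaximalQuotientConjecture.{u} CoxeterSystem.AllSystems)) ∧
    ∀ E : Set ℕ∞, E.Nonempty → (∀ m ∈ E, 3 ≤ m) →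
      ((CoxeterSystem.LusztigDyerConjecture.{u} (CoxeterSystem.OfClass E) ↔
          CoxeterSystem.MariettiConjecture.{u} (CoxeterSystem.OfClass E)) ∧
        (CoxeterSystem.MariettiConjecture.{u} (CoxeterSystem.OfClass E) ↔
          CoxeterSystem.MaximalQuotientConjecture.{u} (CoxeterSystem.OfClass E))) := by
  refine ⟨CoxeterSystem.conjectures_equivalent (n := 3) (by decide) (by decide)
    fun _ _ _ => trivial, fun E ⟨m, hm⟩ hE => ?_⟩
  -- Mathlib encodes the label `∞` by `0`.
  obtain ⟨n, hn1, hn2, hn⟩ : ∃ n : ℕ, n ≠ 1 ∧ n ≠ 2 ∧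
      (if n = 0 then (⊤ : ℕ∞) else (n : ℕ∞)) = m := by
    have h3 := hE m hm
    induction m using ENat.recTopCoe with
    | top => exact ⟨0, by decide, by decide, if_pos rfl⟩
    | coe k =>
      have : 3 ≤ k := by exact_mod_cast h3
      exact ⟨k, by omega, by omega, if_neg (by omega)⟩
  exact CoxeterSystem.conjectures_equivalent hn1 hn2
    (CoxeterSystem.ofClass_extendMatrix hn1 (hn ▸ hm))
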